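/- Let $k$ be a field of characteristic $0$ and $H$ a finite-dimensional symplectic vector space over $k$ with symplectic form $\langle\cdot,\cdot\rangle$ (for instance $H=H_1(\Sigma_{g,1};k)$). Let $\mathsf L(H)=\bigoplus_n \mathsf L_n(H)$ be the free Lie algebra on $H$, graded by bracket length. *Definitions.* - $\mathsf D_s(H)=\ker\big(H\otimes \mathsf L_{s+1}(H)\to \mathsf L_{s+2}(H)\big)$, the kernel of the bracketing map. - $\mathcal T(H)$ is the space of unitrivalent trees with cyclically ordered trivalent vertices and univalent vertices labelled by elements of $H$, modulo AS, IHX and multilinearity; $\mathcal T_s(H)$ is the part with $s$ trivalent vertices. The map $\eta(t)=\sum_x \ell(x)\otimes t_x$ sums over the univalent vertices $x$ of $t$, where $\ell(x)$ is the label of $x$ and $t_x\in\mathsf L_{s+1}(H)$ is represented by the tree rooted at $x$; a vertex with cyclic order (root, $a$, $b$) stands for $[a,b]$. - On $H^{\otimes s}$, the group $\mathbb Z_s$ acts by cyclic rotation, and the dihedral group $D_{2s}$ acts by rotations together with $b(v_1\otimes\cdots\otimes v_s)=(-1)^{s+1}v_s\otimes\cdots\otimes v_1$. Write $[H^{\otimes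 s}]_G$ for coinvariants. The map $b$ induces an involution of $[H^{\otimes s}]_{\mathbb Z_s}$, also denoted $b$. Here $[H^{\otimes s}]_G$ means the quotient of $H^{\otimes s}$ by all $ax-x$ with $a$ the rotation and, for $D_{2s}$, also all $bx-x$; this makes sense for $s=0$ too. - The Enomoto–Satoh trace $\mathrm{Tr}^{\mathrm{ES}}\colon \mathsf D_s(H)\to[H^{\otimes s}]_{\mathbb Z_s}$ is the composition of $\mathsf D_s(H)\subset H\otimes\mathsf L_{s+1}(H)\to H\otimes H^{\otimes(s+1)}$, the contraction of the first two factors, $v\otimes v_0\otimes v_1\otimes\cdots\otimes v_s\mapsto\langle v,v_0\rangle\, v_1\otimes\cdots\otimes v_s$, and the projection to coinvariants. - $C_k\mathscr H(H)$ is spanned by hairy graphs: $k$ unitrivalent trees with cyclically ordered trivalent vertices, numbered $1,\dots,k$, some pairs of whose univalent vertices are joined by directed external edges, the remaining univalent vertices (hairs) being labelled by $H$. The relations are AS and IHX within trees, multilinearity on hairs, a sign for switching the direction of an external edge, and the sign of the permutation for renumbering trees. The map $\partial\colon C_2\mathscr H(H)\to C_1\mathscr H(H)$ sums over the external edges between the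 two trees, joining the trees along the edge, with sign $+1$ if the edge is directed from tree $1$ to tree $2$ and $-1$ otherwise. - $S_2\subset C_2\mathscr H(H)$ is spanned by the graphs that consist of a tripod and another tree (which may have external edges joining it to itself), such that two or three legs of the tripod are joined to the other tree, or two legs of the tripod are joined to each other and the third one is joined to the other tree. Let $\iota\colon\mathcal T(H)\to C_1\mathscr H(H)$ be the inclusion as graphs without external edges, and put $\Omega(H)=C_1\mathscr H(H)/(\partial S_2+\iota\mathcal T(H))$. With $C_{1,r,s}$ and $S_{2,r,s}$ the parts spanned by graphs with $s$ hairs and first Betti number $r$, put $\Omega_{s,r}(H)=C_{1,r,s}\mathscr H(H)/\partial S_{2,r,s}$; there is a natural projection $\Omega(H)\to\Omega_{s,r}(H)$ for $r\ge1$. - $\mathrm{Tr}^{\mathrm C}\colon\mathcal T(H)\to\Omega(H)$ is $\exp(T)\circ\iota$ followed by the projection to $\Omega(H)$. The operator $T$ sums over all unordered pairs of hairs, joining the two hairs by a new external edge, directed from a hair labelled $v$ to a hair labelled $w$, and multiplying by $\langle v,w\rangle$; the choice of direction is immaterial. **Theorem.** 1. For every $s\ge 0$ and every $d\in\mathsf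 D_s(H)$, $b\,\mathrm{Tr}^{\mathrm{ES}}(d)=\mathrm{Tr}^{\mathrm{ES}}(d)$ in $[H^{\otimes s}]_{\mathbb Z_s}$. Moreover, the natural projection $[H^{\otimes s}]_{\mathbb Z_s}\to[H^{\otimes s}]_{D_{2s}}$ restricts to a bijection from the subspace of $b$-invariant elements onto $[H^{\otimes s}]_{D_{2s}}$. So, without loss of information, $\mathrm{Tr}^{\mathrm{ES}}$ takes values in $[H^{\otimes s}]_{D_{2s}}$. 2. For every $s\ge 0$, $\eta$ restricts to an isomorphism $\mathcal T_s(H)\to\mathsf D_s(H)$. For every $s\geq 2$ there is an isomorphism $\Phi\colon\Omega_{s,1}(H)\to[H^{\otimes s}]_{D_{2s}}$ that sends, for all $v_1,\dots,v_s\in H$, the loop with hairs $v_1,\dots,v_s$ to the class of $v_1\otimes\cdots\otimes v_s$, and for all $t\in\mathcal T_s(H)$ $$\Phi\big(\mathrm{pr}_{s,1}\,\mathrm{Tr}^{\mathrm C}(t)\big)=\tfrac12\,\mathrm{Tr}^{\mathrm{ES}}(\eta(t))\quad\text{in } [H^{\otimes s}]_{D_{2s}},$$ where $\mathrm{pr}_{s,1}\colon\Omega(H)\to\Omega_{s,1}(H)$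 is the projection. Here the loop with hairs $v_1,\dots,v_s$ is the rooted tree $[\cdots[[\bullet,v_1],v_2],\cdots,v_s]$ with an external edge directed from its root to the leaf $\bullet$. -/

import Mathlib

open scoped TensorProduct

set_option linter.unusedSectionVars false
set_option linter.unusedVariables false

noncomputable section

namespace Johnson

universe u v

/-! ### Unitrivalent trees

A planar binary rooted tree with leaves labelled by `X` is an element of `FreeMagma X`.  A
unitrivalent tree with a cyclic order at each trivalent vertex, together with a chosen edge `ε`, is
a pair `(a, b)` of planar rooted trees, glued along their roots to form `ε`.  A trivalent vertex
with subtrees `a`, `b` above it and root below it carries the cyclic order (root, `a`, `b`).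
Changing the chosen edge gives another presentation of the same unitrivalent tree. -/

/-- Unitrivalent trees with cyclic orders at the vertices and leaves labelled by `X`, presented by
cutting one of the edges. -/
abbrev UTree (X : Type v) := FreeMagma X × FreeMagma X

section Trees

variable {X : Type v}

/-- The leaves of a rooted tree. -/
def leavesR : FreeMagma X → List X
  | .of x => [x]
  | .mul a b => leavesR a ++ leavesR b

/-- The number of trivalent vertices of a rooted tree. -/
def nodesR : FreeMagma X → ℕ
  | .of _ => 0
  | .mul a b => nodesR a + nodesR b + 1

/-- The univalent vertices of a unitrivalent tree. -/
def leaves (t : UTree X) : List X := leavesR t.1 ++ leavesR t.2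

/-- The number of trivalent vertices of a unitrivalent tree. -/
def trivalent (t : UTree X) : ℕ := nodesR t.1 + nodesR t.2

/-- For every leaf `x` of `a`, the pair of `x` and the rooted tree obtained from the unitrivalent
tree `(a, c)` by removing the label from `x` and regarding `x` as the root. -/
def rootingsR : FreeMagma X → FreeMagma X → List (X × FreeMagma X)
  | .of x, c => [(x, c)]
  | .mul a b, c => rootingsR a (b * c) ++ rootingsR b (c * a)

/-- For every univalent vertex `x` of `t`, the pair of the label `ℓ(x)` and the rooted tree `t_x`
obtained by removing the label from `x` and regarding `x` as the root. -/
def rootings (t : UTree X) : List (X × FreeMagma X) := rootingsR t.1 t.2 ++ rootingsR t.2 t.1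

@[simp] theorem leavesR_of (x : X) : leavesR (.of x) = [x] := rfl
@[simp] theorem leavesR_mul (a b : FreeMagma X) : leavesR (a * b) = leavesR a ++ leavesR b := rfl
@[simp] theorem nodesR_of (x : X) : nodesR (.of x) = 0 := rfl
@[simp] theorem nodesR_mul (a b : FreeMagma X) : nodesR (a * b) = nodesR a + nodesR b + 1 := rfl
@[simp] theorem rootingsR_of (x : X) (c : FreeMagma X) : rootingsR (.of x) c = [(x, c)] := rfl
@[simp] theorem rootingsR_mul (a b c : FreeMagma X) :
    rootingsR (a * b) c = rootingsR a (b * c) ++ rootingsR b (c * a) := rfl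

theorem leavesR_length (a : FreeMagma X) : (leavesR a).length = nodesR a + 1 := by
  induction a with
  | ih1 x => simp
  | ih2 a b ha hb => simp [ha, hb]; omega

theorem rootingsR_perm (a c : FreeMagma X) (p : X × FreeMagma X) (hp : p ∈ rootingsR a c) :
    (p.1 :: leavesR p.2).Perm (leavesR a ++ leavesR c) := by
  induction a generalizing c with
  | ih1 x => simp only [rootingsR_of, List.mem_singleton] at hp; subst hp; simp
  | ih2 a b ha hb =>
    simp only [rootingsR_mul, List.mem_append] at hp
    rcases hp with hp | hp
    · simpa using ha _ hp
    · refine (hb _ hp).trans ?_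
      simp only [leavesR_mul]
      rw [← List.append_assoc]
      exact List.perm_append_comm.trans (by simp)

theorem rootings_perm (t : UTree X) (p : X × FreeMagma X) (hp : p ∈ rootings t) :
    (p.1 :: leavesR p.2).Perm (leaves t) := by
  simp only [rootings, List.mem_append] at hp
  rcases hp with hp | hp
  · exact rootingsR_perm _ _ _ hp
  · exact (rootingsR_perm _ _ _ hp).trans List.perm_append_comm

theorem rootings_nodes (t : UTree X) (p : X × FreeMagma X) (hp : p ∈ rootings t) :
    nodesR p.2 = trivalent t := by
  have h := (rootings_perm t p hp).length_eq
  simp only [List.length_cons, leavesR_length, leaves, List.length_append] at h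
  simp only [trivalent]
  omega

end Trees

variable (k : Type u) [Field k]

/-- The relations between labelled unitrivalent trees.  The labels in the image of `lab` come from
a vector space.  The first two constructors identify the presentations of one tree obtained by
cutting different edges; then come AS, IHX and multilinearity.  As every edge of a tree can be made
the chosen one, it is enough to impose the last three next to the chosen edge. -/
inductive TreeRel {H : Type v} [AddCommGroup H] [Module k H] {X : Type v} (lab : H → X) :
    (UTree X →₀ k) → Prop
  | flip (a b : FreeMagma X) :
      TreeRel lab (Finsupp.single (a, b) 1 - Finsupp.single (b, a) 1)
  | move (a b c : FreeMagma X) :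
      TreeRel lab (Finsupp.single (a * b, c) 1 - Finsupp.single (a, b * c) 1)
  | antisymm (a b c : FreeMagma X) :
      TreeRel lab (Finsupp.single (a, b * c) 1 + Finsupp.single (a, c * b) 1)
  | ihx (a b c d : FreeMagma X) :
      TreeRel lab (Finsupp.single (a, b * c * d) 1 + Finsupp.single (a, c * d * b) 1
        + Finsupp.single (a, d * b * c) 1)
  | multilinear (r : k) (v w : H) (a : FreeMagma X) :
      TreeRel lab (Finsupp.single (.of (lab (r • v + w)), a) 1
        - r • Finsupp.single (.of (lab v), a) 1 - Finsupp.single (.of (lab w), a) 1)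

/-- The vector space of unitrivalent trees with leaves labelled by `X`, modulo AS, IHX and
multilinearity in the labels coming from the vector space `H`. -/
abbrev TreeSpace {H : Type v} [AddCommGroup H] [Module k H] {X : Type v} (lab : H → X) :=
  (UTree X →₀ k) ⧸ Submodule.span k {x | TreeRel k lab x}

/-- The class of a tree. -/
def treeMk {H : Type v} [AddCommGroup H] [Module k H] {X : Type v} (lab : H → X) (t : UTree X) :
    TreeSpace k lab :=
  Submodule.mkQ _ (Finsupp.single t 1)

section TreeSpace

variable {H : Type v} [AddCommGroup H] [Module k H] {X : Type v} (lab : H → X)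

theorem treeMk_flip (a b : FreeMagma X) : treeMk k lab (a, b) = treeMk k lab (b, a) :=
  (Submodule.Quotient.eq (Submodule.span k {x | TreeRel k lab x})).2
    (Submodule.subset_span (TreeRel.flip a b))

theorem treeMk_move (a b c : FreeMagma X) :
    treeMk k lab (a * b, c) = treeMk k lab (a, b * c) :=
  (Submodule.Quotient.eq (Submodule.span k {x | TreeRel k lab x})).2
    (Submodule.subset_span (TreeRel.move a b c))

theorem treeMk_antisymm (a b c : FreeMagma X) :
    treeMk k lab (a, b * c) + treeMk k lab (a, c * b) = 0 := by
  have := (Submodule.Quotient.mk_eq_zero (Submodule.span k {x | TreeRel k lab x})).2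
    (Submodule.subset_span (TreeRel.antisymm a b c))
  simpa [treeMk] using this

theorem treeMk_ihx (a b c d : FreeMagma X) :
    treeMk k lab (a, b * c * d) + treeMk k lab (a, c * d * b) + treeMk k lab (a, d * b * c)
      = 0 := by
  have := (Submodule.Quotient.mk_eq_zero (Submodule.span k {x | TreeRel k lab x})).2
    (Submodule.subset_span (TreeRel.ihx a b c d))
  simpa [treeMk] using this

theorem treeMk_linear (r : k) (v w : H) (a : FreeMagma X) :
    treeMk k lab (.of (lab (r • v + w)), a)
      = r • treeMk k lab (.of (lab v), a) + treeMk k lab (.of (lab w), a) := by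
  have := (Submodule.Quotient.mk_eq_zero (Submodule.span k {x | TreeRel k lab x})).2
    (Submodule.subset_span (TreeRel.multilinear r v w a))
  rw [← sub_eq_zero, ← sub_sub]
  exact this

/-- A function on trees that respects the relations extends to a linear map. -/
def treeLift {M : Type*} [AddCommGroup M] [Module k M] (f : UTree X → M)
    (hflip : ∀ a b, f (a, b) = f (b, a))
    (hmove : ∀ a b c, f (a * b, c) = f (a, b * c))
    (hanti : ∀ a b c, f (a, b * c) + f (a, c * b) = 0)
    (hihx : ∀ a b c d, f (a, b * c * d) + f (a, c * d * b) + f (a, d * b * c) = 0)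
    (hlin : ∀ (r : k) v w a, f (.of (lab (r • v + w)), a)
      = r • f (.of (lab v), a) + f (.of (lab w), a)) :
    TreeSpace k lab →ₗ[k] M :=
  Submodule.liftQ _ (Finsupp.linearCombination k f) <| by
    rw [Submodule.span_le]
    rintro _ (⟨a, b⟩ | ⟨a, b, c⟩ | ⟨a, b, c⟩ | ⟨a, b, c, d⟩ | ⟨r, v, w, a⟩)
    · simp [hflip a b]
    · simp [hmove a b c]
    · simpa using hanti a b c
    · simpa using hihx a b c d
    · simp [hlin r v w a]

@[simp] theorem treeLift_mk {M : Type*} [AddCommGroup M] [Module k M] (f : UTree X → M)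
    (h1 h2 h3 h4 h5) (t : UTree X) :
    treeLift k lab f h1 h2 h3 h4 h5 (treeMk k lab t) = f t := by
  simp [treeLift, treeMk]

theorem treeSpace_ext {M : Type*} [AddCommGroup M] [Module k M] {f g : TreeSpace k lab →ₗ[k] M}
    (h : ∀ t, f (treeMk k lab t) = g (treeMk k lab t)) : f = g := by
  apply Submodule.linearMap_qext
  ext t
  simpa [treeMk] using h t

theorem span_treeMk (x : TreeSpace k lab) :
    x ∈ Submodule.span k (Set.range (treeMk k lab)) := by
  obtain ⟨x, rfl⟩ := Submodule.mkQ_surjective _ x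
  induction x using Finsupp.induction_linear with
  | zero => simp
  | add f g hf hg => rw [map_add]; exact add_mem hf hg
  | single t r =>
    rw [← mul_one r, ← smul_eq_mul, ← Finsupp.smul_single, map_smul]
    exact Submodule.smul_mem _ _ (Submodule.subset_span ⟨t, rfl⟩)

end TreeSpace

variable (H : Type v) [AddCommGroup H] [Module k H]

/-- `𝒯(H)`: unitrivalent trees labelled by elements of `H`, modulo AS, IHX, multilinearity. -/
abbrev T := TreeSpace k (id : H → H)

/-- `𝒯_s(H)`: the part of `𝒯(H)` with `s` trivalent vertices. -/
def TDeg (s : ℕ) : Submodule k (T k H) :=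
  Submodule.span k {x | ∃ t : UTree H, trivalent t = s ∧ x = treeMk k id t}

/-! ### The free Lie algebra and `D_s(H)` -/

/-- The ideal of the free Lie algebra on the set `H` that makes the generators linear in `H`. -/
def linIdeal : LieIdeal k (FreeLieAlgebra k H) :=
  LieSubmodule.lieSpan k (FreeLieAlgebra k H)
    {x | ∃ (r : k) (v w : H), x = FreeLieAlgebra.of k (r • v + w)
      - (r • FreeLieAlgebra.of k v + FreeLieAlgebra.of k w)}

/-- The free Lie algebra on the vector space `H`. -/
abbrev L := FreeLieAlgebra k H ⧸ linIdeal k H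

/-- The inclusion of the generators. -/
def L.ι : H →ₗ[k] L k H where
  toFun v := LieSubmodule.Quotient.mk (FreeLieAlgebra.of k v)
  map_add' v w := by
    have : FreeLieAlgebra.of k ((1 : k) • v + w)
      - ((1 : k) • FreeLieAlgebra.of k v + FreeLieAlgebra.of k w) ∈ linIdeal k H :=
      LieSubmodule.subset_lieSpan ⟨1, v, w, rfl⟩
    rw [one_smul, one_smul] at this
    exact (Submodule.Quotient.eq _).2 this
  map_smul' r v := by
    have h0 : FreeLieAlgebra.of k ((0 : k) • v + (0 : H))
      - ((0 : k) • FreeLieAlgebra.of k v + FreeLieAlgebra.of k (0 : H)) ∈ linIdeal k H :=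
      LieSubmodule.subset_lieSpan ⟨0, v, 0, rfl⟩
    have h1 : FreeLieAlgebra.of k ((-1 : k) • (0 : H) + (0 : H))
      - ((-1 : k) • FreeLieAlgebra.of k 0 + FreeLieAlgebra.of k (0 : H)) ∈ linIdeal k H :=
      LieSubmodule.subset_lieSpan ⟨-1, 0, 0, rfl⟩
    have h2 : FreeLieAlgebra.of k (r • v + (0 : H))
      - (r • FreeLieAlgebra.of k v + FreeLieAlgebra.of k (0 : H)) ∈ linIdeal k H :=
      LieSubmodule.subset_lieSpan ⟨r, v, 0, rfl⟩
    simp only [smul_zero, add_zero, neg_smul, one_smul, neg_add_cancel, sub_zero] at h1 h2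
    refine (Submodule.Quotient.eq _).2 ?_
    have := add_mem h2 h1
    simpa [sub_add_eq_sub_sub] using this

variable {H} in
/-- The iterated bracket represented by a rooted tree: a trivalent vertex with cyclic order
(root, `a`, `b`) stands for `⁅a, b⁆`. -/
def lieOf : FreeMagma H → L k H
  | .of v => L.ι k H v
  | .mul a b => ⁅lieOf a, lieOf b⁆

variable {H} in
@[simp] theorem lieOf_of (v : H) : lieOf k (.of v) = L.ι k H v := rfl
variable {H} in
@[simp] theorem lieOf_mul (a b : FreeMagma H) : lieOf k (a * b) = ⁅lieOf k a, lieOf k b⁆ := rfl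

/-- `L_n(H)`: the degree `n` part of the free Lie algebra, spanned by all iterated brackets of `n`
elements of `H`. -/
def LDeg (n : ℕ) : Submodule k (L k H) :=
  Submodule.span k {x | ∃ a : FreeMagma H, (leavesR a).length = n ∧ x = lieOf k a}

/-- The bracketing map `H ⊗ L(H) → L(H)`. -/
def bracketing : H ⊗[k] L k H →ₗ[k] L k H :=
  TensorProduct.lift ((LieModule.toEnd k (L k H) (L k H) : L k H →ₗ[k] _) ∘ₗ L.ι k H)

/-- `D_s(H)`: the kernel of the bracketing map on `H ⊗ L_{s+1}(H)`, the latter being regarded as a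
subspace of `H ⊗ L(H)`. -/
def D (s : ℕ) : Submodule k (H ⊗[k] L k H) :=
  LinearMap.range ((LDeg k H (s + 1)).subtype.lTensor H) ⊓ LinearMap.ker (bracketing k H)

@[simp] theorem bracketing_tmul (v : H) (x : L k H) :
    bracketing k H (v ⊗ₜ x) = ⁅L.ι k H v, x⁆ := by
  simp [bracketing]

/-! ### The map `η` -/

section Eta

variable {H}

/-- `∑_x ℓ(x) ⊗ t_x`, the sum over all univalent vertices `x` of `t`. -/
def etaTree (t : UTree H) : H ⊗[k] L k H :=
  ((rootings t).map fun p => p.1 ⊗ₜ[k] lieOf k p.2).sum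

/-- Auxiliary: the part of `η (a, c)` coming from the leaves of `a`, as a function of the Lie
element represented by `c`. -/
def etaAux : FreeMagma H → L k H → H ⊗[k] L k H
  | .of v, x => v ⊗ₜ[k] x
  | .mul a b, x => etaAux a ⁅lieOf k b, x⁆ + etaAux b ⁅x, lieOf k a⁆

@[simp] theorem etaAux_of (v : H) (x : L k H) : etaAux k (.of v) x = v ⊗ₜ[k] x := rfl
@[simp] theorem etaAux_mul (a b : FreeMagma H) (x : L k H) : etaAux k (a * b) x =
    etaAux k a ⁅lieOf k b, x⁆ + etaAux k b ⁅x, lieOf k a⁆ := rfl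

theorem etaAux_add (a : FreeMagma H) (x y : L k H) :
    etaAux k a (x + y) = etaAux k a x + etaAux k a y := by
  induction a generalizing x y with
  | ih1 v => simp [TensorProduct.tmul_add]
  | ih2 a b ha hb => simp only [etaAux_mul, lie_add, add_lie, ha, hb]; abel

theorem etaAux_smul (r : k) (a : FreeMagma H) (x : L k H) :
    etaAux k a (r • x) = r • etaAux k a x := by
  induction a generalizing x with
  | ih1 v => simp
  | ih2 a b ha hb => simp only [etaAux_mul, lie_smul, smul_lie, ha, hb, smul_add]

theorem etaAux_zero (a : FreeMagma H) : etaAux k a 0 = 0 := by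
  simpa using etaAux_smul k 0 a 0

theorem etaAux_skew (a : FreeMagma H) (x y : L k H) :
    etaAux k a ⁅x, y⁆ + etaAux k a ⁅y, x⁆ = 0 := by
  rw [← etaAux_add, ← lie_skew, neg_add_cancel, etaAux_zero]

theorem sum_rootingsR (a c : FreeMagma H) :
    ((rootingsR a c).map fun p => p.1 ⊗ₜ[k] lieOf k p.2).sum = etaAux k a (lieOf k c) := by
  induction a generalizing c with
  | ih1 v => simp
  | ih2 a b ha hb => simp [ha, hb]

theorem etaTree_eq (a b : FreeMagma H) :
    etaTree k (a, b) = etaAux k a (lieOf k b) + etaAux k b (lieOf k a) := by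
  simp [etaTree, rootings, sum_rootingsR]

variable (H) in
/-- `η : 𝒯(H) → H ⊗ L(H)`, `η(t) = ∑_x ℓ(x) ⊗ t_x`. -/
def etaLin : T k H →ₗ[k] H ⊗[k] L k H :=
  treeLift k id (etaTree k)
    (fun a b => by rw [etaTree_eq, etaTree_eq, add_comm])
    (fun a b c => by simp only [etaTree_eq, etaAux_mul, lieOf_mul, add_assoc])
    (fun a b c => by
      simp only [etaTree_eq, etaAux_mul, lieOf_mul]
      have := congrArg₂ (· + ·) (etaAux_skew k a (lieOf k b) (lieOf k c)) (congrArg₂ (· + ·)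
        (etaAux_skew k b (lieOf k c) (lieOf k a)) (etaAux_skew k c (lieOf k a) (lieOf k b)))
      simp only [add_zero] at this
      rw [← this]
      abel)
    (fun a b c d => by
      simp only [etaTree_eq, etaAux_mul, lieOf_mul]
      have h0 : ⁅⁅lieOf k b, lieOf k c⁆, lieOf k d⁆ + ⁅⁅lieOf k c, lieOf k d⁆, lieOf k b⁆
        + ⁅⁅lieOf k d, lieOf k b⁆, lieOf k c⁆ = 0 := by
        have := lie_jacobi (lieOf k b) (lieOf k c) (lieOf k d)
        rw [← lie_skew (lieOf k d) ⁅lieOf k b, _⁆, ← lie_skew (lieOf k b) ⁅lieOf k c, _⁆,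
          ← lie_skew (lieOf k c) ⁅lieOf k d, _⁆, ← neg_add, ← neg_add, neg_eq_zero] at this
        rw [← this]; abel
      have key : ∀ x y z : L k H, ⁅x, ⁅y, z⁆⁆ + ⁅z, ⁅x, y⁆⁆ + ⁅⁅x, z⁆, y⁆ = 0 := by
        intro x y z
        rw [← lie_skew ⁅x, z⁆ y, ← lie_skew x z, lie_neg, neg_neg, ← lie_jacobi x y z]
        abel
      have hb := key (lieOf k c) (lieOf k d) (lieOf k a)
      have hc := key (lieOf k d) (lieOf k b) (lieOf k a)
      have hd := key (lieOf k b) (lieOf k c) (lieOf k a)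
      have e0 := congrArg (etaAux k a) h0
      have eb := congrArg (etaAux k b) hb
      have ec := congrArg (etaAux k c) hc
      have ed := congrArg (etaAux k d) hd
      simp only [etaAux_add, etaAux_zero] at e0 eb ec ed
      have := congrArg₂ (· + ·) (congrArg₂ (· + ·) e0 eb) (congrArg₂ (· + ·) ec ed)
      simp only [add_zero] at this
      rw [← this]
      abel)
    (fun r v w a => by
      simp only [etaTree_eq, etaAux_of, lieOf_of, id, map_add, map_smul, etaAux_add, etaAux_smul,
        TensorProduct.add_tmul, TensorProduct.smul_tmul', smul_add]
      abel)

theorem bracketing_etaAux (a : FreeMagma H) (x : L k H) :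
    bracketing k H (etaAux k a x) = ⁅lieOf k a, x⁆ := by
  induction a generalizing x with
  | ih1 v => simp
  | ih2 a b ha hb =>
    simp only [etaAux_mul, map_add, ha, hb, lieOf_mul]
    rw [← lie_skew x, lie_neg, lie_lie]; abel

theorem etaLin_mem (s : ℕ) (x : T k H) (hx : x ∈ TDeg k H s) : etaLin k H x ∈ D k H s := by
  refine (Submodule.span_le (p := (D k H s).comap (etaLin k H))).2 ?_ hx
  rintro _ ⟨t, ht, rfl⟩
  simp only [Submodule.comap_coe, Set.mem_preimage, SetLike.mem_coe, etaLin, treeLift_mk]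
  refine ⟨?_, ?_⟩
  · refine list_sum_mem fun y hy => ?_
    obtain ⟨p, hp, rfl⟩ := List.mem_map.1 hy
    refine ⟨p.1 ⊗ₜ ⟨lieOf k p.2, Submodule.subset_span ⟨p.2, ?_, rfl⟩⟩, by simp⟩
    rw [leavesR_length, rootings_nodes t p hp, ht]
  · rw [SetLike.mem_coe, LinearMap.mem_ker, ← Prod.mk.eta (p := t), etaTree_eq, map_add, bracketing_etaAux,
      bracketing_etaAux, ← lie_skew, neg_add_cancel]

variable (H) in
/-- `η_s : 𝒯_s(H) → D_s(H)`. -/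
def eta (s : ℕ) : TDeg k H s →ₗ[k] D k H s :=
  (etaLin k H).restrict (etaLin_mem k s)

end Eta

/-! ### Cyclic and dihedral coinvariants of `H^{⊗s}` -/

/-- The cyclic rotation `v₁ ⊗ ⋯ ⊗ v_s ↦ v_s ⊗ v₁ ⊗ ⋯ ⊗ v_{s-1}`, a generator of `ℤ_s`. -/
def rot (s : ℕ) : (⨂[k]^s H) ≃ₗ[k] (⨂[k]^s H) := PiTensorProduct.reindex k (fun _ => H) (finRotate s)

/-- The reversal map `b(v₁ ⊗ ⋯ ⊗ v_s) = (-1)^{s+1} v_s ⊗ ⋯ ⊗ v₁`. -/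
def rev (s : ℕ) : (⨂[k]^s H) →ₗ[k] (⨂[k]^s H) :=
  (-1 : k) ^ (s + 1) • (PiTensorProduct.reindex k (fun _ => H) (Fin.revPerm (n := s))).toLinearMap

/-- `[H^{⊗s}]_{ℤ_s}`, where the generator of `ℤ_s` acts by `rot`. -/
abbrev CycCoinv (s : ℕ) :=
  (⨂[k]^s H) ⧸ LinearMap.range ((rot k H s).toLinearMap - LinearMap.id)

/-- `[H^{⊗s}]_{D_{2s}}`, where the two generators of `D_{2s}` act by `rot` and `rev`. -/
abbrev DihCoinv (s : ℕ) :=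
  (⨂[k]^s H) ⧸ (LinearMap.range ((rot k H s).toLinearMap - LinearMap.id) ⊔
    LinearMap.range (rev k H s - LinearMap.id))

theorem rot_rev_rot (s : ℕ) (x : ⨂[k]^s H) : rot k H s (rev k H s (rot k H s x)) = rev k H s x := by
  have key : (rot k H s).toLinearMap ∘ₗ rev k H s ∘ₗ (rot k H s).toLinearMap = rev k H s := by
    ext v
    simp only [rot, rev, LinearMap.compMultilinearMap_apply, LinearMap.comp_apply,
      LinearMap.smul_apply, map_smul, LinearEquiv.coe_coe, PiTensorProduct.reindex_tprod]
    congr 2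
    funext i
    congr 1
    obtain ⟨j, rfl⟩ := (finRotate s).surjective i
    rw [Equiv.symm_apply_apply, Equiv.symm_apply_eq]
    rcases s with _ | s
    · exact j.elim0
    · ext
      simp only [Fin.revPerm_symm, Fin.revPerm_apply, coe_finRotate, Fin.ext_iff, Fin.val_rev,
        Fin.val_last]
      split_ifs <;> omega
  exact LinearMap.congr_fun key x

/-- The involution induced by the reversal map on `[H^{⊗s}]_{ℤ_s}`. -/
def revCyc (s : ℕ) : CycCoinv k H s →ₗ[k] CycCoinv k H s :=
  Submodule.mapQ _ _ (rev k H s) <| by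
    rintro _ ⟨x, rfl⟩
    refine ⟨-rev k H s (rot k H s x), ?_⟩
    simp only [LinearMap.sub_apply, LinearEquiv.coe_coe, map_neg, rot_rev_rot, LinearMap.id_apply,
      map_sub]
    abel

/-- The natural projection `[H^{⊗s}]_{ℤ_s} → [H^{⊗s}]_{D_{2s}}`. -/
def cycToDih (s : ℕ) : CycCoinv k H s →ₗ[k] DihCoinv k H s :=
  Submodule.mapQ _ _ LinearMap.id (by rw [Submodule.comap_id]; exact le_sup_left)

/-! ### The Enomoto–Satoh trace -/

section ES

attribute [local instance] LieRing.ofAssociativeRing LieAlgebra.ofAssociativeAlgebra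

/-- The canonical map from the free Lie algebra to the tensor algebra,
`⁅x, y⁆ ↦ x ⊗ y - y ⊗ x`. -/
def lieToTensor : L k H →ₗ[k] TensorAlgebra k H :=
  Submodule.liftQ (linIdeal k H).toSubmodule
    (FreeLieAlgebra.lift k (TensorAlgebra.ι k : H → TensorAlgebra k H) :
      FreeLieAlgebra k H →ₗ[k] TensorAlgebra k H) <| by
    have : linIdeal k H ≤
        (FreeLieAlgebra.lift k (TensorAlgebra.ι k : H → TensorAlgebra k H)).ker := by
      refine LieSubmodule.lieSpan_le.2 ?_
      rintro _ ⟨r, v, w, rfl⟩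
      simp
    intro x hx
    exact LieHom.mem_ker.1 (this hx)

end ES

/-- The embedding of `L_n(H)` in `H^{⊗n}`, extended by zero to the other degrees. -/
def lieToPower (n : ℕ) : L k H →ₗ[k] ⨂[k]^n H :=
  DirectSum.component k ℕ (fun n => ⨂[k]^n H) n ∘ₗ
    (TensorAlgebra.toDirectSum (R := k) (M := H)).toLinearMap ∘ₗ lieToTensor k H

variable {k H}

/-- Contraction of the first two factors: `v ⊗ (v₀ ⊗ v₁ ⊗ ⋯ ⊗ v_s) ↦ ⟨v, v₀⟩ v₁ ⊗ ⋯ ⊗ v_s`. -/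
def contract (ω : LinearMap.BilinForm k H) (s : ℕ) : H ⊗[k] (⨂[k]^(s + 1) H) →ₗ[k] ⨂[k]^s H :=
  TensorProduct.lift <|
    { toFun := fun v => PiTensorProduct.lift
        (((ω v).smulRight (PiTensorProduct.tprod k (s := fun _ : Fin s => H))).uncurryLeft)
      map_add' := fun v w => by
        ext x
        simp [add_smul]
      map_smul' := fun r v => by
        ext x
        simp [mul_smul] }

/-- The Enomoto–Satoh trace `D_s(H) → [H^{⊗s}]_{ℤ_s}`: embed `D_s(H)` in `H ⊗ H^{⊗(s+1)}`, contract
the first two factors, project to the cyclic coinvariants. -/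
def trES (ω : LinearMap.BilinForm k H) (s : ℕ) : D k H s →ₗ[k] CycCoinv k H s :=
  Submodule.mkQ _ ∘ₗ contract ω s ∘ₗ (lieToPower k H (s + 1)).lTensor H ∘ₗ (D k H s).subtype

/-! ### Hairy graphs

The ends of the external edges are leaves of the trees: `tail e` and `head e` are the two ends of
the external edge named `e`, which is directed from `tail e` to `head e`. -/

/-- The leaves of a hairy graph: hairs labelled by `H`, and ends of external edges. -/
inductive Leaf (H : Type v) : Type v
  | hair (v : H)
  | tail (e : ℕ)
  | head (e : ℕ)

/-- The label of a hair. -/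
def Leaf.hair? : Leaf H → Option H
  | .hair v => some v
  | _ => none

/-- The external edge that starts at a given leaf. -/
def Leaf.tail? : Leaf H → Option ℕ
  | .tail e => some e
  | _ => none

/-- The external edge that ends at a given leaf. -/
def Leaf.head? : Leaf H → Option ℕ
  | .head e => some e
  | _ => none

/-- Among the given leaves, the ends of external edges are matched in pairs: each name of an edge
occurs exactly once as a tail and exactly once as a head, or not at all. -/
def Matched (l : List (Leaf H)) : Prop :=
  (l.filterMap Leaf.tail?).Nodup ∧ (l.filterMap Leaf.head?).Perm (l.filterMap Leaf.tail?)

/-- The number of hairs. -/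
def numHairs (l : List (Leaf H)) : ℕ := (l.filterMap Leaf.hair?).length

/-- The number of external edges (for matched leaves). -/
def numEdges (l : List (Leaf H)) : ℕ := (l.filterMap Leaf.tail?).length

/-- A hairy graph with one tree. -/
def IsHairy (t : UTree (Leaf H)) : Prop := Matched (leaves t)

/-- Relabelling the leaves of a tree. -/
def relabel {X Y : Type v} (f : X → Y) (t : UTree X) : UTree Y :=
  (FreeMagma.map f t.1, FreeMagma.map f t.2)

/-- Renaming of the external edges. -/
def Leaf.rename (f : ℕ → ℕ) : Leaf H → Leaf H
  | .hair v => .hair v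
  | .tail e => .tail (f e)
  | .head e => .head (f e)

/-- Switching the direction of the external edge `e`. -/
def Leaf.switch (e : ℕ) : Leaf H → Leaf H
  | .hair v => .hair v
  | .tail e' => if e' = e then .head e' else .tail e'
  | .head e' => if e' = e then .tail e' else .head e'

variable (k H)

/-- Trees with leaves in `Leaf H`, modulo IHX, AS, and multilinearity on labels of hairs. -/
abbrev PreGraph := TreeSpace k (Leaf.hair : H → Leaf H)

variable {H} in
/-- The class of a tree with leaves in `Leaf H`. -/
def gr (t : UTree (Leaf H)) : PreGraph k H := treeMk k Leaf.hair t

/-- The span of all hairy graphs with one tree, the external edges having names. -/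
def PreC₁ : Submodule k (PreGraph k H) := Submodule.span k {x | ∃ t, IsHairy t ∧ x = gr k t}

/-- The span of all hairy graphs with one tree, `r` external edges and `s` hairs.  A graph formed
by one tree and `r` external edges has first Betti number `r`. -/
def PreC₁Part (s r : ℕ) : Submodule k (PreGraph k H) :=
  Submodule.span k {x | ∃ t, IsHairy t ∧ numEdges (leaves t) = r ∧ numHairs (leaves t) = s ∧
    x = gr k t}

/-- The relations on external edges: switching the direction of an external edge gives a minus
sign, and external edges have no names. -/
def edgeRel : Submodule k (PreGraph k H) :=
  Submodule.span k (
    {x | ∃ t e, IsHairy t ∧ e ∈ (leaves t).filterMap Leaf.tail? ∧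
      x = gr k t + gr k (relabel (Leaf.switch e) t)} ∪
    {x | ∃ t f, IsHairy t ∧ Function.Injective f ∧ x = gr k t - gr k (relabel (Leaf.rename f) t)})

/-- The space `C₁ℋ(H)` of hairy graphs with one tree. -/
abbrev C₁ := PreC₁ k H ⧸ (edgeRel k H).submoduleOf (PreC₁ k H)

variable {k H}

/-! ### The boundary on graphs with two trees and the relators `∂S₂` -/

/-- The leaves of a graph with two trees, numbered in this order. -/
def leaves₂ (Γ : UTree (Leaf H) × UTree (Leaf H)) : List (Leaf H) := leaves Γ.1 ++ leaves Γ.2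

variable (k) in
/-- The sign with which an external edge between a leaf `x` of the first tree and a leaf `y` of the
second tree is contracted: `1` if it is directed from `x` to `y`, `-1` if it is directed from `y` to
`x`, and `0` if the two leaves are not joined by an external edge. -/
def joinSign : Leaf H → Leaf H → k
  | .tail e, .head e' => if e = e' then 1 else 0
  | .head e, .tail e' => if e = e' then -1 else 0
  | _, _ => 0

variable (k) in
/-- The boundary of a hairy graph with two trees: the sum over all external edges between the first
and the second tree of the graphs in which the two trees are joined along this edge to form one
tree. -/
def boundary (Γ : UTree (Leaf H) × UTree (Leaf H)) : PreGraph k H :=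
  ((rootings Γ.1).map fun p =>
    ((rootings Γ.2).map fun q => joinSign k p.1 q.1 • gr k (p.2, q.2)).sum).sum

/-- The leaf `x` is joined by an external edge to a leaf of the tree `t`. -/
def JoinedTo (x : Leaf H) (t : UTree (Leaf H)) : Prop :=
  ∃ e, (x = .tail e ∧ .head e ∈ leaves t) ∨ (x = .head e ∧ .tail e ∈ leaves t)

/-- The graphs that span `S₂`: the first tree is a tripod, and either two or three of its leaves are
joined to the second tree, or two of its leaves are joined to each other and the third one is
joined to the second tree.  The second tree may have external edges joining it to itself.  Rotating
the tripod gives the same graph, and exchanging two of its leaves, switching an edge, or exchanging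
the numbers of the trees only changes the sign, so this list is complete up to sign. -/
inductive IsS₂ : UTree (Leaf H) × UTree (Leaf H) → Prop
  | slide (x y z : Leaf H) (t : UTree (Leaf H)) (hy : JoinedTo y t) (hz : JoinedTo z t)
      (hΓ : Matched (leaves₂ ((.of x, .of y * .of z), t))) : IsS₂ ((.of x, .of y * .of z), t)
  | loop (x : Leaf H) (e : ℕ) (t : UTree (Leaf H)) (hx : JoinedTo x t)
      (hΓ : Matched (leaves₂ ((.of x, .of (.tail e) * .of (.head e)), t))) :
      IsS₂ ((.of x, .of (.tail e) * .of (.head e)), t)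

variable (k H)

/-- `∂S₂`, as a space of representatives. -/
def bdS₂ : Submodule k (PreGraph k H) := Submodule.span k {x | ∃ Γ, IsS₂ Γ ∧ x = boundary k Γ}

/-- `∂S_{2,r,s}`: the boundaries of the graphs in `S₂` with `s` hairs and first Betti number `r`.  A
connected graph formed by two trees and `r + 1` external edges has first Betti number `r`. -/
def bdS₂Part (s r : ℕ) : Submodule k (PreGraph k H) :=
  Submodule.span k {x | ∃ Γ, IsS₂ Γ ∧ numEdges (leaves₂ Γ) = r + 1 ∧ numHairs (leaves₂ Γ) = s ∧
    x = boundary k Γ}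

/-- The inclusion `𝒯(H) → C₁ℋ(H)` of trees as hairy graphs without external edges, as a map to
representatives. -/
def inclT : T k H →ₗ[k] PreGraph k H :=
  treeLift k id (fun t => gr k (relabel Leaf.hair t))
    (fun a b => treeMk_flip k _ _ _)
    (fun a b c => treeMk_move k _ _ _ _)
    (fun a b c => treeMk_antisymm k _ _ _ _)
    (fun a b c d => treeMk_ihx k _ _ _ _ _)
    (fun r v w a => treeMk_linear k _ r v w _)

variable {H} in
theorem inclT_mk (t : UTree H) : inclT k H (treeMk k id t) = gr k (relabel Leaf.hair t) :=
  treeLift_mk k _ _ _ _ _ _ _ t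

/-- The target `Ω(H) = C₁ℋ(H) / (∂S₂ + ι(𝒯(H)))`; the quotient by `edgeRel` that gives `C₁ℋ(H)` is
taken at the same time. -/
abbrev Omega := PreC₁ k H ⧸
  (edgeRel k H ⊔ bdS₂ k H ⊔ LinearMap.range (inclT k H)).submoduleOf (PreC₁ k H)

/-- `Ω_{s,r}(H) = C_{1,r,s}ℋ(H) / ∂S_{2,r,s}`, with `s` hairs and rank `r`. -/
abbrev OmegaPart (s r : ℕ) := PreC₁Part k H s r ⧸
  (edgeRel k H ⊔ bdS₂Part k H s r).submoduleOf (PreC₁Part k H s r)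

section Projection

variable {k H}

theorem leaves_relabel {X Y : Type v} (f : X → Y) (t : UTree X) :
    leaves (relabel f t) = (leaves t).map f := by
  have key : ∀ a : FreeMagma X, leavesR (FreeMagma.map f a) = (leavesR a).map f := by
    intro a
    induction a with
    | ih1 x => simp
    | ih2 a b ha hb => simp [ha, hb]
  simp [leaves, relabel, key]

theorem numHairs_perm {l l' : List (Leaf H)} (h : l.Perm l') : numHairs l = numHairs l' :=
  (h.filterMap _).length_eq

theorem numEdges_perm {l l' : List (Leaf H)} (h : l.Perm l') : numEdges l = numEdges l' :=
  (h.filterMap _).length_eq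

theorem Matched.perm {l l' : List (Leaf H)} (h : l.Perm l') (hl : Matched l) : Matched l' :=
  ⟨(h.filterMap _).nodup_iff.1 hl.1, (h.filterMap _).symm.trans (hl.2.trans (h.filterMap _))⟩

variable (k) in
/-- The part of a tree that has `r` external edges and `s` hairs. -/
def partTree (s r : ℕ) (t : UTree (Leaf H)) : PreGraph k H :=
  if numEdges (leaves t) = r ∧ numHairs (leaves t) = s then gr k t else 0

variable (k H) in
/-- The projection onto the part with `r` external edges and `s` hairs. -/
def prePart (s r : ℕ) : PreGraph k H →ₗ[k] PreGraph k H :=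
  treeLift k Leaf.hair (partTree k s r)
    (fun a b => by
      have h : (leaves (a, b)).Perm (leaves (b, a)) := List.perm_append_comm
      simp only [partTree, numEdges_perm h, numHairs_perm h]
      split_ifs
      · exact treeMk_flip k _ _ _
      · rfl)
    (fun a b c => by
      have h : (leaves (a * b, c)).Perm (leaves (a, b * c)) := by simp [leaves]
      simp only [partTree, numEdges_perm h, numHairs_perm h]
      split_ifs
      · exact treeMk_move k _ _ _ _
      · rfl)
    (fun a b c => by
      have h : (leaves (a, b * c)).Perm (leaves (a, c * b)) :=
        List.perm_append_comm.append_left _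
      simp only [partTree, numEdges_perm h, numHairs_perm h]
      split_ifs
      · exact treeMk_antisymm k _ _ _ _
      · simp)
    (fun a b c d => by
      have h : (leaves (a, c * d * b)).Perm (leaves (a, b * c * d)) := by
        refine List.Perm.append_left _ ?_
        simp only [leavesR_mul]
        exact List.perm_append_comm.trans (by simp)
      have h' : (leaves (a, d * b * c)).Perm (leaves (a, b * c * d)) := by
        refine List.Perm.append_left _ ?_
        simp only [leavesR_mul]
        rw [List.append_assoc]
        exact List.perm_append_comm
      simp only [partTree, numEdges_perm h, numHairs_perm h, numEdges_perm h', numHairs_perm h']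
      split_ifs
      · exact treeMk_ihx k _ _ _ _ _
      · simp)
    (fun r v w a => by
      have hE : ∀ u : H, numEdges (leaves (.of (.hair u), a)) = numEdges (leavesR a) := fun u => rfl
      have hH : ∀ u : H, numHairs (leaves (.of (.hair u), a)) = numHairs (leavesR a) + 1 :=
        fun u => rfl
      simp only [partTree, hE, hH]
      split_ifs
      · exact treeMk_linear k _ r v w _
      · simp)

theorem prePart_gr (s r : ℕ) (t : UTree (Leaf H)) :
    prePart k H s r (gr k t) =
      if numEdges (leaves t) = r ∧ numHairs (leaves t) = s then gr k t else 0 :=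
  treeLift_mk k _ _ _ _ _ _ _ t

theorem prePart_mem (s r : ℕ) (x : PreGraph k H) (hx : x ∈ PreC₁ k H) :
    prePart k H s r x ∈ PreC₁Part k H s r := by
  refine (Submodule.span_le (p := (PreC₁Part k H s r).comap (prePart k H s r))).2 ?_ hx
  rintro _ ⟨t, ht, rfl⟩
  simp only [Submodule.comap_coe, Set.mem_preimage, SetLike.mem_coe, prePart_gr]
  split_ifs with h
  · exact Submodule.subset_span ⟨t, ht, h.1, h.2, rfl⟩
  · exact zero_mem _

theorem filterMap_hair_rename (f : ℕ → ℕ) (l : List (Leaf H)) :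
    (l.map (Leaf.rename f)).filterMap Leaf.hair? = l.filterMap Leaf.hair? := by
  rw [List.filterMap_map]
  congr 1
  funext x
  cases x <;> rfl

theorem filterMap_tail_rename (f : ℕ → ℕ) (l : List (Leaf H)) :
    (l.map (Leaf.rename f)).filterMap Leaf.tail? = (l.filterMap Leaf.tail?).map f := by
  rw [List.filterMap_map, List.map_filterMap]
  congr 1
  funext x
  cases x <;> rfl

theorem filterMap_head_rename (f : ℕ → ℕ) (l : List (Leaf H)) :
    (l.map (Leaf.rename f)).filterMap Leaf.head? = (l.filterMap Leaf.head?).map f := by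
  rw [List.filterMap_map, List.map_filterMap]
  congr 1
  funext x
  cases x <;> rfl

theorem filterMap_hair_switch (e : ℕ) (l : List (Leaf H)) :
    (l.map (Leaf.switch e)).filterMap Leaf.hair? = l.filterMap Leaf.hair? := by
  rw [List.filterMap_map]
  congr 1
  funext x
  cases x <;> simp only [Function.comp, Leaf.switch] <;> (try split_ifs) <;> rfl

theorem numEdges_switch (e : ℕ) (l : List (Leaf H)) :
    numEdges (l.map (Leaf.switch e)) + (l.filterMap Leaf.tail?).count e
      = numEdges l + (l.filterMap Leaf.head?).count e := by
  induction l with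
  | nil => rfl
  | cons x l ih =>
    unfold numEdges at ih ⊢
    cases x with
    | hair v => simpa [-List.filterMap_map, List.filterMap_cons, Leaf.switch, Leaf.tail?, Leaf.head?] using ih
    | tail e' =>
      by_cases h : e' = e
      · subst h
        simp [-List.filterMap_map, List.filterMap_cons, Leaf.switch, Leaf.tail?, Leaf.head?]
        omega
      · simp [-List.filterMap_map, List.filterMap_cons, Leaf.switch, Leaf.tail?, Leaf.head?, h]
        omega
    | head e' =>
      by_cases h : e' = e
      · subst h
        simp [-List.filterMap_map, List.filterMap_cons, Leaf.switch, Leaf.tail?, Leaf.head?]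
        omega
      · simp [-List.filterMap_map, List.filterMap_cons, Leaf.switch, Leaf.tail?, Leaf.head?, h]
        omega

theorem prePart_edgeRel (s r : ℕ) (x : PreGraph k H) (hx : x ∈ edgeRel k H) :
    prePart k H s r x ∈ edgeRel k H := by
  refine (Submodule.span_le (p := (edgeRel k H).comap (prePart k H s r))).2 ?_ hx
  rintro _ (⟨t, e, ht, he, rfl⟩ | ⟨t, f, ht, hf, rfl⟩)
  · have hE : numEdges (leaves (relabel (Leaf.switch e) t)) = numEdges (leaves t) := by
      have := numEdges_switch e (leaves t)
      rw [ht.2.count_eq] at this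
      rw [leaves_relabel]
      omega
    have hH : numHairs (leaves (relabel (Leaf.switch e) t)) = numHairs (leaves t) := by
      rw [leaves_relabel, numHairs, filterMap_hair_switch, numHairs]
    simp only [Submodule.comap_coe, Set.mem_preimage, SetLike.mem_coe, map_add, prePart_gr, hE, hH]
    split_ifs with h
    · exact Submodule.subset_span (Or.inl ⟨t, e, ht, he, rfl⟩)
    · simp
  · have hE : numEdges (leaves (relabel (Leaf.rename f) t)) = numEdges (leaves t) := by
      rw [leaves_relabel, numEdges, filterMap_tail_rename, List.length_map, numEdges]
    have hH : numHairs (leaves (relabel (Leaf.rename f) t)) = numHairs (leaves t) := by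
      rw [leaves_relabel, numHairs, filterMap_hair_rename, numHairs]
    simp only [Submodule.comap_coe, Set.mem_preimage, SetLike.mem_coe, map_sub, prePart_gr, hE, hH]
    split_ifs with h
    · exact Submodule.subset_span (Or.inr ⟨t, f, ht, hf, rfl⟩)
    · simp

theorem joinSign_ne_zero {x y : Leaf H} (h : joinSign k x y ≠ 0) (l l' : List (Leaf H)) :
    numEdges (x :: l) + numEdges (y :: l') = numEdges l + numEdges l' + 1 ∧
    numHairs (x :: l) + numHairs (y :: l') = numHairs l + numHairs l' := by
  cases x <;> cases y <;>
    simp [joinSign, numEdges, numHairs, List.filterMap_cons, Leaf.tail?, Leaf.hair?] at h ⊢ <;>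
    omega

theorem prePart_boundary (s r : ℕ) (Γ : UTree (Leaf H) × UTree (Leaf H)) :
    prePart k H s r (boundary k Γ) =
      if numEdges (leaves₂ Γ) = r + 1 ∧ numHairs (leaves₂ Γ) = s then boundary k Γ else 0 := by
  have key : ∀ p ∈ rootings Γ.1, ∀ q ∈ rootings Γ.2,
      prePart k H s r (joinSign k p.1 q.1 • gr k (p.2, q.2)) =
        if numEdges (leaves₂ Γ) = r + 1 ∧ numHairs (leaves₂ Γ) = s then
          joinSign k p.1 q.1 • gr k (p.2, q.2) else 0 := by
    intro p hp q hq
    by_cases h : joinSign k p.1 q.1 = 0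
    · simp [h]
    · have h1 := joinSign_ne_zero h (leavesR p.2) (leavesR q.2)
      have hE : ∀ l l' : List (Leaf H), numEdges (l ++ l') = numEdges l + numEdges l' := by
        intro l l'; simp [numEdges]
      have hH : ∀ l l' : List (Leaf H), numHairs (l ++ l') = numHairs l + numHairs l' := by
        intro l l'; simp [numHairs]
      rw [numEdges_perm (rootings_perm _ p hp), numEdges_perm (rootings_perm _ q hq),
        numHairs_perm (rootings_perm _ p hp), numHairs_perm (rootings_perm _ q hq),
        ← hE, ← hE, ← hH, ← hH] at h1
      change numEdges (leaves₂ Γ) = numEdges (leaves (p.2, q.2)) + 1 ∧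
        numHairs (leaves₂ Γ) = numHairs (leaves (p.2, q.2)) at h1
      rw [map_smul, prePart_gr, h1.1, h1.2]
      simp only [add_left_inj]
      split_ifs <;> simp
  have hsum : prePart k H s r (boundary k Γ) =
      ((rootings Γ.1).map fun p => ((rootings Γ.2).map fun q =>
        if numEdges (leaves₂ Γ) = r + 1 ∧ numHairs (leaves₂ Γ) = s then
          joinSign k p.1 q.1 • gr k (p.2, q.2) else 0).sum).sum := by
    rw [boundary, map_list_sum, List.map_map]
    congr 1
    refine List.map_congr_left fun p hp => ?_
    rw [Function.comp, map_list_sum, List.map_map]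
    congr 1
    exact List.map_congr_left fun q hq => key p hp q hq
  rw [hsum]
  split_ifs
  · rfl
  · simp

theorem prePart_bdS₂ (s r : ℕ) (x : PreGraph k H) (hx : x ∈ bdS₂ k H) :
    prePart k H s r x ∈ bdS₂Part k H s r := by
  refine (Submodule.span_le (p := (bdS₂Part k H s r).comap (prePart k H s r))).2 ?_ hx
  rintro _ ⟨Γ, hΓ, rfl⟩
  simp only [Submodule.comap_coe, Set.mem_preimage, SetLike.mem_coe, prePart_boundary]
  split_ifs with h
  · exact Submodule.subset_span ⟨Γ, hΓ, h.1, h.2, rfl⟩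
  · exact zero_mem _

theorem tails_hair (t : UTree H) :
    (leaves (relabel Leaf.hair t)).filterMap Leaf.tail? = [] := by
  rw [leaves_relabel, List.filterMap_map]
  simp [Function.comp_def, Leaf.tail?]

theorem heads_hair (t : UTree H) :
    (leaves (relabel Leaf.hair t)).filterMap Leaf.head? = [] := by
  rw [leaves_relabel, List.filterMap_map]
  simp [Function.comp_def, Leaf.head?]

theorem prePart_inclT (s r : ℕ) (hr : 1 ≤ r) : prePart k H s r ∘ₗ inclT k H = 0 := by
  apply treeSpace_ext
  intro t
  rw [LinearMap.comp_apply, inclT_mk, prePart_gr, if_neg, LinearMap.zero_apply]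
  rintro ⟨h, -⟩
  rw [numEdges, tails_hair, List.length_nil] at h
  omega

variable (k H) in
/-- The projection `Ω(H) → Ω_{s,r}(H)`, for `r ≥ 1`. -/
def projOmega (s r : ℕ) (hr : 1 ≤ r) : Omega k H →ₗ[k] OmegaPart k H s r :=
  Submodule.mapQ _ _ ((prePart k H s r).restrict (prePart_mem s r)) <| by
    rintro ⟨x, hx⟩ hx'
    change x ∈ edgeRel k H ⊔ bdS₂ k H ⊔ LinearMap.range (inclT k H) at hx'
    change prePart k H s r x ∈ edgeRel k H ⊔ bdS₂Part k H s r
    obtain ⟨y, hy, z, ⟨w, rfl⟩, rfl⟩ := Submodule.mem_sup.1 hx'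
    obtain ⟨y, hy', z, hz, rfl⟩ := Submodule.mem_sup.1 hy
    have h0 : prePart k H s r (inclT k H w) = 0 :=
      LinearMap.congr_fun (prePart_inclT (k := k) (H := H) s r hr) w
    have h1 : prePart k H s r (y + z + inclT k H w) = prePart k H s r y + prePart k H s r z := by
      rw [map_add, map_add, h0, add_zero]
    rw [h1]
    exact add_mem (Submodule.mem_sup_left (prePart_edgeRel s r y hy'))
      (Submodule.mem_sup_right (prePart_bdS₂ s r z hz))

end Projection

/-! ### The trace maps `Tr^{CKV}` and `Tr^C` -/

section Trace

variable {k H}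

/-- For every hair of `a`, the pair of its label `v` and the tree obtained from `a` by replacing
this hair by the leaf `ℓ`. -/
def replaceR (ℓ : Leaf H) : FreeMagma (Leaf H) → List (H × FreeMagma (Leaf H))
  | .of (.hair v) => [(v, .of ℓ)]
  | .of (.tail _) => []
  | .of (.head _) => []
  | .mul a b => (replaceR ℓ a).map (fun p => (p.1, p.2 * b)) ++
      (replaceR ℓ b).map (fun p => (p.1, a * p.2))

/-- For every hair of `t`, the pair of its label `v` and the tree obtained from `t` by replacing
this hair by the leaf `ℓ`. -/
def replace (ℓ : Leaf H) (t : UTree (Leaf H)) : List (H × UTree (Leaf H)) :=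
  (replaceR ℓ t.1).map (fun p => (p.1, (p.2, t.2))) ++
    (replaceR ℓ t.2).map (fun p => (p.1, (t.1, p.2)))

@[simp] theorem replaceR_mul (ℓ : Leaf H) (a b : FreeMagma (Leaf H)) :
    replaceR ℓ (a * b) = (replaceR ℓ a).map (fun p => (p.1, p.2 * b)) ++
      (replaceR ℓ b).map (fun p => (p.1, a * p.2)) := rfl

theorem replaceR_perm (ℓ : Leaf H) (a : FreeMagma (Leaf H)) (p : H × FreeMagma (Leaf H))
    (hp : p ∈ replaceR ℓ a) :
    ∃ l, (leavesR a).Perm (.hair p.1 :: l) ∧ (leavesR p.2).Perm (ℓ :: l) := by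
  induction a generalizing p with
  | ih1 x =>
    cases x <;> simp only [replaceR, List.mem_singleton, List.not_mem_nil] at hp
    subst hp
    exact ⟨[], by simp, by simp⟩
  | ih2 a b ha hb =>
    simp only [replaceR_mul, List.mem_append, List.mem_map] at hp
    rcases hp with ⟨q, hq, rfl⟩ | ⟨q, hq, rfl⟩
    · obtain ⟨l, h1, h2⟩ := ha q hq
      exact ⟨l ++ leavesR b, h1.append_right _, h2.append_right _⟩
    · obtain ⟨l, h1, h2⟩ := hb q hq
      exact ⟨leavesR a ++ l, (h1.append_left _).trans List.perm_middle,
        (h2.append_left _).trans List.perm_middle⟩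

theorem replace_perm (ℓ : Leaf H) (t : UTree (Leaf H)) (p : H × UTree (Leaf H))
    (hp : p ∈ replace ℓ t) :
    ∃ l, (leaves t).Perm (.hair p.1 :: l) ∧ (leaves p.2).Perm (ℓ :: l) := by
  simp only [replace, List.mem_append, List.mem_map] at hp
  rcases hp with ⟨q, hq, rfl⟩ | ⟨q, hq, rfl⟩
  · obtain ⟨l, h1, h2⟩ := replaceR_perm ℓ _ q hq
    exact ⟨l ++ leavesR t.2, h1.append_right _, h2.append_right _⟩
  · obtain ⟨l, h1, h2⟩ := replaceR_perm ℓ _ q hq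
    exact ⟨leavesR t.1 ++ l, (h1.append_left _).trans List.perm_middle,
      (h2.append_left _).trans List.perm_middle⟩

/-- Auxiliary: a sum over the hairs of a rooted tree. -/
def hairSum {M : Type*} [AddCommGroup M] (ℓ : Leaf H) (a : FreeMagma (Leaf H))
    (f : H → FreeMagma (Leaf H) → M) : M :=
  ((replaceR ℓ a).map fun p => f p.1 p.2).sum

theorem hairSum_mul {M : Type*} [AddCommGroup M] (ℓ : Leaf H) (a b : FreeMagma (Leaf H))
    (f : H → FreeMagma (Leaf H) → M) :
    hairSum ℓ (a * b) f = hairSum ℓ a (fun v c => f v (c * b)) +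
      hairSum ℓ b (fun v c => f v (a * c)) := by
  simp [hairSum, Function.comp_def]

theorem hairSum_add {M : Type*} [AddCommGroup M] (ℓ : Leaf H) (a : FreeMagma (Leaf H))
    (f g : H → FreeMagma (Leaf H) → M) :
    hairSum ℓ a f + hairSum ℓ a g = hairSum ℓ a (fun v c => f v c + g v c) := by
  simp [hairSum, List.sum_map_add]

theorem hairSum_eq_zero {M : Type*} [AddCommGroup M] (ℓ : Leaf H) (a : FreeMagma (Leaf H))
    (f : H → FreeMagma (Leaf H) → M) (h : ∀ v c, f v c = 0) : hairSum ℓ a f = 0 := by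
  simp [hairSum, h]

theorem hairSum_smul {M : Type*} [AddCommGroup M] [Module k M] (r : k) (ℓ : Leaf H)
    (a : FreeMagma (Leaf H)) (f : H → FreeMagma (Leaf H) → M) :
    r • hairSum ℓ a f = hairSum ℓ a (fun v c => r • f v c) := by
  simp [hairSum, List.smul_sum, Function.comp_def]

variable (k) in
/-- `∑ v ⊗ t'`, where the sum runs over the hairs of `t`, `v` is the label of the hair, and in `t'`
the hair is replaced by the leaf `ℓ`. -/
def detachTree (ℓ : Leaf H) (t : UTree (Leaf H)) : H ⊗[k] PreGraph k H :=
  ((replace ℓ t).map fun p => p.1 ⊗ₜ[k] gr k p.2).sum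

theorem detachTree_eq (ℓ : Leaf H) (a b : FreeMagma (Leaf H)) :
    detachTree k ℓ (a, b) = hairSum ℓ a (fun v c => v ⊗ₜ[k] gr k (c, b)) +
      hairSum ℓ b (fun v c => v ⊗ₜ[k] gr k (a, c)) := by
  simp [detachTree, replace, hairSum, Function.comp_def]

theorem gr_flip (a b : FreeMagma (Leaf H)) : gr k (a, b) = gr k (b, a) := treeMk_flip k _ a b
theorem gr_move (a b c : FreeMagma (Leaf H)) : gr k (a * b, c) = gr k (a, b * c) :=
  treeMk_move k _ a b c
theorem gr_antisymm (a b c : FreeMagma (Leaf H)) : gr k (a, b * c) + gr k (a, c * b) = 0 :=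
  treeMk_antisymm k _ a b c
theorem gr_ihx (a b c d : FreeMagma (Leaf H)) :
    gr k (a, b * c * d) + gr k (a, c * d * b) + gr k (a, d * b * c) = 0 := treeMk_ihx k _ a b c d

variable (k) in
/-- The linear map `t ↦ ∑ v ⊗ t'`, where the sum runs over the hairs of `t`, `v` is the label of
the hair, and in `t'` the hair is replaced by the leaf `ℓ`. -/
def detach (ℓ : Leaf H) : PreGraph k H →ₗ[k] H ⊗[k] PreGraph k H :=
  treeLift k Leaf.hair (detachTree k ℓ)
    (fun a b => by
      simp only [detachTree_eq, gr_flip _ b, gr_flip _ a]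
      rw [add_comm])
    (fun a b c => by
      simp only [detachTree_eq, hairSum_mul, gr_move, add_assoc])
    (fun a b c => by
      simp only [detachTree_eq, hairSum_mul]
      have key : ∀ (e : FreeMagma (Leaf H)) (f g : FreeMagma (Leaf H) → UTree (Leaf H)),
          (∀ x, gr k (f x) + gr k (g x) = 0) →
          hairSum ℓ e (fun v x => v ⊗ₜ[k] gr k (f x)) + hairSum ℓ e (fun v x => v ⊗ₜ[k] gr k (g x))
            = 0 := by
        intro e f g hz
        rw [hairSum_add]
        refine hairSum_eq_zero _ _ _ fun v x => ?_
        rw [← TensorProduct.tmul_add, hz, TensorProduct.tmul_zero]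
      have h1 := key a (fun x => (x, b * c)) (fun x => (x, c * b)) fun x => gr_antisymm _ _ _
      have h2 := key b (fun x => (a, x * c)) (fun x => (a, c * x)) fun x => gr_antisymm _ _ _
      have h3 := key c (fun x => (a, b * x)) (fun x => (a, x * b)) fun x => gr_antisymm _ _ _
      have := congrArg₂ (· + ·) h1 (congrArg₂ (· + ·) h2 h3)
      simp only [add_zero] at this
      rw [← this]
      abel)
    (fun a b c d => by
      simp only [detachTree_eq, hairSum_mul]
      have key : ∀ (e : FreeMagma (Leaf H)) (f g h : FreeMagma (Leaf H) → UTree (Leaf H)),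
          (∀ x, gr k (f x) + gr k (g x) + gr k (h x) = 0) →
          hairSum ℓ e (fun v x => v ⊗ₜ[k] gr k (f x)) + hairSum ℓ e (fun v x => v ⊗ₜ[k] gr k (g x))
            + hairSum ℓ e (fun v x => v ⊗ₜ[k] gr k (h x)) = 0 := by
        intro e f g h hz
        rw [hairSum_add, hairSum_add]
        refine hairSum_eq_zero _ _ _ fun v x => ?_
        rw [← TensorProduct.tmul_add, ← TensorProduct.tmul_add, hz, TensorProduct.tmul_zero]
      have h1 := key a (fun x => (x, b * c * d)) (fun x => (x, c * d * b))
        (fun x => (x, d * b * c)) fun x => gr_ihx _ _ _ _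
      have h2 := key b (fun x => (a, x * c * d)) (fun x => (a, c * d * x))
        (fun x => (a, d * x * c)) fun x => gr_ihx _ _ _ _
      have h3 := key c (fun x => (a, b * x * d)) (fun x => (a, x * d * b))
        (fun x => (a, d * b * x)) fun x => gr_ihx _ _ _ _
      have h4 := key d (fun x => (a, b * c * x)) (fun x => (a, c * x * b))
        (fun x => (a, x * b * c)) fun x => gr_ihx _ _ _ _
      have := congrArg₂ (· + ·) (congrArg₂ (· + ·) h1 h2) (congrArg₂ (· + ·) h3 h4)
      simp only [add_zero] at this
      rw [← this]
      abel)
    (fun r v w a => by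
      have h0 : ∀ u : H, hairSum ℓ (.of (.hair u)) (fun v c => v ⊗ₜ[k] gr k (c, a)) =
          u ⊗ₜ[k] gr k (.of ℓ, a) := fun u => by simp [hairSum, replaceR]
      have h1 : ∀ c : FreeMagma (Leaf H), gr k (.of (.hair (r • v + w)), c) =
          r • gr k (.of (.hair v), c) + gr k (.of (.hair w), c) :=
        fun c => treeMk_linear k _ r v w c
      simp only [detachTree_eq, h0, h1, TensorProduct.tmul_add, TensorProduct.tmul_smul,
        ← hairSum_add, ← hairSum_smul, smul_add]
      rw [TensorProduct.add_tmul, TensorProduct.smul_tmul']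
      abel)

theorem detach_gr (ℓ : Leaf H) (t : UTree (Leaf H)) :
    detach k ℓ (gr k t) = ((replace ℓ t).map fun p => p.1 ⊗ₜ[k] gr k p.2).sum :=
  treeLift_mk k _ _ _ _ _ _ _ t

variable (k H) in
/-- Renaming the external edges from `0, 1, …` to `1, 2, …`. -/
def shift : PreGraph k H →ₗ[k] PreGraph k H :=
  treeLift k Leaf.hair (fun t => gr k (relabel (Leaf.rename Nat.succ) t))
    (fun a b => treeMk_flip k _ _ _)
    (fun a b c => treeMk_move k _ _ _ _)
    (fun a b c => treeMk_antisymm k _ _ _ _)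
    (fun a b c d => treeMk_ihx k _ _ _ _ _)
    (fun r v w a => treeMk_linear k _ r v w _)

theorem shift_gr (t : UTree (Leaf H)) :
    shift k H (gr k t) = gr k (relabel (Leaf.rename Nat.succ) t) :=
  treeLift_mk k _ _ _ _ _ _ _ t

/-- The operator `T`: sum over all pairs of hairs of a hairy graph, joining the two hairs by a new
external edge and multiplying by the contraction `⟨v, w⟩` of the two labels, where the edge is
directed from the hair labelled `v` to the hair labelled `w`.

The two directions of the new edge give the same element of `C₁ℋ(H)`.  Instead of choosing one of
them, the operator takes one half of the sum over all ordered pairs of distinct hairs; see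
`addEdge_gr`.  The other edges are renamed so that the new edge can be named `0`. -/
def addEdge (ω : LinearMap.BilinForm k H) : Module.End k (PreGraph k H) :=
  (2⁻¹ : k) • ((TensorProduct.lid k (PreGraph k H)).toLinearMap ∘ₗ
    (TensorProduct.lift ω).rTensor (PreGraph k H) ∘ₗ
    (TensorProduct.assoc k H H (PreGraph k H)).symm.toLinearMap ∘ₗ
    (detach k (.head 0)).lTensor H ∘ₗ detach k (.tail 0) ∘ₗ shift k H)

theorem addEdge_gr (ω : LinearMap.BilinForm k H) (t : UTree (Leaf H)) :
    addEdge ω (gr k t) = (2⁻¹ : k) •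
      ((replace (.tail 0) (relabel (Leaf.rename Nat.succ) t)).map fun p =>
        ((replace (.head 0) p.2).map fun q => ω p.1 q.1 • gr k q.2).sum).sum := by
  simp only [addEdge, LinearMap.smul_apply, LinearMap.comp_apply, shift_gr, detach_gr,
    map_list_sum, List.map_map, Function.comp_def, LinearMap.lTensor_tmul]
  congr 3
  funext p
  have h : ∀ l : List (H ⊗[k] PreGraph k H),
      p.1 ⊗ₜ[k] l.sum = (l.map fun y => p.1 ⊗ₜ[k] y).sum := fun l =>
    map_list_sum (TensorProduct.mk k H (H ⊗[k] PreGraph k H) p.1) l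
  rw [h]
  simp [map_list_sum, List.map_map, Function.comp_def]

theorem replace_replace (t : UTree (Leaf H)) (p q : H × UTree (Leaf H))
    (hp : p ∈ replace (.tail 0) (relabel (Leaf.rename Nat.succ) t))
    (hq : q ∈ replace (.head 0) p.2) :
    numHairs (leaves q.2) + 2 = numHairs (leaves t) ∧ (IsHairy t → IsHairy q.2) := by
  obtain ⟨l, h1, h2⟩ := replace_perm _ _ p hp
  obtain ⟨l', h3, h4⟩ := replace_perm _ _ q hq
  rw [leaves_relabel] at h1
  have h5 := h2.symm.trans h3
  have hH1 := h1.filterMap Leaf.hair?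
  have hH2 := h5.filterMap Leaf.hair?
  have hH3 := h4.filterMap Leaf.hair?
  have hT1 := h1.filterMap Leaf.tail?
  have hT2 := h5.filterMap Leaf.tail?
  have hT3 := h4.filterMap Leaf.tail?
  have hD1 := h1.filterMap Leaf.head?
  have hD2 := h5.filterMap Leaf.head?
  have hD3 := h4.filterMap Leaf.head?
  rw [filterMap_hair_rename] at hH1
  rw [filterMap_tail_rename] at hT1
  rw [filterMap_head_rename] at hD1
  simp only [List.filterMap_cons, Leaf.hair?, Leaf.tail?] at hH1 hH2 hH3 hT1 hT2 hT3
  simp only [List.filterMap_cons, Leaf.head?] at hD1 hD2 hD3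
  constructor
  · have e1 := hH1.length_eq
    have e2 := hH2.length_eq
    have e3 := hH3.length_eq
    simp only [List.length_cons] at e1 e2 e3
    simp only [numHairs]
    omega
  · rintro ⟨hn, hm⟩
    have hT : (List.filterMap Leaf.tail? (leaves q.2)).Perm
        (0 :: (List.filterMap Leaf.tail? (leaves t)).map Nat.succ) :=
      hT3.trans (hT2.symm.trans (hT1.symm.cons 0))
    have hD : (List.filterMap Leaf.head? (leaves q.2)).Perm
        (0 :: (List.filterMap Leaf.head? (leaves t)).map Nat.succ) :=
      hD3.trans ((hD2.symm.trans hD1.symm).cons 0)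
    refine ⟨hT.nodup_iff.2 ?_, hD.trans (((hm.map _).cons 0).trans hT.symm)⟩
    rw [List.nodup_cons]
    exact ⟨by simp, hn.map Nat.succ_injective⟩

theorem addEdge_mem (ω : LinearMap.BilinForm k H) (x : PreGraph k H) (hx : x ∈ PreC₁ k H) :
    addEdge ω x ∈ PreC₁ k H := by
  refine (Submodule.span_le (p := (PreC₁ k H).comap (addEdge ω))).2 ?_ hx
  rintro _ ⟨t, ht, rfl⟩
  simp only [Submodule.comap_coe, Set.mem_preimage, SetLike.mem_coe, addEdge_gr]
  refine Submodule.smul_mem _ _ (list_sum_mem fun y hy => ?_)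
  obtain ⟨p, hp, rfl⟩ := List.mem_map.1 hy
  refine list_sum_mem fun y hy => ?_
  obtain ⟨q, hq, rfl⟩ := List.mem_map.1 hy
  exact Submodule.smul_mem _ _ (Submodule.subset_span
    ⟨q.2, (replace_replace t p q hp hq).2 ht, rfl⟩)

theorem addEdge_pow_gr (ω : LinearMap.BilinForm k H) (n : ℕ) (t : UTree (Leaf H))
    (ht : numHairs (leaves t) ≤ n) : (addEdge ω ^ (n + 1)) (gr k t) = 0 := by
  induction n using Nat.strong_induction_on generalizing t with
  | _ n ih =>
    rw [pow_succ, Module.End.mul_apply, addEdge_gr, map_smul, map_list_sum, List.map_map]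
    rw [List.sum_eq_zero, smul_zero]
    intro y hy
    obtain ⟨p, hp, rfl⟩ := List.mem_map.1 hy
    rw [Function.comp, map_list_sum, List.map_map]
    refine List.sum_eq_zero fun y hy => ?_
    obtain ⟨q, hq, rfl⟩ := List.mem_map.1 hy
    have h := (replace_replace t p q hp hq).1
    rw [Function.comp, map_smul]
    obtain ⟨m, rfl⟩ : ∃ m, n = m + 1 := ⟨n - 1, by omega⟩
    rw [ih m (by omega) q.2 (by omega), smul_zero]

theorem addEdge_locallyNilpotent (ω : LinearMap.BilinForm k H) (x : PreGraph k H) :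
    ∃ N, ∀ n, N ≤ n → (addEdge ω ^ n) x = 0 := by
  refine Submodule.span_induction ?_ ?_ ?_ ?_ (span_treeMk k Leaf.hair x)
  · rintro _ ⟨t, rfl⟩
    refine ⟨numHairs (leaves t) + 1, fun n hn => ?_⟩
    obtain ⟨m, rfl⟩ : ∃ m, n = m + 1 := ⟨n - 1, by omega⟩
    exact addEdge_pow_gr ω m t (by omega)
  · exact ⟨0, fun n _ => map_zero _⟩
  · rintro x y - - ⟨N, hN⟩ ⟨M, hM⟩
    exact ⟨max N M, fun n hn => by
      rw [map_add, hN n (le_trans (le_max_left _ _) hn), hM n (le_trans (le_max_right _ _) hn),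
        add_zero]⟩
  · rintro r x - ⟨N, hN⟩
    exact ⟨N, fun n hn => by rw [map_smul, hN n hn, smul_zero]⟩

theorem finite_support_exp (ω : LinearMap.BilinForm k H) (x : PreGraph k H) :
    (Function.support fun n : ℕ => ((n.factorial : k)⁻¹) • (addEdge ω ^ n) x).Finite := by
  obtain ⟨N, hN⟩ := addEdge_locallyNilpotent ω x
  refine (Set.finite_Iio N).subset fun n hn => ?_
  by_contra h
  exact hn (by simp [hN n (not_lt.1 h)])

/-- `exp(T) = ∑_n Tⁿ / n!`, a finite sum on every element. -/
def expAddEdge (ω : LinearMap.BilinForm k H) : PreGraph k H →ₗ[k] PreGraph k H where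
  toFun x := ∑ᶠ n : ℕ, ((n.factorial : k)⁻¹) • (addEdge ω ^ n) x
  map_add' x y := by
    rw [← finsum_add_distrib (finite_support_exp ω x) (finite_support_exp ω y)]
    simp only [map_add, smul_add]
  map_smul' r x := by
    rw [RingHom.id_apply, smul_finsum' r (finite_support_exp ω x)]
    simp only [map_smul, smul_comm r]

theorem addEdge_pow_mem (ω : LinearMap.BilinForm k H) (n : ℕ) (x : PreGraph k H)
    (hx : x ∈ PreC₁ k H) : (addEdge ω ^ n) x ∈ PreC₁ k H := by
  induction n with
  | zero => exact hx
  | succ n ih => rw [pow_succ', Module.End.mul_apply]; exact addEdge_mem ω _ ih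

theorem inclT_mem (x : T k H) : inclT k H x ∈ PreC₁ k H := by
  refine Submodule.span_induction ?_ ?_ ?_ ?_ (span_treeMk k id x)
  · rintro _ ⟨t, rfl⟩
    rw [inclT_mk]
    refine Submodule.subset_span ⟨_, ⟨?_, ?_⟩, rfl⟩
    · rw [tails_hair]; exact List.nodup_nil
    · rw [tails_hair, heads_hair]
  · rw [map_zero]; exact zero_mem _
  · rintro x y - - hx hy
    rw [map_add]; exact add_mem hx hy
  · rintro r x - hx
    rw [map_smul]; exact Submodule.smul_mem _ _ hx

/-- `Tr^{CKV} = exp(T) ∘ ι` on `𝒯(H)`, as a map to representatives of elements of `C₁ℋ(H)`. -/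
def trCKV (ω : LinearMap.BilinForm k H) : T k H →ₗ[k] PreC₁ k H :=
  (expAddEdge ω ∘ₗ inclT k H).codRestrict (PreC₁ k H) fun x =>
    finsum_induction (· ∈ PreC₁ k H) (zero_mem _) (fun _ _ => add_mem) fun n =>
      Submodule.smul_mem _ _ (addEdge_pow_mem ω n _ (inclT_mem x))

/-- `Tr^C : 𝒯(H) → Ω(H)`, the composition of `Tr^{CKV}` with the projection to `Ω(H)`. -/
def trC (ω : LinearMap.BilinForm k H) : T k H →ₗ[k] Omega k H :=
  Submodule.mkQ _ ∘ₗ trCKV ω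

end Trace

/-! ### Loops with hairs -/

section Loop

variable {k H}

/-- The loop with hairs `v₁, …, v_s`: the tree `⟦⋯⟦⟦•, v₁⟧, v₂⟧⋯, v_s⟧`, whose root is joined to
the leaf `•` by an external edge directed from the root to `•`.  When one goes around the loop in
the direction of this edge, one meets `v₁, …, v_s` in this order. -/
def loopTree {s : ℕ} (v : Fin s → H) : UTree (Leaf H) :=
  (.of (.tail 0), (List.ofFn v).foldl (fun a x => a * .of (.hair x)) (.of (.head 0)))

theorem leaves_loopTree {s : ℕ} (v : Fin s → H) :
    leaves (loopTree v) = .tail 0 :: .head 0 :: (List.ofFn v).map Leaf.hair := by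
  have key : ∀ (l : List H) (a : FreeMagma (Leaf H)),
      leavesR (l.foldl (fun a x => a * .of (.hair x)) a) = leavesR a ++ l.map Leaf.hair := by
    intro l
    induction l with
    | nil => simp
    | cons x l ih => intro a; simp [ih]
  simp [leaves, loopTree, key]

theorem loopTree_mem {s : ℕ} (v : Fin s → H) : gr k (loopTree v) ∈ PreC₁Part k H s 1 := by
  have h1 : ∀ l : List H, (l.map Leaf.hair).filterMap Leaf.tail? = [] := fun l => by
    rw [List.filterMap_map]; simp [Function.comp_def, Leaf.tail?]
  have h2 : ∀ l : List H, (l.map Leaf.hair).filterMap Leaf.head? = [] := fun l => by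
    rw [List.filterMap_map]; simp [Function.comp_def, Leaf.head?]
  have h3 : ∀ l : List H, (l.map Leaf.hair).filterMap Leaf.hair? = l := fun l => by
    rw [List.filterMap_map]; simp [Function.comp_def, Leaf.hair?]
  refine Submodule.subset_span ⟨_, ⟨?_, ?_⟩, ?_, ?_, rfl⟩ <;>
  simp [leaves_loopTree, numEdges, numHairs, -List.filterMap_map, -List.map_ofFn, List.filterMap_cons,
    h1, h2, h3,
    Leaf.tail?, Leaf.head?, Leaf.hair?]

variable (k) in
/-- The class in `Ω_{s,1}(H)` of the loop with hairs `v₁, …, v_s`. -/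
def loopClass {s : ℕ} (v : Fin s → H) : OmegaPart k H s 1 :=
  Submodule.mkQ _ ⟨gr k (loopTree v), loopTree_mem v⟩

end Loop

end Johnson

end

open Johnson

noncomputable section

namespace Johnson

universe u v

/-! ### Gluing rooted trees: the inverse of `η` -/

section TreeSpaceLemmas

variable (k : Type u) [Field k] {H : Type v} [AddCommGroup H] [Module k H] {X : Type v}
  (lab : H → X)

/-! The map `η` is inverted up to a scalar. Gluing a label back to the root of a rooted tree defines
a map from `H ⊗ L(H)` to trees (`labelRoot`). A tree with `s` trivalent vertices has `s + 2` leaves,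
and each of them gives back the same tree, so gluing after `η` is multiplication by `s + 2`
(`labelRoot_etaLin`); this gives injectivity. For surjectivity, a Dynkin–Specht–Wever type argument
with an action of the tensor algebra shows that `η` of the tree with root labelled `v` and branch
`a` is `(s + 2) v ⊗ a` minus a linear function of `⁅v, a⁆` (`exists_etaLin_eq`). The correction
vanishes on the kernel of the bracket.

Both traces are instances of one construction, `algTrace`. Given letters `p` in an associative
algebra and a bilinear form `β` on leaves, every leaf in turn is made the root, the remaining tree
is expanded as a commutator, and the first letter of each word is contracted with the root. With `β
= ω` this is the Enomoto–Satoh trace. With the form pairing tails and heads of external edges, it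
opens a graph with one external edge along that edge. The central fact is `reverse_algTrace`: an
antiautomorphism that negates letters replaces `β` by its transpose. The reversal `b` is minus the
antipode, and `ω` is skew, so the Enomoto–Satoh trace is `b`-invariant. Since `2` is invertible and
`b` is an involution, invariants and coinvariants of `b` agree.

For graphs with one external edge, the opening map takes values in dihedral coinvariants. It
respects switching the edge and kills the relators of rank one: for a tripod with two legs joined to
the other tree the two terms of the boundary cancel, by reversal and cyclicity (`loopTrace_slide`);
for a tripod with a self-edge the value is a commutator as soon as there are two hairs
(`loopTrace_loop`). In the other direction, AS and IHX reduce every graph with one edge to loops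
(`PreC₁Part_le`), switching the edge gives the reflection of a loop, and one boundary relator
combined with it gives the rotation (`loopGr_rotate`). Hence loops define a surjection from the
dihedral coinvariants, of which the opening map is a left inverse.

Finally, each application of `T` adds one edge, so only the linear term of `exp(T)` reaches rank
one. Joining two hairs and then opening the new edge is the contraction in `algTrace`; the factor
`1/2` appears because `algTrace` sums over ordered pairs of leaves, whereas `T` sums over unordered
ones (`loopTrace_addEdge`). -/

theorem treeMk_rootingsR (a c : FreeMagma X) (p : X × FreeMagma X) (hp : p ∈ rootingsR a c) :
    treeMk k lab (a, c) = treeMk k lab (.of p.1, p.2) := by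
  induction a generalizing c with
  | ih1 x => simp only [rootingsR_of, List.mem_singleton] at hp; subst hp; rfl
  | ih2 a b ha hb =>
    simp only [rootingsR_mul, List.mem_append] at hp
    rcases hp with hp | hp
    · rw [treeMk_move, ha _ hp]
    · rw [treeMk_flip, ← treeMk_move, treeMk_flip, hb _ hp]

/-- Rooting at a leaf only moves the cut to the edge at that leaf, so the underlying unitrivalent
tree does not change. -/
theorem treeMk_rootings (t : UTree X) (p : X × FreeMagma X) (hp : p ∈ rootings t) :
    treeMk k lab t = treeMk k lab (.of p.1, p.2) := by
  simp only [rootings, List.mem_append] at hp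
  rcases hp with hp | hp
  · exact treeMk_rootingsR k lab _ _ p hp
  · rw [← Prod.mk.eta (p := t), treeMk_flip]
    exact treeMk_rootingsR k lab _ _ p hp

/-- Cyclic symmetry of the three trees around a vertex. -/
theorem treeMk_rotate (a b c : FreeMagma X) :
    treeMk k lab (a * b, c) = treeMk k lab (b, c * a) := by
  rw [treeMk_flip, ← treeMk_move, treeMk_flip]

theorem treeMk_antisymm_left (a b c : FreeMagma X) :
    treeMk k lab (a * b, c) + treeMk k lab (b * a, c) = 0 := by
  rw [treeMk_flip, treeMk_flip k lab (b * a)]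
  exact treeMk_antisymm k lab c a b

theorem treeMk_swap (a b c : FreeMagma X) :
    treeMk k lab (a, b * c) = - treeMk k lab (a, c * b) :=
  eq_neg_of_add_eq_zero_left (treeMk_antisymm k lab a b c)

/-- The IHX relation in Leibniz form. -/
theorem treeMk_leibniz (x a b c : FreeMagma X) :
    treeMk k lab (x, a * (b * c)) =
      treeMk k lab (x, a * b * c) + treeMk k lab (x, b * (a * c)) := by
  have h := treeMk_ihx k lab x a b c
  have h1 : treeMk k lab (x, c * a * b) = treeMk k lab (x, b * (a * c)) := by
    rw [treeMk_swap, ← treeMk_move, treeMk_swap, neg_neg, treeMk_move]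
  rw [treeMk_swap k lab x (b * c) a, h1] at h
  rw [← sub_eq_zero, ← neg_eq_zero, ← h]
  abel

end TreeSpaceLemmas

variable (k : Type u) [Field k] (H : Type v) [AddCommGroup H] [Module k H]

theorem rootingsR_length {X : Type*} (a c : FreeMagma X) :
    (rootingsR a c).length = (leavesR a).length := by
  induction a generalizing c with
  | ih1 x => rfl
  | ih2 a b ha hb => simp [ha, hb]

/-! ### Descent of gluing to the free Lie algebra -/

section Gluing

/-- Gluing a linear combination of rooted trees to a rooted tree. -/
def glue : FreeNonUnitalNonAssocAlgebra k H →ₗ[k] FreeMagma H → T k H :=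
  (Finsupp.linearCombination k fun a c => treeMk k id (a, c)) ∘ₗ
    (MonoidAlgebra.coeffLinearEquiv k).toLinearMap

theorem glue_single (a c : FreeMagma H) (r : k) :
    glue k H (MonoidAlgebra.single a r) c = r • treeMk k id (a, c) := by
  simp [glue]

/-- The left factor of a product can be absorbed into the tree on the other side of the cut. Hence
the gluings of `x * y` depend on `y` only through its own gluings, which makes the kernel of `glue`
stable under left multiplication. -/
theorem glue_single_mul (a c : FreeMagma H) (r : k) (x : FreeNonUnitalNonAssocAlgebra k H) :
    glue k H (MonoidAlgebra.single a r * x) c = r • glue k H x (c * a) := by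
  induction x using MonoidAlgebra.induction_linear with
  | zero => simp
  | add x y hx hy => simp [mul_add, hx, hy]
  | single b t =>
    rw [MonoidAlgebra.single_mul_single, glue_single, glue_single, treeMk_rotate, mul_smul]

theorem glue_antisymm (x y : FreeNonUnitalNonAssocAlgebra k H) :
    glue k H (x * y) + glue k H (y * x) = 0 := by
  induction x using MonoidAlgebra.induction_linear with
  | zero => simp
  | add x x' hx hx' =>
    rw [add_mul, mul_add, map_add, map_add, add_add_add_comm, hx, hx', add_zero]
  | single a r =>
    induction y using MonoidAlgebra.induction_linear with
    | zero => simp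
    | add x x' hx hx' =>
      rw [add_mul, mul_add, map_add, map_add, add_add_add_comm, hx, hx', add_zero]
    | single b t =>
      funext c
      rw [MonoidAlgebra.single_mul_single, MonoidAlgebra.single_mul_single, Pi.add_apply,
        glue_single, glue_single, mul_comm t r, ← smul_add, treeMk_antisymm_left, smul_zero,
        Pi.zero_apply]

theorem glue_leibniz (x y z : FreeNonUnitalNonAssocAlgebra k H) :
    glue k H (x * (y * z)) = glue k H (x * y * z + y * (x * z)) := by
  induction x using MonoidAlgebra.induction_linear with
  | zero => simp
  | add x x' hx hx' => simp only [add_mul, map_add] at hx hx' ⊢; rw [hx, hx']; simp only [mul_add, map_add]; abel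
  | single a r =>
    induction y using MonoidAlgebra.induction_linear with
    | zero => simp
    | add x x' hx hx' => simp only [add_mul, mul_add, map_add] at hx hx' ⊢; rw [hx, hx']; abel
    | single b t =>
      induction z using MonoidAlgebra.induction_linear with
      | zero => simp
      | add x x' hx hx' => simp only [mul_add, map_add] at hx hx' ⊢; rw [hx, hx']; abel
      | single d q =>
        funext c
        simp only [MonoidAlgebra.single_mul_single, map_add, Pi.add_apply, glue_single]
        rw [treeMk_flip, treeMk_leibniz, smul_add, treeMk_flip k id c, treeMk_flip k id c]
        congr 2 <;> ring

theorem glue_mul_congr (x : FreeNonUnitalNonAssocAlgebra k H)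
    {y z : FreeNonUnitalNonAssocAlgebra k H} (h : glue k H y = glue k H z) :
    glue k H (x * y) = glue k H (x * z) := by
  induction x using MonoidAlgebra.induction_linear with
  | zero => simp
  | add x x' hx hx' => simp only [add_mul, map_add, hx, hx']
  | single a r => funext c; rw [glue_single_mul, glue_single_mul, h]

variable [CharZero k]

/-- The two Lie axioms become AS and IHX. Congruence in the left factor reduces to congruence in the
right factor by AS. -/
theorem glue_rel {x y : FreeNonUnitalNonAssocAlgebra k H} (h : FreeLieAlgebra.Rel k H x y) :
    glue k H x = glue k H y := by
  induction h with
  | lie_self a =>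
    -- AS with equal branches only gives that twice the element vanishes, so `2` has to be
    -- cancelled.
    have := glue_antisymm k H a a
    rw [← two_smul k, smul_eq_zero] at this
    rw [this.resolve_left two_ne_zero, map_zero]
  | leibniz_lie a b c => exact glue_leibniz k H a b c
  | smul t _ ih => rw [map_smul, map_smul, ih]
  | add_right c _ ih => rw [map_add, map_add, ih]
  | mul_left a _ ih => exact glue_mul_congr k H a ih
  | @mul_right a b c _ ih =>
    rw [eq_neg_of_add_eq_zero_left (glue_antisymm k H a c),
      eq_neg_of_add_eq_zero_left (glue_antisymm k H b c), glue_mul_congr k H c ih]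

/-- The map induced by `glue` on the free Lie algebra on the set `H`. -/
def glueFree : FreeLieAlgebra k H →ₗ[k] FreeMagma H → T k H where
  toFun x := Quot.liftOn x (glue k H) fun _ _ h => glue_rel k H h
  map_add' := by rintro ⟨x⟩ ⟨y⟩; exact map_add (glue k H) x y
  map_smul' := by rintro r ⟨x⟩; exact map_smul (glue k H) r x

theorem linIdeal_le_ker : (linIdeal k H).toSubmodule ≤ LinearMap.ker (glueFree k H) := by
  -- The kernel is an ideal because gluings of a product are determined by gluings of its right
  -- factor; it then suffices to check the generators of `linIdeal`, which is multilinearity of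
  -- labels.
  let I : LieIdeal k (FreeLieAlgebra k H) :=
    { LinearMap.ker (glueFree k H) with
      lie_mem := by
        rintro ⟨x⟩ ⟨y⟩ hy
        change glue k H y = 0 at hy
        change glue k H (x * y) = 0
        rw [glue_mul_congr k H x (z := 0) (by rw [hy, map_zero]), mul_zero, map_zero] }
  have : linIdeal k H ≤ I := by
    refine LieSubmodule.lieSpan_le.2 ?_
    rintro _ ⟨r, v, w, rfl⟩
    change glueFree k H _ = 0
    rw [map_sub, map_add, map_smul, sub_eq_zero]
    have key : ∀ u : H, glueFree k H (FreeLieAlgebra.of k u) =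
        fun c => treeMk k id (.of u, c) := fun u => by
      funext c
      exact (glue_single k H (.of u) c 1).trans (one_smul _ _)
    rw [key, key, key]
    funext c
    exact treeMk_linear k id r v w c
  exact this

/-- The map induced by `glue` on the free Lie algebra on the vector space `H`. -/
def glueLie : L k H →ₗ[k] FreeMagma H → T k H :=
  Submodule.liftQ (linIdeal k H).toSubmodule (glueFree k H) (linIdeal_le_ker k H)

end Gluing

theorem lieOf_eq_mk (a : FreeMagma H) :
    lieOf k a = LieSubmodule.Quotient.mk (N := linIdeal k H)
      (Quot.mk (FreeLieAlgebra.Rel k H) (MonoidAlgebra.single a 1) : FreeLieAlgebra k H) := by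
  induction a with
  | ih1 v => rfl
  | ih2 a b ha hb =>
    have h : (MonoidAlgebra.single (a * b) (1 : k)) =
        MonoidAlgebra.single a 1 * MonoidAlgebra.single b 1 := by
      rw [MonoidAlgebra.single_mul_single, mul_one]
    rw [lieOf_mul, ha, hb, h]
    rfl

theorem span_lieOf (x : L k H) : x ∈ Submodule.span k (Set.range (lieOf k (H := H))) := by
  obtain ⟨⟨z⟩, rfl⟩ := Submodule.mkQ_surjective _ x
  induction z using MonoidAlgebra.induction_linear with
  | zero => exact zero_mem _
  | add f g hf hg => exact add_mem hf hg
  | single a r =>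
    have h : MonoidAlgebra.single a r = r • MonoidAlgebra.single a (1 : k) := by simp
    rw [h]
    have := Submodule.smul_mem _ r
      (Submodule.subset_span (R := k) (Set.mem_range_self (f := lieOf k (H := H)) a))
    rw [lieOf_eq_mk] at this
    exact this

variable {H} in
@[elab_as_elim]
theorem lie_induction {P : L k H → Prop} (x : L k H) (h0 : ∀ a, P (lieOf k a))
    (hadd : ∀ x y, P x → P y → P (x + y)) (hsmul : ∀ (r : k) x, P x → P (r • x)) : P x := by
  refine Submodule.span_induction ?_ ?_ ?_ ?_ (span_lieOf k H x)
  · rintro _ ⟨a, rfl⟩; exact h0 a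
  -- The value at zero is obtained as `0` times a generator; `H` is nonempty because it contains
  -- `0`.
  · by_cases hH : Nonempty H
    · have := hsmul 0 _ (h0 (.of hH.some))
      rwa [zero_smul] at this
    · exact absurd ⟨0⟩ hH
  · exact fun x y _ _ => hadd x y
  · exact fun r x _ => hsmul r x

/-! ### Gluing a label to the root, and injectivity of `η` -/

section Eta

variable [CharZero k]

theorem glueLie_lieOf (a c : FreeMagma H) : glueLie k H (lieOf k a) c = treeMk k id (a, c) := by
  rw [lieOf_eq_mk]
  exact (glue_single k H a c 1).trans (one_smul _ _)

/-- The map `H ⊗ L(H) → 𝒯(H)` that glues the label `v` to the root of a rooted tree. -/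
def labelRoot : H ⊗[k] L k H →ₗ[k] T k H :=
  TensorProduct.lift
    { toFun := fun v => LinearMap.proj (.of v) ∘ₗ glueLie k H
      map_add' := fun v w => by
        ext x
        induction x using lie_induction with
        | h0 a =>
          have := treeMk_linear k (id : H → H) 1 v w a
          simp only [one_smul] at this
          simpa [glueLie_lieOf, treeMk_flip k id a] using this
        | hadd x y hx hy =>
          simp only [map_add, hx, hy]
        | hsmul r x hx => simp only [map_smul, hx]
      map_smul' := fun r v => by
        have h0 : ∀ a : FreeMagma H, treeMk k (id : H → H) (.of (0 : H), a) = 0 := fun a => by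
          have := treeMk_linear k (id : H → H) (1 : k) 0 0 a
          simpa using this
        ext x
        induction x using lie_induction with
        | h0 a =>
          have := treeMk_linear k (id : H → H) r v 0 a
          simp only [add_zero, id, h0] at this
          simpa [glueLie_lieOf, treeMk_flip k id a] using this
        | hadd x y hx hy =>
          simp only [map_add, hx, hy]
        | hsmul r x hx => simp only [map_smul, hx] }

variable {H} in
theorem labelRoot_tmul (v : H) (a : FreeMagma H) :
    labelRoot k H (v ⊗ₜ lieOf k a) = treeMk k id (.of v, a) := by
  rw [treeMk_flip, ← glueLie_lieOf]
  rfl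

/-- Each leaf contributes one copy of the tree, and a unitrivalent tree with `s` trivalent vertices
has `s + 2` leaves. -/
theorem labelRoot_etaLin (s : ℕ) (x : T k H) (hx : x ∈ TDeg k H s) :
    labelRoot k H (etaLin k H x) = ((s : k) + 2) • x := by
  refine (Submodule.span_le
    (p := LinearMap.eqLocus (labelRoot k H ∘ₗ etaLin k H) (((s : k) + 2) • LinearMap.id))).2 ?_ hx
  rintro _ ⟨t, rfl, rfl⟩
  change labelRoot k H (etaLin k H (treeMk k id t)) = ((trivalent t : k) + 2) • treeMk k id t
  rw [etaLin, treeLift_mk, etaTree, map_list_sum, List.map_map]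
  have : (rootings t).map (labelRoot k H ∘ fun p => p.1 ⊗ₜ[k] lieOf k p.2) =
      (rootings t).map fun _ => treeMk k id t :=
    List.map_congr_left fun p hp => by
      rw [Function.comp, labelRoot_tmul, ← treeMk_rootings k id t p hp]
  rw [this, List.map_const', List.sum_replicate, ← Nat.cast_smul_eq_nsmul k]
  congr 1
  simp only [rootings, List.length_append, rootingsR_length, leavesR_length, trivalent]
  push_cast
  ring

theorem natCast_add_two_ne_zero (s : ℕ) : (s : k) + 2 ≠ 0 := by
  have : ((s + 2 : ℕ) : k) ≠ 0 := Nat.cast_ne_zero.2 (by omega)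
  simpa using this

theorem eta_injective (s : ℕ) : Function.Injective (eta k H s) := by
  rintro ⟨x, hx⟩ ⟨y, hy⟩ h
  have h' : etaLin k H x = etaLin k H y := congrArg Subtype.val h
  have := congrArg (labelRoot k H) h'
  rw [labelRoot_etaLin k H s x hx, labelRoot_etaLin k H s y hy] at this
  exact Subtype.ext (smul_right_injective _ (natCast_add_two_ne_zero k s) this)

/-! ### Surjectivity of `η` -/

attribute [local instance] LieRing.ofAssociativeRing LieAlgebra.ofAssociativeAlgebra

theorem lieToTensor_ι (v : H) : lieToTensor k H (L.ι k H v) = TensorAlgebra.ι k v :=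
  FreeLieAlgebra.lift_of_apply _ _

theorem lieToTensor_lie (x y : L k H) :
    lieToTensor k H ⁅x, y⁆ = lieToTensor k H x * lieToTensor k H y -
      lieToTensor k H y * lieToTensor k H x := by
  obtain ⟨x, rfl⟩ := Submodule.mkQ_surjective _ x
  obtain ⟨y, rfl⟩ := Submodule.mkQ_surjective _ y
  exact LieHom.map_lie (FreeLieAlgebra.lift k (TensorAlgebra.ι k : H → TensorAlgebra k H)) x y

/-- An action of the tensor algebra that combines the adjoint action on the free Lie algebra with
left-normed bracketing and with splitting off the first letter. -/
def splitAct : TensorAlgebra k H →ₐ[k] Module.End k ((H ⊗[k] L k H) × L k H × k) :=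
  TensorAlgebra.lift k
    { toFun := fun v =>
        LinearMap.prod (TensorProduct.mk k H (L k H) v ∘ₗ LinearMap.fst k _ _ ∘ₗ LinearMap.snd k _ _)
          (LinearMap.prod
            ((LieModule.toEnd k (L k H) (L k H) (L.ι k H v)) ∘ₗ LinearMap.fst k _ _ ∘ₗ
                LinearMap.snd k _ _ +
              (LinearMap.snd k _ _ ∘ₗ LinearMap.snd k _ _).smulRight (L.ι k H v)) 0)
      map_add' := fun v w => by
        refine LinearMap.ext fun ⟨m, x, c⟩ => ?_
        simp
        abel
      map_smul' := fun r v => by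
        refine LinearMap.ext fun ⟨m, x, c⟩ => ?_
        simp [TensorProduct.smul_tmul', smul_comm c r] }

variable {H} in
theorem splitAct_ι (v : H) (m : H ⊗[k] L k H) (x : L k H) (c : k) :
    splitAct k H (TensorAlgebra.ι k v) (m, x, c) = (v ⊗ₜ x, ⁅L.ι k H v, x⁆ + c • L.ι k H v, 0) := by
  simp [splitAct]

/-- Auxiliary: splitting the first letter off a Lie element and left-normed bracketing of the rest. -/
def splitLie : L k H →ₗ[k] H ⊗[k] L k H :=
  LinearMap.fst k _ _ ∘ₗ LinearMap.applyₗ (0, 0, 1) ∘ₗ (splitAct k H).toLinearMap ∘ₗ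
    lieToTensor k H

variable {H} in
-- The second component is the Dynkin–Specht–Wever identity: besides the adjoint action, starting
-- from the scalar `c` produces the degree of the Lie element as a factor. The first component
-- records what happens when the outermost letter is split off instead of being bracketed; on the
-- part starting from `x` this is exactly the sum over leaves that defines `η`.
theorem splitAct_lieOf (a : FreeMagma H) : ∀ (m : H ⊗[k] L k H) (x : L k H) (c : k),
    splitAct k H (lieToTensor k H (lieOf k a)) (m, x, c) =
      (etaAux k a x + c • splitLie k H (lieOf k a),
        ⁅lieOf k a, x⁆ + (c * (leavesR a).length) • lieOf k a, 0) := by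
  induction a with
  | ih1 v =>
    intro m x c
    simp [splitLie, lieToTensor_ι, splitAct_ι]
  | ih2 a b ha hb =>
    -- The coefficient of `c` is first computed explicitly; evaluating at `(0, 0, 1)` then
    -- identifies it with `splitLie` of the bracket.
    have key : ∀ (m : H ⊗[k] L k H) (x : L k H) (c : k),
        splitAct k H (lieToTensor k H (lieOf k (a * b))) (m, x, c) =
        (etaAux k (a * b) x + c • (((leavesR b).length : k) • etaAux k a (lieOf k b) -
            ((leavesR a).length : k) • etaAux k b (lieOf k a)),
          ⁅lieOf k (a * b), x⁆ + (c * (leavesR (a * b)).length) • lieOf k (a * b), 0) := by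
      intro m x c
      rw [lieOf_mul, lieToTensor_lie, map_sub, map_mul, map_mul, LinearMap.sub_apply,
        Module.End.mul_apply, Module.End.mul_apply, ha, hb, ha, hb]
      simp only [zero_smul, add_zero, zero_mul, Prod.mk_sub_mk, etaAux_add, etaAux_smul, lie_add,
        lie_smul, etaAux_mul, leavesR_mul, List.length_append, sub_self]
      refine Prod.ext ?_ (Prod.ext ?_ rfl)
      · have h := eq_neg_of_add_eq_zero_left (etaAux_skew k b x (lieOf k a))
        simp only [h]
        module
      · simp only [lie_lie]
        rw [← lie_skew (lieOf k a) (lieOf k b)]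
        push_cast
        module
    intro m x c
    have h1 : splitLie k H (lieOf k (a * b)) =
        (splitAct k H (lieToTensor k H (lieOf k (a * b))) (0, 0, 1)).1 := rfl
    rw [key, h1, key, etaAux_zero, zero_add, one_smul]

theorem splitLie_lie (v : H) (a : FreeMagma H) :
    splitLie k H ⁅L.ι k H v, lieOf k a⁆ =
      ((leavesR a).length : k) • v ⊗ₜ lieOf k a - etaAux k a (L.ι k H v) := by
  have h1 : splitLie k H ⁅L.ι k H v, lieOf k a⁆ =
    (splitAct k H (lieToTensor k H ⁅L.ι k H v, lieOf k a⁆) (0, 0, 1)).1 := rfl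
  rw [h1, lieToTensor_lie, map_sub, map_mul, map_mul, LinearMap.sub_apply, Module.End.mul_apply,
    Module.End.mul_apply, splitAct_lieOf, lieToTensor_ι, splitAct_ι, splitAct_ι, splitAct_lieOf]
  simp [TensorProduct.tmul_smul]

/-- For `y = v ⊗ a`, the tree with root `v` and branch `a` works: its image is `v ⊗ a` plus the
contribution of the leaves of `a`, and by `splitLie_lie` the latter is `(s + 1) v ⊗ a` minus
`splitLie ⁅v, a⁆`. When the bracket of `y` vanishes, this exhibits `(s + 2) y` as a value of `η`. -/
theorem exists_etaLin_eq (s : ℕ) (y : H ⊗[k] LDeg k H (s + 1)) :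
    ∃ x ∈ TDeg k H s, etaLin k H x = ((s : k) + 2) • (LDeg k H (s + 1)).subtype.lTensor H y -
      splitLie k H (bracketing k H ((LDeg k H (s + 1)).subtype.lTensor H y)) := by
  induction y using TensorProduct.induction_on with
  | zero => exact ⟨0, zero_mem _, by simp⟩
  | add y z hy hz =>
    obtain ⟨x, hx, hx'⟩ := hy
    obtain ⟨x', hx1, hx1'⟩ := hz
    refine ⟨x + x', add_mem hx hx1, ?_⟩
    rw [map_add, hx', hx1']
    simp only [map_add, smul_add]
    abel
  | tmul v y =>
    obtain ⟨y, hy⟩ := y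
    simp only [LinearMap.lTensor_tmul, Submodule.subtype_apply]
    induction hy using Submodule.span_induction with
    | mem y hy =>
      obtain ⟨a, ha, rfl⟩ := hy
      refine ⟨treeMk k id (.of v, a), Submodule.subset_span ⟨_, ?_, rfl⟩, ?_⟩
      · rw [leavesR_length] at ha
        simp only [trivalent, nodesR_of]
        omega
      · rw [bracketing_tmul, splitLie_lie, ha, etaLin, treeLift_mk, etaTree_eq]
        push_cast
        simp only [etaAux_of, lieOf_of]
        module
    | zero => exact ⟨0, zero_mem _, by simp⟩
    | add y z _ _ hy hz =>
      obtain ⟨x, hx, hx'⟩ := hy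
      obtain ⟨x', hx1, hx1'⟩ := hz
      refine ⟨x + x', add_mem hx hx1, ?_⟩
      rw [map_add, hx', hx1']
      simp only [TensorProduct.tmul_add, map_add, smul_add]
      abel
    | smul r y _ hy =>
      obtain ⟨x, hx, hx'⟩ := hy
      refine ⟨r • x, Submodule.smul_mem _ _ hx, ?_⟩
      rw [map_smul, hx']
      simp only [TensorProduct.tmul_smul, map_smul, smul_sub, smul_comm r]

theorem eta_surjective (s : ℕ) : Function.Surjective (eta k H s) := by
  rintro ⟨_, ⟨y, rfl⟩, hy⟩
  obtain ⟨x, hx, hx'⟩ := exists_etaLin_eq k H s y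
  rw [LinearMap.mem_ker.1 hy, map_zero, sub_zero] at hx'
  refine ⟨((s : k) + 2)⁻¹ • ⟨x, hx⟩, Subtype.ext ?_⟩
  change etaLin k H (((s : k) + 2)⁻¹ • x) = _
  rw [map_smul, hx', smul_smul, inv_mul_cancel₀ (natCast_add_two_ne_zero k s), one_smul]

end Eta

/-! ### Traces of trees with values in an associative algebra -/

section AlgTrace

variable {k : Type u} [Field k] {X : Type v} {A : Type*} [Ring A] [Algebra k A] (p : X → A)

/-- The iterated commutator represented by a rooted tree. -/
def comm : FreeMagma X → A
  | .of x => p x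
  | .mul a b => comm a * comm b - comm b * comm a

/-- The first letter of `comm p a`, evaluated by `φ` and removed. -/
def firstLetter (φ : X → k) : FreeMagma X → A
  | .of x => algebraMap k A (φ x)
  | .mul a b => firstLetter φ a * comm p b - firstLetter φ b * comm p a

@[simp] theorem comm_of (x : X) : comm p (.of x) = p x := rfl
@[simp] theorem comm_mul (a b : FreeMagma X) :
    comm p (a * b) = comm p a * comm p b - comm p b * comm p a := rfl
@[simp] theorem firstLetter_of (φ : X → k) (x : X) :
    firstLetter p φ (.of x) = algebraMap k A (φ x) := rfl
@[simp] theorem firstLetter_mul (φ : X → k) (a b : FreeMagma X) : firstLetter p φ (a * b) =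
    firstLetter p φ a * comm p b - firstLetter p φ b * comm p a := rfl

theorem firstLetter_congr {φ ψ : X → k} (a : FreeMagma X) (h : ∀ x ∈ leavesR a, φ x = ψ x) :
    firstLetter p φ a = firstLetter p ψ a := by
  induction a with
  | ih1 x => simp [h x (by simp)]
  | ih2 a b ha hb =>
    simp only [leavesR_mul, List.mem_append] at h
    rw [firstLetter_mul, firstLetter_mul, ha fun x hx => h x (Or.inl hx),
      hb fun x hx => h x (Or.inr hx)]

theorem firstLetter_zero (a : FreeMagma X) : firstLetter p (fun _ => (0 : k)) a = 0 := by
  induction a with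
  | ih1 x => simp
  | ih2 a b ha hb => simp [ha, hb]

theorem firstLetter_eq_zero {φ : X → k} (a : FreeMagma X) (h : ∀ x ∈ leavesR a, φ x = 0) :
    firstLetter p φ a = 0 :=
  (firstLetter_congr p a h).trans (firstLetter_zero p a)

theorem firstLetter_neg (φ : X → k) (a : FreeMagma X) :
    firstLetter p (fun x => - φ x) a = - firstLetter p φ a := by
  induction a with
  | ih1 x => simp
  | ih2 a b ha hb => rw [firstLetter_mul, firstLetter_mul, ha, hb]; noncomm_ring

/-- Both halves are needed in one induction, since the recursion for `firstLetter` involves `comm`.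
-/
theorem firstLetter_map {Y : Type v} (f : Y → X) (φ : X → k) (a : FreeMagma Y) :
    firstLetter p φ (FreeMagma.map f a) = firstLetter (p ∘ f) (φ ∘ f) a ∧
      comm p (FreeMagma.map f a) = comm (p ∘ f) a := by
  induction a with
  | ih1 x => simp
  | ih2 a b ha hb => simp [ha, hb]

/-- The part of `algTrace` that comes from the leaves of `a` as roots. -/
def algTraceR (β : X → X → k) (a c : FreeMagma X) : A :=
  ((rootingsR a c).map fun q => firstLetter p (β q.1) q.2).sum

/-- The sum over all leaves `x` of the tree `t`, regarded as roots: the first letter of the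
commutator represented by `t_x` is contracted with `x`. -/
def algTrace (β : X → X → k) (t : UTree X) : A :=
  ((rootings t).map fun q => firstLetter p (β q.1) q.2).sum

theorem algTrace_eq (β : X → X → k) (a b : FreeMagma X) :
    algTrace p β (a, b) = algTraceR p β a b + algTraceR p β b a := by
  simp [algTrace, algTraceR, rootings]

@[simp] theorem algTraceR_of (β : X → X → k) (x : X) (c : FreeMagma X) :
    algTraceR p β (.of x) c = firstLetter p (β x) c := by
  simp [algTraceR]

@[simp] theorem algTraceR_mul (β : X → X → k) (a b c : FreeMagma X) :
    algTraceR p β (a * b) c = algTraceR p β a (b * c) + algTraceR p β b (c * a) := by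
  simp [algTraceR]

theorem algTraceR_eq_zero {β : X → X → k} {a : FreeMagma X} (h : ∀ x ∈ leavesR a, β x = fun _ => 0)
    (c : FreeMagma X) : algTraceR p β a c = 0 := by
  induction a generalizing c with
  | ih1 x => rw [algTraceR_of, h x (by simp), firstLetter_zero]
  | ih2 a b ha hb =>
    simp only [leavesR_mul, List.mem_append] at h
    rw [algTraceR_mul, ha fun x hx => h x (Or.inl hx), hb fun x hx => h x (Or.inr hx), add_zero]

theorem rootings_map {X Y : Type v} (f : X → Y) (t : UTree X) :
    rootings (relabel f t) = (rootings t).map fun q => (f q.1, FreeMagma.map f q.2) := by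
  have key : ∀ a c : FreeMagma X, rootingsR (FreeMagma.map f a) (FreeMagma.map f c) =
      (rootingsR a c).map fun q => (f q.1, FreeMagma.map f q.2) := by
    intro a
    induction a with
    | ih1 x => intro c; simp
    | ih2 a b ha hb =>
      intro c
      simp only [map_mul, rootingsR_mul, List.map_append] at ha hb ⊢
      rw [← ha, ← hb, map_mul, map_mul]
  simp [rootings, relabel, key]

theorem algTrace_relabel {Y : Type v} (f : Y → X) (β : X → X → k) (t : UTree Y) :
    algTrace p β (relabel f t) = algTrace (p ∘ f) (fun x y => β (f x) (f y)) t := by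
  rw [algTrace, rootings_map, List.map_map, algTrace]
  congr 1
  exact List.map_congr_left fun q _ => (firstLetter_map p f _ q.2).1

theorem mem_leaves_of_mem_rootings {t : UTree X} {q : X × FreeMagma X} (hq : q ∈ rootings t) :
    q.1 ∈ leaves t ∧ ∀ x ∈ leavesR q.2, x ∈ leaves t :=
  ⟨(rootings_perm t q hq).subset (by simp), fun x hx =>
    (rootings_perm t q hq).subset (List.mem_cons_of_mem _ hx)⟩

theorem algTrace_congr {β γ : X → X → k} (t : UTree X)
    (h : ∀ x ∈ leaves t, ∀ y ∈ leaves t, β x y = γ x y) : algTrace p β t = algTrace p γ t := by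
  refine congrArg List.sum (List.map_congr_left fun q hq => ?_)
  have := mem_leaves_of_mem_rootings hq
  exact firstLetter_congr p _ fun y hy => h _ this.1 y (this.2 y hy)

theorem algTrace_neg (β : X → X → k) (t : UTree X) :
    algTrace p (fun x y => - β x y) t = - algTrace p β t := by
  simp only [algTrace, firstLetter_neg]
  induction rootings t with
  | nil => simp
  | cons q l ih => rw [List.map_cons, List.sum_cons, ih, List.map_cons, List.sum_cons, neg_add]

/-! #### Compatibility with the relations between trees -/

variable (β : X → X → k)

/-- The part of the trace that comes from the leaves of `a`, as a function of the value and the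
first letters of the other tree. -/
def traceAux : FreeMagma X → A × (X → A) → A
  | .of x, e => e.2 x
  | .mul a b, e =>
    traceAux a (comm p b * e.1 - e.1 * comm p b,
      fun x => firstLetter p (β x) b * e.1 - e.2 x * comm p b) +
    traceAux b (e.1 * comm p a - comm p a * e.1,
      fun x => e.2 x * comm p a - firstLetter p (β x) a * e.1)

@[simp] theorem traceAux_of (x : X) (e : A × (X → A)) : traceAux p β (.of x) e = e.2 x := rfl
theorem traceAux_mul (a b : FreeMagma X) (e : A × (X → A)) : traceAux p β (a * b) e =
    traceAux p β a (comm p b * e.1 - e.1 * comm p b,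
      fun x => firstLetter p (β x) b * e.1 - e.2 x * comm p b) +
    traceAux p β b (e.1 * comm p a - comm p a * e.1,
      fun x => e.2 x * comm p a - firstLetter p (β x) a * e.1) := rfl

/-- The tree `c` enters only through its commutator and its family of first letters, and `traceAux`
is linear in these data. Relations between trees thus become identities in an associative algebra.
-/
theorem algTraceR_eq_traceAux (a c : FreeMagma X) :
    algTraceR p β a c = traceAux p β a (comm p c, fun x => firstLetter p (β x) c) := by
  induction a generalizing c with
  | ih1 x => simp
  | ih2 a b ha hb => rw [algTraceR_mul, ha, hb]; rfl

theorem traceAux_add (a : FreeMagma X) (e f : A × (X → A)) :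
    traceAux p β a (e + f) = traceAux p β a e + traceAux p β a f := by
  induction a generalizing e f with
  | ih1 x => rfl
  | ih2 a b ha hb =>
    rw [traceAux_mul, traceAux_mul, traceAux_mul, add_add_add_comm, ← ha, ← hb]
    congr 2 <;> refine Prod.ext ?_ (funext fun x => ?_) <;>
      simp only [Prod.fst_add, Prod.snd_add, Pi.add_apply] <;> noncomm_ring

theorem traceAux_smul (r : k) (a : FreeMagma X) (e : A × (X → A)) :
    traceAux p β a (r • e) = r • traceAux p β a e := by
  induction a generalizing e with
  | ih1 x => rfl
  | ih2 a b ha hb =>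
    rw [traceAux_mul, traceAux_mul, smul_add, ← ha, ← hb]
    congr 2 <;> refine Prod.ext ?_ (funext fun x => ?_) <;>
      simp [smul_sub]

theorem traceAux_zero (a : FreeMagma X) : traceAux p β a 0 = 0 := by
  simpa using traceAux_smul p β 0 a 0

theorem algTrace_flip (a b : FreeMagma X) :
    algTrace p β (a, b) = algTrace p β (b, a) := by
  rw [algTrace_eq, algTrace_eq, add_comm]

theorem algTrace_move (a b c : FreeMagma X) :
    algTrace p β (a * b, c) = algTrace p β (a, b * c) := by
  simp only [algTrace_eq, algTraceR_mul, add_assoc]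

theorem algTrace_antisymm (a b c : FreeMagma X) :
    algTrace p β (a, b * c) + algTrace p β (a, c * b) = 0 := by
  have key : ∀ a b c : FreeMagma X, algTraceR p β a (b * c) + algTraceR p β a (c * b) = 0 := by
    intro a b c
    rw [algTraceR_eq_traceAux, algTraceR_eq_traceAux, ← traceAux_add]
    refine Eq.trans ?_ (traceAux_zero p β a)
    congr 1
    refine Prod.ext ?_ (funext fun x => ?_) <;>
      simp only [Prod.fst_add, Prod.snd_add, Pi.add_apply, comm_mul, firstLetter_mul,
        Prod.fst_zero, Prod.snd_zero, Pi.zero_apply] <;> noncomm_ring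
  have := congrArg₂ (· + ·) (key a b c) (congrArg₂ (· + ·) (key b c a) (key c a b))
  simp only [add_zero] at this
  simp only [algTrace_eq, algTraceR_mul]
  rw [← this]
  abel

theorem algTrace_ihx (a b c d : FreeMagma X) :
    algTrace p β (a, b * c * d) + algTrace p β (a, c * d * b) + algTrace p β (a, d * b * c) = 0 := by
  -- This is the case of a root in one of the branches `b`, `c`, `d`: seen from there the three IHX
  -- terms are bracketings of the other three branches, and their sum vanishes by Jacobi.
  have key : ∀ a x y z : FreeMagma X, algTraceR p β a (x * (y * z)) + algTraceR p β a (z * (x * y))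
      + algTraceR p β a (x * z * y) = 0 := by
    intro a x y z
    rw [algTraceR_eq_traceAux, algTraceR_eq_traceAux, algTraceR_eq_traceAux, ← traceAux_add,
      ← traceAux_add]
    refine Eq.trans ?_ (traceAux_zero p β a)
    congr 1
    refine Prod.ext ?_ (funext fun x => ?_) <;>
      simp only [Prod.fst_add, Prod.snd_add, Pi.add_apply, comm_mul, firstLetter_mul,
        Prod.fst_zero, Prod.snd_zero, Pi.zero_apply] <;> noncomm_ring
  -- This is the case of a root in `a`, where Jacobi appears in cyclic form.
  have key' : ∀ a x y z : FreeMagma X, algTraceR p β a (x * y * z) + algTraceR p β a (y * z * x)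
      + algTraceR p β a (z * x * y) = 0 := by
    intro a x y z
    rw [algTraceR_eq_traceAux, algTraceR_eq_traceAux, algTraceR_eq_traceAux, ← traceAux_add,
      ← traceAux_add]
    refine Eq.trans ?_ (traceAux_zero p β a)
    congr 1
    refine Prod.ext ?_ (funext fun x => ?_) <;>
      simp only [Prod.fst_add, Prod.snd_add, Pi.add_apply, comm_mul, firstLetter_mul,
        Prod.fst_zero, Prod.snd_zero, Pi.zero_apply] <;> noncomm_ring
  have := congrArg₂ (· + ·) (congrArg₂ (· + ·) (key' a b c d) (key b c d a))
    (congrArg₂ (· + ·) (key c d b a) (key d b c a))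
  simp only [add_zero] at this
  simp only [algTrace_eq, algTraceR_mul]
  rw [← this]
  abel

/-- The trace as a linear map on the space of trees. -/
def algTraceLin {H : Type v} [AddCommGroup H] [Module k H] (lab : H → X)
    (hp : ∀ (r : k) v w, p (lab (r • v + w)) = r • p (lab v) + p (lab w))
    (hβ : ∀ v, β (lab v) = fun _ => 0) (hβ' : ∀ x v, β x (lab v) = 0) :
    TreeSpace k lab →ₗ[k] A :=
  treeLift k lab (algTrace p β) (algTrace_flip p β) (algTrace_move p β) (algTrace_antisymm p β)
    (algTrace_ihx p β) fun r v w a => by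
      have h : ∀ v, algTrace p β (.of (lab v), a) = traceAux p β a (p (lab v), 0) := fun v => by
        rw [algTrace_eq, algTraceR_of, hβ, firstLetter_zero, zero_add, algTraceR_eq_traceAux]
        simp only [comm_of, firstLetter_of, hβ', map_zero]
        rfl
      rw [h, h, h, hp, ← traceAux_smul, ← traceAux_add]
      simp

theorem algTraceLin_mk {H : Type v} [AddCommGroup H] [Module k H] (lab : H → X)
    (hp : ∀ (r : k) v w, p (lab (r • v + w)) = r • p (lab v) + p (lab w))
    (hβ : ∀ v, β (lab v) = fun _ => 0) (hβ' : ∀ x v, β x (lab v) = 0) (t : UTree X) :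
    algTraceLin p β lab hp hβ hβ' (treeMk k lab t) = algTrace p β t :=
  treeLift_mk k _ _ _ _ _ _ _ t

/-! #### Reversal -/

section Reverse

variable (S : A →ₗ[k] A)

/-- Auxiliary: `∑ β(h, h') u' m S(u)`, where the commutators represented by `a` and `b` are
expanded as `∑ h u` and `∑ h' u'`. -/
def pairing : FreeMagma X → A → FreeMagma X → A
  | .of x, m, b => firstLetter p (β x) b * m
  | .mul a₁ a₂, m, b => pairing a₂ (m * comm p a₁) b - pairing a₁ (m * comm p a₂) b

@[simp] theorem pairing_of (x : X) (m : A) (b : FreeMagma X) :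
    pairing p β (.of x) m b = firstLetter p (β x) b * m := rfl
@[simp] theorem pairing_mul (a₁ a₂ : FreeMagma X) (m : A) (b : FreeMagma X) :
    pairing p β (a₁ * a₂) m b =
      pairing p β a₂ (m * comm p a₁) b - pairing p β a₁ (m * comm p a₂) b := rfl

theorem pairing_neg (a : FreeMagma X) (m : A) (b : FreeMagma X) :
    pairing p β a (-m) b = - pairing p β a m b := by
  induction a generalizing m with
  | ih1 x => simp
  | ih2 a₁ a₂ h1 h2 => simp only [pairing_mul, neg_mul, h1, h2]; abel

/-- The definition of `pairing` recurses on its first tree only; this is the matching expansion in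
the second one. -/
theorem pairing_mul_right (a : FreeMagma X) (m : A) (b c : FreeMagma X) :
    pairing p β a m (b * c) = pairing p β a (comm p c * m) b - pairing p β a (comm p b * m) c := by
  induction a generalizing m with
  | ih1 x => simp only [pairing_of, firstLetter_mul]; noncomm_ring
  | ih2 a₁ a₂ h1 h2 => simp only [pairing_mul, h1, h2, mul_assoc]; abel

theorem reverse_comm (hS : ∀ x y, S (x * y) = S y * S x) (hSp : ∀ x, S (p x) = - p x)
    (a : FreeMagma X) : S (comm p a) = - comm p a := by
  induction a with
  | ih1 x => exact hSp x
  | ih2 a b ha hb => simp only [comm_mul, map_sub, hS, ha, hb]; noncomm_ring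

theorem reverse_firstLetter (hS1 : S 1 = 1) (hS : ∀ x y, S (x * y) = S y * S x)
    (hSp : ∀ x, S (p x) = - p x) (x : X) (b : FreeMagma X) (n : A) :
    n * S (firstLetter p (β x) b) = pairing p (fun x y => β y x) b n (.of x) := by
  induction b generalizing n with
  | ih1 y =>
    rw [firstLetter_of, pairing_of, firstLetter_of, Algebra.algebraMap_eq_smul_one, map_smul, hS1]
    simp
  | ih2 b₁ b₂ h1 h2 =>
    rw [pairing_mul, ← h1, ← h2, firstLetter_mul, map_sub, hS, hS, reverse_comm p S hS hSp,
      reverse_comm p S hS hSp]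
    noncomm_ring

/-- In the notation of `pairing`, reversing `u' m S(u)` gives `u S(m) S(u')`, which exchanges the
roles of the two trees. Working by induction on the first tree avoids assuming that `S` is an
involution. -/
theorem reverse_pairing (hS1 : S 1 = 1) (hS : ∀ x y, S (x * y) = S y * S x)
    (hSp : ∀ x, S (p x) = - p x) (a : FreeMagma X) (m : A) (b : FreeMagma X) :
    S (pairing p β a m b) = pairing p (fun x y => β y x) b (S m) a := by
  induction a generalizing m with
  | ih1 x => rw [pairing_of, hS, reverse_firstLetter p _ S hS1 hS hSp]
  | ih2 a₁ a₂ h1 h2 =>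
    rw [pairing_mul, map_sub, h1, h2, hS, hS, reverse_comm p S hS hSp, reverse_comm p S hS hSp,
      neg_mul, neg_mul, pairing_neg, pairing_neg, pairing_mul_right]
    abel

/-- Subtracting `pairing p β a 1 c` removes the contractions of a root in `a` with a leaf of `c`;
what remains are the contractions of two leaves of `a`. For a single leaf nothing remains, and for a
product one gets the internal terms of both branches plus two cross terms between them. -/
theorem reverse_algTraceR (hS1 : S 1 = 1) (hS : ∀ x y, S (x * y) = S y * S x)
    (hSp : ∀ x, S (p x) = - p x) (a c : FreeMagma X) :
    S (algTraceR p β a c - pairing p β a 1 c) =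
      algTraceR p (fun x y => β y x) a c - pairing p (fun x y => β y x) a 1 c := by
  induction a generalizing c with
  | ih1 x => simp
  | ih2 a b ha hb =>
    -- The cross terms have `comm p c` in the middle. Since `S` negates it, reversal exchanges the
    -- two cross terms, with the form transposed, and their opposite signs match.
    have key : ∀ γ : X → X → k, algTraceR p γ (a * b) c - pairing p γ (a * b) 1 c =
        (algTraceR p γ a (b * c) - pairing p γ a 1 (b * c)) +
        (algTraceR p γ b (c * a) - pairing p γ b 1 (c * a)) +
        (pairing p γ a (comm p c) b - pairing p γ b (comm p c) a) := by
      intro γ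
      rw [algTraceR_mul, pairing_mul, pairing_mul_right, pairing_mul_right]
      simp only [one_mul, mul_one]
      abel
    rw [key, key, map_add, map_add, ha, hb, map_sub, reverse_pairing p _ S hS1 hS hSp,
      reverse_pairing p _ S hS1 hS hSp, reverse_comm p S hS hSp, pairing_neg, pairing_neg]
    abel

/-- An antiautomorphism that changes the signs of the letters transposes the form in the trace. -/
theorem reverse_algTrace (hS1 : S 1 = 1) (hS : ∀ x y, S (x * y) = S y * S x)
    (hSp : ∀ x, S (p x) = - p x) (t : UTree X) :
    S (algTrace p β t) = algTrace p (fun x y => β y x) t := by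
  obtain ⟨a, b⟩ := t
  -- Contractions are sorted into those within `a`, those within `b`, and those across the cut;
  -- reversal exchanges the two `pairing` terms of the last kind.
  have key : ∀ γ : X → X → k, algTrace p γ (a, b) =
      (algTraceR p γ a b - pairing p γ a 1 b) + (algTraceR p γ b a - pairing p γ b 1 a) +
      (pairing p γ a 1 b + pairing p γ b 1 a) := by
    intro γ
    rw [algTrace_eq]
    abel
  rw [key, key, map_add, map_add, reverse_algTraceR p _ S hS1 hS hSp, reverse_algTraceR p _ S hS1 hS hSp,
    map_add, reverse_pairing p _ S hS1 hS hSp, reverse_pairing p _ S hS1 hS hSp, hS1]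
  abel

end Reverse

end AlgTrace

/-! ### Words in the tensor algebra and their (co)invariants -/

section Words

variable (k : Type u) [Field k] {H : Type v} [AddCommGroup H] [Module k H]

/-- The product of vectors in the tensor algebra. -/
def word (l : List H) : TensorAlgebra k H := (l.map (TensorAlgebra.ι k)).prod

@[simp] theorem word_nil : word k ([] : List H) = 1 := rfl
@[simp] theorem word_cons (v : H) (l : List H) :
    word k (v :: l) = TensorAlgebra.ι k v * word k l := by simp [word]
theorem word_append (l l' : List H) : word k (l ++ l') = word k l * word k l' := by simp [word]

theorem span_word : Submodule.span k (Set.range (word k (H := H))) = ⊤ := by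
  rw [eq_top_iff]
  rintro x -
  induction x using TensorAlgebra.induction with
  | algebraMap r =>
    rw [Algebra.algebraMap_eq_smul_one, ← word_nil k (H := H)]
    exact Submodule.smul_mem _ _ (Submodule.subset_span ⟨_, rfl⟩)
  | ι v => exact Submodule.subset_span ⟨[v], by simp⟩
  | mul a b ha hb =>
    have := Submodule.mul_mem_mul ha hb
    rw [Submodule.span_mul_span] at this
    refine Submodule.span_mono ?_ this
    rintro _ ⟨_, ⟨l, rfl⟩, _, ⟨l', rfl⟩, rfl⟩
    exact ⟨l ++ l', word_append k l l'⟩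
  | add a b ha hb => exact add_mem ha hb

theorem tensorAlgebra_ext {M : Type*} [AddCommGroup M] [Module k M]
    {f g : TensorAlgebra k H →ₗ[k] M} (h : ∀ l, f (word k l) = g (word k l)) : f = g :=
  LinearMap.ext_on_range (span_word k) h

variable (H) in
/-- The projection of the tensor algebra onto a tensor power. -/
def tensorPart (s : ℕ) : TensorAlgebra k H →ₗ[k] ⨂[k]^s H :=
  DirectSum.component k ℕ (fun n => ⨂[k]^n H) s ∘ₗ
    (TensorAlgebra.toDirectSum (R := k) (M := H)).toLinearMap

theorem toDirectSum_word {n : ℕ} (x : Fin n → H) :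
    TensorAlgebra.toDirectSum (word k (List.ofFn x)) =
      DirectSum.of (fun n => ⨂[k]^n H) n (PiTensorProduct.tprod k x) := by
  rw [← TensorAlgebra.toDirectSum_tensorPower_tprod, TensorAlgebra.tprod_apply, word,
    List.map_ofFn]
  rfl

theorem tensorPart_ofFn {n : ℕ} (x : Fin n → H) :
    tensorPart k H n (word k (List.ofFn x)) = PiTensorProduct.tprod k x := by
  change (TensorAlgebra.toDirectSum (word k (List.ofFn x))) n = _
  rw [toDirectSum_word, DirectSum.of_eq_same]

theorem tensorPart_of_length_ne {s : ℕ} {l : List H} (h : l.length ≠ s) :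
    tensorPart k H s (word k l) = 0 := by
  change (TensorAlgebra.toDirectSum (word k l)) s = _
  rw [← List.ofFn_get l, toDirectSum_word, DirectSum.of_eq_of_ne _ _ _ (by simpa using h.symm)]

theorem exists_eq_ofFn {s : ℕ} {l : List H} (h : l.length = s) : ∃ x : Fin s → H, l = List.ofFn x := by
  subst h
  exact ⟨l.get, (List.ofFn_get l).symm⟩

/-! ### The antipode and the reversal map -/

variable (H) in
/-- The antipode of the tensor algebra. -/
def antipode : TensorAlgebra k H →ₗ[k] TensorAlgebra k H :=
  (MulOpposite.opLinearEquiv k).symm.toLinearMap ∘ₗ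
    (TensorAlgebra.lift k
      (-((MulOpposite.opLinearEquiv k).toLinearMap ∘ₗ TensorAlgebra.ι k (M := H)))).toLinearMap

theorem antipode_ι (v : H) : antipode k H (TensorAlgebra.ι k v) = - TensorAlgebra.ι k v := by
  simp [antipode]

theorem antipode_one : antipode k H 1 = 1 := by simp [antipode]

theorem antipode_mul (x y : TensorAlgebra k H) :
    antipode k H (x * y) = antipode k H y * antipode k H x := by simp [antipode]

theorem antipode_word (l : List H) :
    antipode k H (word k l) = (-1 : k) ^ l.length • word k l.reverse := by
  induction l with
  | nil => simp [antipode_one]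
  | cons v l ih =>
    rw [word_cons, antipode_mul, ih, antipode_ι, List.reverse_cons, word_append, word_cons,
      word_nil, mul_one, List.length_cons, pow_succ]
    simp

theorem ofFn_rev {n : ℕ} (x : Fin n → H) :
    (List.ofFn x).reverse = List.ofFn fun i => x (Fin.rev i) := by
  refine List.ext_getElem (by simp) fun i h1 h2 => ?_
  simp only [List.getElem_reverse, List.getElem_ofFn, List.length_ofFn]
  congr 1
  ext
  simp [Fin.val_rev]
  omega

/-- Both maps reverse words; the antipode carries the sign `(-1)^s` and the reversal `(-1)^(s+1)`.
-/
theorem rev_tensorPart (s : ℕ) (x : TensorAlgebra k H) :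
    rev k H s (tensorPart k H s x) = - tensorPart k H s (antipode k H x) := by
  suffices h : rev k H s ∘ₗ tensorPart k H s = - (tensorPart k H s ∘ₗ antipode k H) from
    LinearMap.congr_fun h x
  refine tensorAlgebra_ext k fun l => ?_
  simp only [LinearMap.comp_apply, LinearMap.neg_apply, antipode_word, map_smul]
  by_cases hl : l.length = s
  · obtain ⟨x, rfl⟩ := exists_eq_ofFn hl
    rw [ofFn_rev, tensorPart_ofFn, tensorPart_ofFn, rev, LinearMap.smul_apply,
      LinearEquiv.coe_coe, PiTensorProduct.reindex_tprod, List.length_ofFn, pow_succ]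
    simp
  · rw [tensorPart_of_length_ne k hl, tensorPart_of_length_ne k (by simpa using hl), map_zero,
      smul_zero, neg_zero]

/-! ### Trace properties of the coinvariants -/

variable (H) in
/-- The class of an element of the tensor algebra in the cyclic coinvariants. -/
def cyc (s : ℕ) : TensorAlgebra k H →ₗ[k] CycCoinv k H s := Submodule.mkQ _ ∘ₗ tensorPart k H s

variable (H) in
/-- The class of an element of the tensor algebra in the dihedral coinvariants. -/
def dih (s : ℕ) : TensorAlgebra k H →ₗ[k] DihCoinv k H s := Submodule.mkQ _ ∘ₗ tensorPart k H s

theorem cycToDih_cyc (s : ℕ) (x : TensorAlgebra k H) :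
    cycToDih k H s (cyc k H s x) = dih k H s x := rfl

theorem revCyc_cyc (s : ℕ) (x : TensorAlgebra k H) :
    revCyc k H s (cyc k H s x) = - cyc k H s (antipode k H x) := by
  change Submodule.mkQ _ (rev k H s (tensorPart k H s x)) = _
  rw [rev_tensorPart, map_neg]
  rfl

theorem dih_antipode (s : ℕ) (x : TensorAlgebra k H) :
    dih k H s (antipode k H x) = - dih k H s x := by
  rw [← neg_eq_iff_eq_neg, eq_comm, ← sub_eq_zero, ← neg_eq_zero, neg_sub]
  have : rev k H s (tensorPart k H s x) - tensorPart k H s x ∈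
      LinearMap.range ((rot k H s).toLinearMap - LinearMap.id) ⊔
        LinearMap.range (rev k H s - LinearMap.id) :=
    Submodule.mem_sup_right ⟨tensorPart k H s x, rfl⟩
  rw [← Submodule.Quotient.mk_eq_zero, rev_tensorPart] at this
  exact this

/-- Moving one letter from the end of a word to its beginning is the rotation. Words of the wrong
length have zero component in degree `s`, so they need no condition. -/
theorem cyc_mul_ι (s : ℕ) (x : TensorAlgebra k H) (v : H) :
    cyc k H s (x * TensorAlgebra.ι k v) = cyc k H s (TensorAlgebra.ι k v * x) := by
  suffices h : cyc k H s ∘ₗ LinearMap.mulRight k (TensorAlgebra.ι k v) =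
      cyc k H s ∘ₗ LinearMap.mulLeft k (TensorAlgebra.ι k v) from LinearMap.congr_fun h x
  refine tensorAlgebra_ext k fun l => ?_
  simp only [LinearMap.comp_apply, LinearMap.mulRight_apply, LinearMap.mulLeft_apply]
  have h1 : word k l * TensorAlgebra.ι k v = word k (l ++ [v]) := by simp [word_append]
  rw [h1, ← word_cons]
  by_cases hl : l.length + 1 = s
  · subst hl
    have h2 : l ++ [v] = List.ofFn (Fin.snoc (α := fun _ => H) l.get v) := by
      rw [List.ofFn_succ']
      simp
    have h3 : v :: l = List.ofFn (Fin.cons (α := fun _ => H) v l.get) := by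
      rw [List.ofFn_succ]
      simp
    rw [h2, h3, cyc, LinearMap.comp_apply, LinearMap.comp_apply, tensorPart_ofFn, tensorPart_ofFn,
      ← sub_eq_zero, ← neg_eq_zero, neg_sub, ← map_sub]
    refine (Submodule.Quotient.mk_eq_zero _).2 ⟨PiTensorProduct.tprod k (Fin.snoc l.get v), ?_⟩
    rw [LinearMap.sub_apply, LinearMap.id_apply, LinearEquiv.coe_coe, rot,
      PiTensorProduct.reindex_tprod, Fin.snoc_eq_cons_rotate]
    simp
  · simp only [cyc, LinearMap.comp_apply]
    rw [tensorPart_of_length_ne k (by simpa using hl), tensorPart_of_length_ne k (by simpa using hl)]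

theorem cyc_mul_comm (s : ℕ) (x y : TensorAlgebra k H) :
    cyc k H s (x * y) = cyc k H s (y * x) := by
  induction y using TensorAlgebra.induction generalizing x with
  | algebraMap r => rw [Algebra.commutes]
  | ι v => exact cyc_mul_ι k s x v
  | mul a b ha hb => rw [← mul_assoc, hb, ← mul_assoc, ha, mul_assoc]
  | add a b ha hb => rw [mul_add, add_mul, map_add, map_add, ha, hb]

theorem dih_mul_comm (s : ℕ) (x y : TensorAlgebra k H) :
    dih k H s (x * y) = dih k H s (y * x) :=
  congrArg (cycToDih k H s) (cyc_mul_comm k s x y)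

/-! ### Invariants and coinvariants of the reversal -/

theorem revCyc_revCyc (s : ℕ) (x : CycCoinv k H s) : revCyc k H s (revCyc k H s x) = x := by
  obtain ⟨x, rfl⟩ := Submodule.mkQ_surjective _ x
  change Submodule.mkQ _ (rev k H s (rev k H s x)) = _
  congr 1
  suffices h : rev k H s ∘ₗ rev k H s = LinearMap.id from LinearMap.congr_fun h x
  ext v
  simp only [rev, LinearMap.compMultilinearMap_apply, LinearMap.comp_apply,
    LinearMap.smul_apply, map_smul, LinearEquiv.coe_coe, PiTensorProduct.reindex_tprod, smul_smul,
    ← mul_pow, Fin.revPerm_symm]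
  simp only [mul_neg, mul_one, neg_neg, one_pow, one_smul, LinearMap.id_apply]
  exact congrArg _ (funext fun i => congrArg v (Fin.rev_rev i))

theorem cycToDih_revCyc (s : ℕ) (x : CycCoinv k H s) :
    cycToDih k H s (revCyc k H s x) = cycToDih k H s x := by
  obtain ⟨x, rfl⟩ := Submodule.mkQ_surjective _ x
  rw [← sub_eq_zero, ← map_sub]
  exact (Submodule.Quotient.mk_eq_zero _).2 (Submodule.mem_sup_right ⟨x, rfl⟩)

theorem exists_of_cycToDih_eq_zero (s : ℕ) (x : CycCoinv k H s) (hx : cycToDih k H s x = 0) :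
    ∃ y, x = revCyc k H s y - y := by
  obtain ⟨x, rfl⟩ := Submodule.mkQ_surjective _ x
  obtain ⟨y, hy, z, ⟨w, rfl⟩, rfl⟩ := Submodule.mem_sup.1 ((Submodule.Quotient.mk_eq_zero _).1 hx)
  refine ⟨Submodule.mkQ _ w, ?_⟩
  rw [map_add, Submodule.mkQ_apply, (Submodule.Quotient.mk_eq_zero _).2 hy, zero_add]
  rfl

/-- An element of the kernel has the form `b y - y`; the involution negates it, so it is zero if it
is also invariant, as `2` is invertible. A preimage of any class is made invariant by averaging over
`b`. -/
theorem cycToDih_bijective [CharZero k] (s : ℕ) :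
    Function.Bijective ((cycToDih k H s).domRestrict
      (LinearMap.ker (revCyc k H s - LinearMap.id))) := by
  constructor
  · rw [← LinearMap.ker_eq_bot, LinearMap.ker_eq_bot']
    rintro ⟨x, hx⟩ h
    obtain ⟨y, rfl⟩ := exists_of_cycToDih_eq_zero k s x h
    rw [LinearMap.mem_ker, LinearMap.sub_apply, LinearMap.id_apply, map_sub, revCyc_revCyc,
      sub_sub_sub_comm, ← neg_sub _ y, ← neg_add', neg_eq_zero, ← two_smul k, smul_eq_zero] at hx
    exact Subtype.ext (hx.resolve_left two_ne_zero)
  · intro y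
    obtain ⟨x, rfl⟩ : ∃ x, cycToDih k H s x = y := by
      obtain ⟨x, rfl⟩ := Submodule.mkQ_surjective _ y
      exact ⟨Submodule.mkQ _ x, rfl⟩
    refine ⟨⟨(2⁻¹ : k) • (x + revCyc k H s x), ?_⟩, ?_⟩
    · rw [LinearMap.mem_ker, LinearMap.sub_apply, LinearMap.id_apply, map_smul, map_add,
        revCyc_revCyc, add_comm, sub_self]
    · rw [LinearMap.domRestrict_apply, map_smul, map_add, cycToDih_revCyc, ← two_smul k, smul_smul,
        inv_mul_cancel₀ two_ne_zero, one_smul]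

/-! ### The Enomoto–Satoh trace of a tree -/

variable (H) in
/-- Multiplication `H ⊗ T(H) → T(H)`. -/
def letterMul : H ⊗[k] TensorAlgebra k H →ₗ[k] TensorAlgebra k H :=
  TensorProduct.lift (LinearMap.mul k (TensorAlgebra k H) ∘ₗ TensorAlgebra.ι k)

theorem letterMul_tmul (v : H) (x : TensorAlgebra k H) :
    letterMul k H (v ⊗ₜ x) = TensorAlgebra.ι k v * x := by simp [letterMul]

/-- Evaluation of the first letter. -/
def letterEval (φ : H →ₗ[k] k) : H ⊗[k] TensorAlgebra k H →ₗ[k] TensorAlgebra k H :=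
  TensorProduct.lift (φ.smulRight LinearMap.id)

theorem letterEval_tmul (φ : H →ₗ[k] k) (v : H) (x : TensorAlgebra k H) :
    letterEval k φ (v ⊗ₜ x) = φ v • x := by simp [letterEval]

/-- `firstLetter` is defined by recursion on a bracketing, whereas `contract` acts on tensors. A
single element `z`, independent of `φ`, that splits the first letter off the commutator links the
two descriptions. -/
theorem exists_firstLetter (a : FreeMagma H) : ∃ z : H ⊗[k] TensorAlgebra k H,
    letterMul k H z = comm (TensorAlgebra.ι k) a ∧
    ∀ φ : H →ₗ[k] k, letterEval k φ z = firstLetter (TensorAlgebra.ι k) φ a := by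
  have key : ∀ (z : H ⊗[k] TensorAlgebra k H) (y : TensorAlgebra k H),
      letterMul k H ((LinearMap.mulRight k y).lTensor H z) = letterMul k H z * y ∧
      ∀ φ : H →ₗ[k] k, letterEval k φ ((LinearMap.mulRight k y).lTensor H z) =
        letterEval k φ z * y := by
    intro z y
    induction z using TensorProduct.induction_on with
    | zero => simp
    | tmul v x => simp [letterMul_tmul, letterEval_tmul, mul_assoc]
    | add z w hz hw =>
      simp only [map_add, hz.1, hw.1, add_mul, true_and]
      intro φ
      rw [hz.2, hw.2]
  induction a with
  | ih1 v =>
    refine ⟨v ⊗ₜ 1, by simp [letterMul_tmul], fun φ => ?_⟩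
    rw [letterEval_tmul, firstLetter_of, Algebra.algebraMap_eq_smul_one]
  | ih2 a b ha hb =>
    obtain ⟨z, hz, hz'⟩ := ha
    obtain ⟨w, hw, hw'⟩ := hb
    refine ⟨(LinearMap.mulRight k (comm (TensorAlgebra.ι k) b)).lTensor H z -
      (LinearMap.mulRight k (comm (TensorAlgebra.ι k) a)).lTensor H w, ?_, fun φ => ?_⟩
    · rw [map_sub, (key _ _).1, (key _ _).1, hz, hw, comm_mul]
    · rw [map_sub, (key _ _).2, (key _ _).2, hz', hw', firstLetter_mul]

theorem contract_letterMul (ω : LinearMap.BilinForm k H) (s : ℕ) (v : H)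
    (z : H ⊗[k] TensorAlgebra k H) :
    contract ω s (v ⊗ₜ tensorPart k H (s + 1) (letterMul k H z)) =
      tensorPart k H s (letterEval k (ω v) z) := by
  induction z using TensorProduct.induction_on with
  | zero => simp
  | add z w hz hw => simp only [map_add, TensorProduct.tmul_add, hz, hw]
  | tmul w x =>
    rw [letterMul_tmul, letterEval_tmul, map_smul]
    suffices h : contract ω s ∘ₗ TensorProduct.mk k H _ v ∘ₗ tensorPart k H (s + 1) ∘ₗ
        LinearMap.mulLeft k (TensorAlgebra.ι k w) = ω v w • tensorPart k H s from
      LinearMap.congr_fun h x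
    refine tensorAlgebra_ext k fun l => ?_
    simp only [LinearMap.comp_apply, LinearMap.mulLeft_apply, ← word_cons, TensorProduct.mk_apply,
      LinearMap.smul_apply]
    by_cases hl : l.length = s
    · obtain ⟨x, rfl⟩ := exists_eq_ofFn hl
      have h : w :: List.ofFn x = List.ofFn (Fin.cons (α := fun _ => H) w x) := by
        rw [List.ofFn_succ]
        simp
      rw [h, tensorPart_ofFn, tensorPart_ofFn]
      simp [contract, LinearMap.uncurryLeft_apply]
    · rw [tensorPart_of_length_ne k hl, tensorPart_of_length_ne k (by simpa using hl),
        TensorProduct.tmul_zero, map_zero, smul_zero]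

theorem lieToTensor_lieOf [CharZero k] (a : FreeMagma H) :
    lieToTensor k H (lieOf k a) = comm (TensorAlgebra.ι k) a := by
  induction a with
  | ih1 v => exact lieToTensor_ι k H v
  | ih2 a b ha hb => rw [lieOf_mul, lieToTensor_lie, ha, hb, comm_mul]

theorem contract_lieOf [CharZero k] (ω : LinearMap.BilinForm k H) (s : ℕ) (v : H)
    (a : FreeMagma H) : contract ω s (v ⊗ₜ lieToPower k H (s + 1) (lieOf k a)) =
      tensorPart k H s (firstLetter (TensorAlgebra.ι k) (ω v) a) := by
  obtain ⟨z, hz, hz'⟩ := exists_firstLetter k a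
  have h : lieToPower k H (s + 1) (lieOf k a) =
      tensorPart k H (s + 1) (lieToTensor k H (lieOf k a)) := rfl
  rw [h, lieToTensor_lieOf, ← hz, contract_letterMul, hz']

/-- The trace of `𝒯(H)` that corresponds to the Enomoto–Satoh trace. -/
def trTree (ω : LinearMap.BilinForm k H) (s : ℕ) : T k H →ₗ[k] CycCoinv k H s :=
  Submodule.mkQ _ ∘ₗ contract ω s ∘ₗ (lieToPower k H (s + 1)).lTensor H ∘ₗ etaLin k H

theorem trTree_mk [CharZero k] (ω : LinearMap.BilinForm k H) (s : ℕ) (t : UTree H) :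
    trTree k ω s (treeMk k id t) =
      cyc k H s (algTrace (TensorAlgebra.ι k) (fun x y => ω x y) t) := by
  simp only [trTree, LinearMap.comp_apply, etaLin, treeLift_mk, etaTree, algTrace, map_list_sum,
    List.map_map, cyc]
  congr 2
  funext q
  simp only [Function.comp_apply, LinearMap.lTensor_tmul, contract_lieOf]
  rfl

theorem trES_eta (ω : LinearMap.BilinForm k H) (s : ℕ) (t : TDeg k H s) :
    trES ω s (eta k H s t) = trTree k ω s t := rfl

/-- By surjectivity of `η` it is enough to treat trees. There the reversal is minus the antipode,
the antipode transposes `ω`, and transposing an alternating form gives back the sign. -/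
theorem revCyc_trES [CharZero k] (ω : LinearMap.BilinForm k H) (hω : ω.IsAlt) (s : ℕ)
    (d : D k H s) : revCyc k H s (trES ω s d) = trES ω s d := by
  obtain ⟨t, rfl⟩ := eta_surjective k H s d
  rw [trES_eta]
  obtain ⟨t, ht⟩ := t
  suffices h : revCyc k H s ∘ₗ trTree k ω s = trTree k ω s from LinearMap.congr_fun h t
  refine treeSpace_ext k id fun t => ?_
  rw [LinearMap.comp_apply, trTree_mk, revCyc_cyc, reverse_algTrace (TensorAlgebra.ι k) _
    (antipode k H) (antipode_one k) (antipode_mul k) (antipode_ι k), ← map_neg]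
  simp only [← algTrace_neg, hω.neg_eq]

end Words

/-! ### The invariant of graphs with one external edge -/

section LoopTrace

variable (k : Type u) [Field k] {H : Type v} [AddCommGroup H] [Module k H]

/-- The value of a leaf in the tensor algebra: hairs are kept, ends of edges are dropped. -/
def hairWord : Leaf H → TensorAlgebra k H
  | .hair v => TensorAlgebra.ι k v
  | _ => 0

/-- The form that joins every tail to every head. -/
def edgeForm : Leaf H → Leaf H → k
  | .tail _, .head _ => 1
  | _, _ => 0

theorem antipode_hairWord (x : Leaf H) : antipode k H (hairWord k x) = - hairWord k x := by
  cases x <;> simp [hairWord, antipode_ι]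

variable (H) in
/-- The linear map that opens a graph with one external edge along this edge and multiplies what
hangs on the path from the tail to the head of the edge. -/
def loopTrace (s : ℕ) : PreGraph k H →ₗ[k] DihCoinv k H s :=
  dih k H s ∘ₗ algTraceLin (hairWord k) (edgeForm k) Leaf.hair
    (fun r v w => by simp [hairWord]) (fun v => by funext x; rfl) (fun x v => by cases x <;> rfl)

theorem loopTrace_gr (s : ℕ) (t : UTree (Leaf H)) :
    loopTrace k H s (gr k t) = dih k H s (algTrace (hairWord k) (edgeForm k) t) :=
  congrArg (dih k H s) (algTraceLin_mk _ _ _ _ _ _ t)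

theorem antipode_algTrace (β : Leaf H → Leaf H → k) (t : UTree (Leaf H)) :
    antipode k H (algTrace (hairWord k) β t) = algTrace (hairWord k) (fun x y => β y x) t :=
  reverse_algTrace _ _ _ (antipode_one k) (antipode_mul k) (antipode_hairWord k) t

/-- The antipode acts by `-1` on dihedral coinvariants and transposes the form, so the graph may
equally be opened from head to tail, up to sign. -/
theorem loopTrace_gr' (s : ℕ) (t : UTree (Leaf H)) :
    loopTrace k H s (gr k t) = - dih k H s (algTrace (hairWord k) (fun x y => edgeForm k y x) t) := by
  have h := congrArg (dih k H s) (antipode_algTrace k (edgeForm k) t)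
  rw [dih_antipode] at h
  rw [loopTrace_gr, ← h, neg_neg]

theorem mem_tails {l : List (Leaf H)} {e : ℕ} : e ∈ l.filterMap Leaf.tail? ↔ .tail e ∈ l := by
  rw [List.mem_filterMap]
  constructor
  · rintro ⟨x, hx, h⟩
    cases x <;> simp [Leaf.tail?] at h
    exact h ▸ hx
  · exact fun h => ⟨_, h, rfl⟩

theorem mem_heads {l : List (Leaf H)} {e : ℕ} : e ∈ l.filterMap Leaf.head? ↔ .head e ∈ l := by
  rw [List.mem_filterMap]
  constructor
  · rintro ⟨x, hx, h⟩
    cases x <;> simp [Leaf.head?] at h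
    exact h ▸ hx
  · exact fun h => ⟨_, h, rfl⟩

theorem IsHairy.eq_of_numEdges_eq_one {t : UTree (Leaf H)} (ht : IsHairy t)
    (h1 : numEdges (leaves t) = 1) {e : ℕ} (he : .tail e ∈ leaves t) :
    (leaves t).filterMap Leaf.tail? = [e] ∧ (leaves t).filterMap Leaf.head? = [e] := by
  obtain ⟨a, ha⟩ := List.length_eq_one_iff.1 h1
  have := mem_tails.2 he
  rw [ha, List.mem_singleton] at this
  subst this
  have h2 := ht.2
  rw [ha, List.perm_singleton] at h2
  exact ⟨ha, h2⟩

/-- With a single edge, switching it exchanges the only tail with the only head, which transposes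
`edgeForm` on the leaves that occur; the sign then comes from opening the graph in the other
direction. -/
theorem loopTrace_switch (s : ℕ) {t : UTree (Leaf H)} (ht : IsHairy t)
    (h1 : numEdges (leaves t) = 1) {e : ℕ} (he : .tail e ∈ leaves t) :
    loopTrace k H s (gr k (relabel (Leaf.switch e) t)) = - loopTrace k H s (gr k t) := by
  obtain ⟨hT, hD⟩ := ht.eq_of_numEdges_eq_one h1 he
  have hT' : ∀ e', .tail e' ∈ leaves t → e' = e := fun e' h => by
    have := mem_tails.2 h
    rwa [hT, List.mem_singleton] at this
  have hD' : ∀ e', .head e' ∈ leaves t → e' = e := fun e' h => by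
    have := mem_heads.2 h
    rwa [hD, List.mem_singleton] at this
  rw [loopTrace_gr', neg_inj, algTrace_relabel, loopTrace_gr]
  have hp : hairWord k ∘ Leaf.switch e = hairWord (H := H) k := by
    funext x
    cases x with
    | hair v => rfl
    | tail e' => by_cases h : e' = e <;> simp [Leaf.switch, hairWord, h]
    | head e' => by_cases h : e' = e <;> simp [Leaf.switch, hairWord, h]
  rw [hp]
  congr 1
  refine algTrace_congr _ _ fun x hx y hy => ?_
  cases x with
  | hair v => cases y with
    | hair w => rfl
    | tail f => obtain rfl := hT' _ hy; simp [Leaf.switch, edgeForm]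
    | head f => obtain rfl := hD' _ hy; simp [Leaf.switch, edgeForm]
  | tail e' =>
    obtain rfl := hT' _ hx
    cases y with
    | hair w => simp [Leaf.switch, edgeForm]
    | tail f => obtain rfl := hT' _ hy; simp [Leaf.switch, edgeForm]
    | head f => obtain rfl := hD' _ hy; simp [Leaf.switch, edgeForm]
  | head e' =>
    obtain rfl := hD' _ hx
    cases y with
    | hair w => simp [Leaf.switch, edgeForm]
    | tail f => obtain rfl := hT' _ hy; simp [Leaf.switch, edgeForm]
    | head f => obtain rfl := hD' _ hy; simp [Leaf.switch, edgeForm]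

theorem loopTrace_rename (s : ℕ) (t : UTree (Leaf H)) (f : ℕ → ℕ) :
    loopTrace k H s (gr k (relabel (Leaf.rename f) t)) = loopTrace k H s (gr k t) := by
  rw [loopTrace_gr, loopTrace_gr, algTrace_relabel]
  congr 2
  · funext x; cases x <;> rfl
  · funext x y; cases x <;> cases y <;> rfl

theorem numEdges_relabel_switch {t : UTree (Leaf H)} (ht : IsHairy t) (e : ℕ) :
    numEdges (leaves (relabel (Leaf.switch e) t)) = numEdges (leaves t) := by
  have := numEdges_switch e (leaves t)
  rw [ht.2.count_eq] at this
  rw [leaves_relabel]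
  omega

theorem numHairs_relabel_switch (t : UTree (Leaf H)) (e : ℕ) :
    numHairs (leaves (relabel (Leaf.switch e) t)) = numHairs (leaves t) := by
  rw [leaves_relabel, numHairs, filterMap_hair_switch, numHairs]

theorem numEdges_relabel_rename (t : UTree (Leaf H)) (f : ℕ → ℕ) :
    numEdges (leaves (relabel (Leaf.rename f) t)) = numEdges (leaves t) := by
  rw [leaves_relabel, numEdges, filterMap_tail_rename, List.length_map, numEdges]

theorem numHairs_relabel_rename (t : UTree (Leaf H)) (f : ℕ → ℕ) :
    numHairs (leaves (relabel (Leaf.rename f) t)) = numHairs (leaves t) := by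
  rw [leaves_relabel, numHairs, filterMap_hair_rename, numHairs]

/-- The projection comes first because `edgeRel` contains graphs of every rank, whereas the sign
rule for switching is established for exactly one edge. -/
theorem loopTrace_prePart_edgeRel (s : ℕ) (x : PreGraph k H) (hx : x ∈ edgeRel k H) :
    loopTrace k H s (prePart k H s 1 x) = 0 := by
  refine (Submodule.span_le (p := LinearMap.ker (loopTrace k H s ∘ₗ prePart k H s 1))).2 ?_ hx
  rintro _ (⟨t, e, ht, he, rfl⟩ | ⟨t, f, ht, hf, rfl⟩)
  · rw [SetLike.mem_coe, LinearMap.mem_ker, LinearMap.comp_apply, map_add, prePart_gr, prePart_gr,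
      numEdges_relabel_switch ht, numHairs_relabel_switch]
    split_ifs with h
    · rw [map_add, loopTrace_switch k s ht h.1 (mem_tails.1 he), add_neg_cancel]
    · simp
  · rw [SetLike.mem_coe, LinearMap.mem_ker, LinearMap.comp_apply, map_sub, prePart_gr, prePart_gr,
      numEdges_relabel_rename, numHairs_relabel_rename]
    split_ifs with h
    · rw [map_sub, loopTrace_rename, sub_self]
    · simp

/-! #### Leaves of the graphs in `S₂` of rank one -/

/-- The other end of the edge that ends at a leaf. -/
def Leaf.opp : Leaf H → Leaf H
  | .hair v => .hair v
  | .tail e => .head e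
  | .head e => .tail e

/-- Whether a leaf is an end of an external edge. -/
def Leaf.IsEnd (x : Leaf H) : Prop := ∀ v, x ≠ .hair v

theorem Leaf.opp_injective : Function.Injective (Leaf.opp : Leaf H → Leaf H) := by
  rintro (_ | _ | _) (_ | _ | _) h <;> simp_all [Leaf.opp]

theorem Leaf.IsEnd.opp {x : Leaf H} (h : x.IsEnd) : x.opp.IsEnd := by
  intro v hv
  cases x with
  | hair w => exact h w rfl
  | tail e => exact absurd hv (by simp [Leaf.opp])
  | head e => exact absurd hv (by simp [Leaf.opp])

theorem JoinedTo.isEnd {x : Leaf H} {t : UTree (Leaf H)} (h : JoinedTo x t) :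
    x.IsEnd ∧ x.opp ∈ leaves t := by
  obtain ⟨e, ⟨rfl, h⟩ | ⟨rfl, h⟩⟩ := h <;> exact ⟨(fun v hv => by cases hv), h⟩

open Classical in
theorem joinSign_eq (x y : Leaf H) :
    joinSign k x y = if y = x.opp then joinSign k x x.opp else 0 := by
  cases x <;> cases y <;> simp [joinSign, Leaf.opp, eq_comm]

/-- The number of ends of external edges. -/
def numEnds (l : List (Leaf H)) : ℕ :=
  (l.filterMap Leaf.tail?).length + (l.filterMap Leaf.head?).length

theorem numEnds_perm {l l' : List (Leaf H)} (h : l.Perm l') : numEnds l = numEnds l' := by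
  rw [numEnds, numEnds, (h.filterMap _).length_eq, (h.filterMap _).length_eq]

theorem numEnds_cons_hair (v : H) (l : List (Leaf H)) : numEnds (.hair v :: l) = numEnds l := rfl

theorem numEnds_cons_of_isEnd {x : Leaf H} (hx : x.IsEnd) (l : List (Leaf H)) :
    numEnds (x :: l) = numEnds l + 1 := by
  cases x with
  | hair v => exact absurd rfl (hx v)
  | tail e => simp [numEnds, List.filterMap_cons, Leaf.tail?, Leaf.head?]; omega
  | head e => simp [numEnds, List.filterMap_cons, Leaf.tail?, Leaf.head?]; omega

theorem isEnd_or (x : Leaf H) : x.IsEnd ∨ ∃ v, x = .hair v := by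
  by_cases h : ∃ v, x = .hair v
  · exact Or.inr h
  · exact Or.inl fun v hv => h ⟨v, hv⟩

theorem exists_hairs_of_numEnds_eq_zero (l : List (Leaf H)) (h : numEnds l = 0) :
    ∃ hs : List H, l = hs.map Leaf.hair := by
  induction l with
  | nil => exact ⟨[], rfl⟩
  | cons x l ih =>
    rcases isEnd_or x with hx | ⟨v, rfl⟩
    · rw [numEnds_cons_of_isEnd hx] at h; omega
    · rw [numEnds_cons_hair] at h
      obtain ⟨hs, rfl⟩ := ih h
      exact ⟨v :: hs, rfl⟩

theorem Matched.numEnds_eq {l : List (Leaf H)} (h : Matched l) : numEnds l = 2 * numEdges l := by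
  rw [numEnds, h.2.length_eq, numEdges]; omega

/-- The end of an edge occurs only once. -/
theorem Matched.not_mem_of_isEnd {l : List (Leaf H)} {x : Leaf H} (h : Matched (x :: l))
    (hx : x.IsEnd) : x ∉ l := by
  intro hm
  cases x with
  | hair v => exact hx v rfl
  | tail e => 
    have := h.1
    simp only [List.filterMap_cons, Leaf.tail?, List.nodup_cons] at this
    exact this.1 (mem_tails.2 hm)
  | head e => 
    have := h.2.nodup_iff.2 h.1
    simp only [List.filterMap_cons, Leaf.head?, List.nodup_cons] at this
    exact this.1 (mem_heads.2 hm)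

theorem exists_perm_cons {α : Type*} {a : α} {l : List α} (h : a ∈ l) : ∃ l', l.Perm (a :: l') := by
  obtain ⟨s, t, rfl⟩ := List.append_of_mem h
  exact ⟨s ++ t, List.perm_middle⟩

/-- Rank one means two edges, hence four ends. The legs `y`, `z` and their partners in `t` already
account for all of them, so the third leg and the other leaves of `t` are hairs. -/
theorem slide_leaves {x y z : Leaf H} {t : UTree (Leaf H)} (hy : JoinedTo y t) (hz : JoinedTo z t)
    (hΓ : Matched (leaves₂ ((.of x, .of y * .of z), t)))
    (h2 : numEdges (leaves₂ ((.of x, .of y * .of z), t)) = 2) :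
    (∃ v, x = .hair v) ∧ ∃ hs : List H, (leaves t).Perm (y.opp :: z.opp :: hs.map Leaf.hair) := by
  have e : leaves₂ ((.of x, .of y * .of z), t) = x :: y :: z :: leaves t := rfl
  rw [e] at hΓ h2
  have hyz : y ≠ z := by
    rintro rfl
    exact (hΓ.perm (List.Perm.swap _ _ _)).not_mem_of_isEnd hy.isEnd.1 (by simp)
  obtain ⟨l, hl⟩ := exists_perm_cons hy.isEnd.2
  have hz' : z.opp ∈ l := by
    have := hl.subset hz.isEnd.2
    rw [List.mem_cons] at this
    exact this.resolve_left fun h => hyz (Leaf.opp_injective h).symm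
  obtain ⟨l', hl'⟩ := exists_perm_cons hz'
  have hp : (leaves t).Perm (y.opp :: z.opp :: l') := hl.trans (hl'.cons _)
  have hn := hΓ.numEnds_eq
  rw [h2, numEnds_perm (((hp.cons z).cons y).cons x)] at hn
  rcases isEnd_or x with hx | hx
  · rw [numEnds_cons_of_isEnd hx, numEnds_cons_of_isEnd hy.isEnd.1,
      numEnds_cons_of_isEnd hz.isEnd.1, numEnds_cons_of_isEnd hy.isEnd.1.opp,
      numEnds_cons_of_isEnd hz.isEnd.1.opp] at hn
    omega
  · refine ⟨hx, ?_⟩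
    obtain ⟨v, rfl⟩ := hx
    rw [numEnds_cons_hair, numEnds_cons_of_isEnd hy.isEnd.1,
      numEnds_cons_of_isEnd hz.isEnd.1, numEnds_cons_of_isEnd hy.isEnd.1.opp,
      numEnds_cons_of_isEnd hz.isEnd.1.opp] at hn
    obtain ⟨hs, rfl⟩ := exists_hairs_of_numEnds_eq_zero l' (by omega)
    exact ⟨hs, hp⟩

/-- Here the four ends are the two joined legs, the leg `x`, and its partner in `t`. -/
theorem loop_leaves {x : Leaf H} {e : ℕ} {t : UTree (Leaf H)} (hx : JoinedTo x t)
    (hΓ : Matched (leaves₂ ((.of x, .of (.tail e) * .of (.head e)), t)))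
    (h2 : numEdges (leaves₂ ((.of x, .of (.tail e) * .of (.head e)), t)) = 2) :
    (∃ hs : List H, (leaves t).Perm (x.opp :: hs.map Leaf.hair)) ∧ .tail e ∉ leaves t ∧
      .head e ∉ leaves t := by
  have e' : leaves₂ ((.of x, .of (.tail e) * .of (.head e)), t) =
    x :: .tail e :: .head e :: leaves t := rfl
  rw [e'] at hΓ h2
  have ht : (Leaf.tail e : Leaf H).IsEnd := fun v hv => by cases hv
  have hh : (Leaf.head e : Leaf H).IsEnd := fun v hv => by cases hv
  refine ⟨?_, fun h => ?_, fun h => ?_⟩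
  · obtain ⟨l, hl⟩ := exists_perm_cons hx.isEnd.2
    have hn := hΓ.numEnds_eq
    rw [h2, numEnds_perm (((hl.cons _).cons _).cons x), numEnds_cons_of_isEnd hx.isEnd.1,
      numEnds_cons_of_isEnd ht, numEnds_cons_of_isEnd hh, numEnds_cons_of_isEnd hx.isEnd.1.opp] at hn
    obtain ⟨hs, rfl⟩ := exists_hairs_of_numEnds_eq_zero l (by omega)
    exact ⟨hs, hl⟩
  · exact (hΓ.perm (List.Perm.swap _ _ _)).not_mem_of_isEnd ht (by simp [h])
  · exact (hΓ.perm (List.perm_middle (l₁ := [x, .tail e]))).not_mem_of_isEnd hh (by simp [h])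

/-! #### Vanishing of the invariant on `∂S₂` -/

open Classical in
/-- The indicator function of a leaf. -/
def leafInd (a : Leaf H) : Leaf H → k := fun x => if x = a then 1 else 0

theorem algTrace_root {β : Leaf H → Leaf H → k} {φ : Leaf H → k} {z : Leaf H}
    {c : FreeMagma (Leaf H)} (h : ∀ x ∈ leavesR c, β z x = φ x)
    (h' : ∀ x ∈ leavesR c, β x = fun _ => 0) :
    algTrace (hairWord k) β (.of z, c) = firstLetter (hairWord k) φ c := by
  rw [algTrace_eq, algTraceR_of, algTraceR_eq_zero _ h', add_zero]
  exact firstLetter_congr _ _ h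

/-- The only possible contraction is between the root `z` and its partner. If `z` is a head, the
transposed formula is used, and its sign is the value `-1` of `joinSign`. -/
theorem loopTrace_root (s : ℕ) {z : Leaf H} (hz : z.IsEnd) {c : FreeMagma (Leaf H)} {hs : List H}
    (hc : (leavesR c).Perm (z.opp :: hs.map Leaf.hair)) :
    loopTrace k H s (gr k (.of z, c)) =
      joinSign k z z.opp • dih k H s (firstLetter (hairWord k) (leafInd k z.opp) c) := by
  have hm : ∀ x ∈ leavesR c, x = z.opp ∨ ∃ v, x = .hair v := fun x hx => by
    have := hc.subset hx
    simp only [List.mem_cons, List.mem_map] at this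
    exact this.imp_right fun ⟨v, _, h⟩ => ⟨v, h.symm⟩
  cases z with
  | hair v => exact absurd rfl (hz v)
  | tail e =>
    rw [loopTrace_gr, algTrace_root k (φ := leafInd k (.head e))]
    · simp [joinSign, Leaf.opp]
    · intro x hx
      obtain rfl | ⟨v, rfl⟩ := hm x hx <;> simp [edgeForm, leafInd, Leaf.opp]
    · intro x hx
      obtain rfl | ⟨v, rfl⟩ := hm x hx <;> rfl
  | head e =>
    rw [loopTrace_gr', algTrace_root k (φ := leafInd k (.tail e))]
    · simp [joinSign, Leaf.opp]
    · intro x hx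
      obtain rfl | ⟨v, rfl⟩ := hm x hx <;> simp [edgeForm, leafInd, Leaf.opp]
    · intro x hx
      funext y
      obtain rfl | ⟨v, rfl⟩ := hm x hx <;> cases y <;> rfl

theorem boundary_tripod (x y z : Leaf H) (t : UTree (Leaf H)) :
    boundary k ((.of x, .of y * .of z), t) =
      ((rootings t).map fun q => joinSign k x q.1 • gr k (.of y * .of z, q.2) +
        joinSign k y q.1 • gr k (.of z, .of x * q.2) +
        joinSign k z q.1 • gr k (.of y, q.2 * .of x)).sum := by
  have h1 : ∀ c, gr k (.of z * .of x, c) = gr k (.of z, .of x * c) := fun c => gr_move _ _ _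
  have h2 : ∀ c, gr k (.of x * .of y, c) = gr k (.of y, c * .of x) :=
    fun c => treeMk_rotate k _ _ _ _
  simp only [boundary, rootings, rootingsR_mul, rootingsR_of, List.map_append, List.map_cons,
    List.map_nil, List.sum_append, List.sum_cons, List.sum_nil, List.cons_append, List.nil_append,
    h1, h2, List.sum_map_add]
  abel

/-- Contracting one of the two edges leaves the other one to be opened. Both orders give the
contraction of `t` at its two ends `y.opp` and `z.opp`, with the form transposed between them,
multiplied by the hair `v` of the tripod. Writing `w` for one of these contractions, the other is
its antipode, and in dihedral coinvariants `S(w) v` equals `v w`, hence `w v`; the opposite signs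
make the terms cancel. -/
theorem loopTrace_slide (s : ℕ) {x y z : Leaf H} {t : UTree (Leaf H)} (hy : JoinedTo y t)
    (hz : JoinedTo z t) (hΓ : Matched (leaves₂ ((.of x, .of y * .of z), t)))
    (h2 : numEdges (leaves₂ ((.of x, .of y * .of z), t)) = 2) :
    loopTrace k H s (boundary k ((.of x, .of y * .of z), t)) = 0 := by
  classical
  obtain ⟨⟨v, rfl⟩, hs, hl⟩ := slide_leaves hy hz hΓ h2
  -- `β` takes the end of the contracted edge `y` as root and the end of the remaining edge `z` as
  -- first letter; `β'` is the opposite choice.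
  let β : Leaf H → Leaf H → k := fun a b => if a = y.opp then leafInd k z.opp b else 0
  let β' : Leaf H → Leaf H → k := fun a b => if a = z.opp then leafInd k y.opp b else 0
  have hβ : (fun a b => β b a) = β' := by
    funext a b
    by_cases h : a = z.opp <;> by_cases h' : b = y.opp <;> simp [β, β', leafInd, h, h']
  have hval : ∀ (y : Leaf H) c, y.IsEnd → firstLetter (hairWord k) (leafInd k y.opp)
      (.of (.hair v) * c) = - (firstLetter (hairWord k) (leafInd k y.opp) c * TensorAlgebra.ι k v) ∧
      firstLetter (hairWord k) (leafInd k y.opp)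
      (c * .of (.hair v)) = firstLetter (hairWord k) (leafInd k y.opp) c * TensorAlgebra.ι k v := by
    intro y c hy
    have : leafInd k y.opp (.hair v) = 0 := if_neg fun h => hy.opp v h.symm
    simp [this, hairWord]
  have key : ∀ q ∈ rootings t,
      loopTrace k H s (joinSign k (.hair v) q.1 • gr k (.of y * .of z, q.2) +
        joinSign k y q.1 • gr k (.of z, .of (.hair v) * q.2) +
        joinSign k z q.1 • gr k (.of y, q.2 * .of (.hair v))) =
      (joinSign k y y.opp * joinSign k z z.opp) • dih k H s
        ((firstLetter (hairWord k) (β' q.1) q.2 - firstLetter (hairWord k) (β q.1) q.2) *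
          TensorAlgebra.ι k v) := by
    intro q hq
    have hp := (rootings_perm t q hq).trans hl
    have e1 : loopTrace k H s (joinSign k y q.1 • gr k (.of z, .of (.hair v) * q.2)) =
        (joinSign k y y.opp * joinSign k z z.opp) • dih k H s
          (- (firstLetter (hairWord k) (β q.1) q.2 * TensorAlgebra.ι k v)) := by
      rw [joinSign_eq]
      by_cases h : q.1 = y.opp
      · have hβ1 : β q.1 = leafInd k z.opp := by funext b; simp [β, h]
        rw [h, List.perm_cons] at hp
        have hq' : (leavesR (FreeMagma.of (Leaf.hair v) * q.2)).Perm
            (z.opp :: (v :: hs).map Leaf.hair) :=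
          show (Leaf.hair v :: leavesR q.2).Perm _ from
            (hp.cons (.hair v)).trans (List.Perm.swap _ _ _)
        rw [if_pos h, map_smul, loopTrace_root k s hz.isEnd.1 hq',
          (hval z q.2 hz.isEnd.1).1, smul_smul, hβ1]
      · have hβ1 : β q.1 = fun _ => 0 := by funext b; simp [β, h]
        rw [if_neg h, hβ1, firstLetter_zero]
        simp
    have e2 : loopTrace k H s (joinSign k z q.1 • gr k (.of y, q.2 * .of (.hair v))) =
        (joinSign k y y.opp * joinSign k z z.opp) • dih k H s
          (firstLetter (hairWord k) (β' q.1) q.2 * TensorAlgebra.ι k v) := by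
      rw [joinSign_eq]
      by_cases h : q.1 = z.opp
      · have hβ1 : β' q.1 = leafInd k y.opp := by funext b; simp [β', h]
        have hp' := hp.trans (List.Perm.swap _ _ _)
        rw [h, List.perm_cons] at hp'
        have hq' : (leavesR (q.2 * FreeMagma.of (Leaf.hair v))).Perm
            (y.opp :: (v :: hs).map Leaf.hair) :=
          List.perm_append_comm.trans (show (Leaf.hair v :: leavesR q.2).Perm _ from
            (hp'.cons (.hair v)).trans (List.Perm.swap _ _ _))
        rw [if_pos h, map_smul, loopTrace_root k s hy.isEnd.1 hq',
          (hval y q.2 hy.isEnd.1).2, smul_smul, hβ1, mul_comm]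
      · have hβ1 : β' q.1 = fun _ => 0 := by funext b; simp [β', h]
        rw [if_neg h, hβ1, firstLetter_zero]
        simp
    have e0 : joinSign k (.hair v) q.1 = 0 := by cases q.1 <;> rfl
    rw [e0, zero_smul, zero_add, map_add, e1, e2, ← smul_add, ← map_add, sub_mul]
    congr 2
    abel
  rw [boundary_tripod, map_list_sum, List.map_map]
  have hsum : ∀ l : List (Leaf H × FreeMagma (Leaf H)), (l.map fun q =>
      (joinSign k y y.opp * joinSign k z z.opp) • dih k H s
        ((firstLetter (hairWord k) (β' q.1) q.2 - firstLetter (hairWord k) (β q.1) q.2) *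
          TensorAlgebra.ι k v)).sum = (joinSign k y y.opp * joinSign k z z.opp) • dih k H s
        (((l.map fun q => firstLetter (hairWord k) (β' q.1) q.2).sum -
          (l.map fun q => firstLetter (hairWord k) (β q.1) q.2).sum) * TensorAlgebra.ι k v) := by
    intro l
    induction l with
    | nil => simp
    | cons q l ih =>
      rw [List.map_cons, List.sum_cons, ih, ← smul_add, ← map_add, ← add_mul]
      simp only [List.map_cons, List.sum_cons]
      congr 3
      abel
  refine (congrArg List.sum (List.map_congr_left key)).trans ?_
  rw [hsum]
  change _ • dih k H s ((algTrace (hairWord k) β' t - algTrace (hairWord k) β t) * _) = 0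
  rw [← hβ, ← antipode_algTrace, sub_mul, map_sub]
  have h3 : dih k H s (antipode k H (algTrace (hairWord k) β t) * TensorAlgebra.ι k v) =
      - dih k H s (antipode k H (TensorAlgebra.ι k v * algTrace (hairWord k) β t)) := by
    rw [antipode_mul, antipode_ι, mul_neg, map_neg, neg_neg]
  rw [h3, dih_antipode, neg_neg, dih_mul_comm, sub_self, smul_zero]

/-- Only the edge at `x` joins the two trees. After contracting it, a tree of hairs hangs on a loop,
and the invariant is its commutator. With at least two hairs this tree is a product, so its value is
a commutator and dies by cyclicity; with one hair it would be that hair itself. -/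
theorem loopTrace_loop (s : ℕ) {x : Leaf H} {e : ℕ} {t : UTree (Leaf H)} (hx : JoinedTo x t)
    (hΓ : Matched (leaves₂ ((.of x, .of (.tail e) * .of (.head e)), t)))
    (h2 : numEdges (leaves₂ ((.of x, .of (.tail e) * .of (.head e)), t)) = 2)
    (hs2 : 2 ≤ numHairs (leaves₂ ((.of x, .of (.tail e) * .of (.head e)), t))) :
    loopTrace k H s (boundary k ((.of x, .of (.tail e) * .of (.head e)), t)) = 0 := by
  classical
  obtain ⟨⟨hs, hl⟩, h1, h3⟩ := loop_leaves hx hΓ h2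
  rw [boundary_tripod, map_list_sum, List.map_map, List.sum_eq_zero]
  intro y hy
  obtain ⟨q, hq, rfl⟩ := List.mem_map.1 hy
  have hm := (mem_leaves_of_mem_rootings hq).1
  have e1 : joinSign k (.tail e) q.1 = 0 := by
    rw [joinSign_eq, if_neg]
    intro h
    rw [h] at hm
    exact h3 hm
  have e2 : joinSign k (.head e) q.1 = 0 := by
    rw [joinSign_eq, if_neg]
    intro h
    rw [h] at hm
    exact h1 hm
  rw [Function.comp_apply, e1, e2, zero_smul, zero_smul, add_zero, add_zero, joinSign_eq]
  split_ifs with h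
  · have hp := (rootings_perm t q hq).trans hl
    rw [h, List.perm_cons] at hp
    have hlen : 2 ≤ (leavesR q.2).length := by
      rw [hp.length_eq, List.length_map]
      have e3 : numHairs (leaves₂ ((.of x, .of (.tail e) * .of (.head e)), t)) = hs.length := by
        have e4 : leaves₂ ((.of x, .of (.tail e) * .of (.head e)), t) =
          x :: .tail e :: .head e :: leaves t := rfl
        have e5 : ∀ (y : Leaf H) l, y.IsEnd → numHairs (y :: l) = numHairs l := by
          intro y l hy
          cases y with
          | hair v => exact absurd rfl (hy v)
          | _ => rfl
        rw [e4, numHairs_perm (((hl.cons _).cons _).cons x), e5 _ _ hx.isEnd.1,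
          e5 _ _ (fun v hv => by cases hv), e5 _ _ (fun v hv => by cases hv),
          e5 _ _ hx.isEnd.1.opp, numHairs, List.filterMap_map]
        simp [Function.comp_def, Leaf.hair?]
      omega
    have hte : (Leaf.tail e : Leaf H).IsEnd := fun v hv => by cases hv
    have h0 : firstLetter (hairWord k) (leafInd k (.head e)) q.2 = 0 := by
      refine firstLetter_eq_zero _ _ fun y hy => if_neg ?_
      rintro rfl
      have := hp.subset hy
      simp at this
    have hq' : (leavesR (FreeMagma.of (Leaf.head e) * q.2)).Perm
        ((Leaf.tail e).opp :: hs.map Leaf.hair) :=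
      show (Leaf.head e :: leavesR q.2).Perm _ from hp.cons (.head e)
    rw [map_smul, gr_move, loopTrace_root k s hte hq']
    rw [Leaf.opp, firstLetter_mul, h0, firstLetter_of, leafInd, if_pos rfl, map_one, one_mul,
      zero_mul, sub_zero]
    obtain ⟨r, c⟩ := q
    cases c with
    | of y => simp [leavesR] at hlen
    | mul a b =>
      change _ • _ • dih k H s (comm (hairWord k) a * comm (hairWord k) b -
        comm (hairWord k) b * comm (hairWord k) a) = 0
      rw [map_sub, dih_mul_comm, sub_self, smul_zero, smul_zero]
  · simp

theorem loopTrace_prePart_bdS₂Part (s : ℕ) (hs : 2 ≤ s) (x : PreGraph k H)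
    (hx : x ∈ bdS₂Part k H s 1) : loopTrace k H s (prePart k H s 1 x) = 0 := by
  refine (Submodule.span_le (p := LinearMap.ker (loopTrace k H s ∘ₗ prePart k H s 1))).2 ?_ hx
  rintro _ ⟨Γ, hΓ, h2, h3, rfl⟩
  rw [SetLike.mem_coe, LinearMap.mem_ker, LinearMap.comp_apply, prePart_boundary,
    if_pos ⟨h2, h3⟩]
  cases hΓ with
  | slide x y z t hy hz hΓ => exact loopTrace_slide k s hy hz hΓ h2
  | loop x e t hx hΓ => exact loopTrace_loop k s hx hΓ h2 (by rw [h3]; exact hs)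

/-! ### The invariant on `Ω_{s,1}(H)` and its value on loops -/

variable (H) in
/-- The map `Ω_{s,1}(H) → [H^{⊗s}]_{D_{2s}}` induced by `loopTrace`. -/
def omegaTrace (s : ℕ) (hs : 2 ≤ s) : OmegaPart k H s 1 →ₗ[k] DihCoinv k H s :=
  Submodule.liftQ _ (loopTrace k H s ∘ₗ prePart k H s 1 ∘ₗ (PreC₁Part k H s 1).subtype) <| by
    rintro ⟨x, hx⟩ h
    obtain ⟨y, hy, z, hz, rfl⟩ := Submodule.mem_sup.1 (show x ∈ _ from h)
    rw [LinearMap.mem_ker, LinearMap.comp_apply, LinearMap.comp_apply, Submodule.subtype_apply,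
      map_add, map_add, loopTrace_prePart_edgeRel k s y hy, loopTrace_prePart_bdS₂Part k s hs z hz,
      add_zero]

theorem prePart_of_mem (s r : ℕ) (x : PreGraph k H) (hx : x ∈ PreC₁Part k H s r) :
    prePart k H s r x = x := by
  refine (Submodule.span_le (p := LinearMap.eqLocus (prePart k H s r) LinearMap.id)).2 ?_ hx
  rintro _ ⟨t, ht, h1, h2, rfl⟩
  exact (prePart_gr s r t).trans (if_pos ⟨h1, h2⟩)

theorem omegaTrace_mk (s : ℕ) (hs : 2 ≤ s) (x : PreC₁Part k H s 1) :
    omegaTrace k H s hs (Submodule.mkQ _ x) = loopTrace k H s x := by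
  change loopTrace k H s (prePart k H s 1 x) = _
  exact congrArg _ (prePart_of_mem k s 1 _ x.2)

/-- Attaching hairs one by one. -/
def attach (a : FreeMagma (Leaf H)) (l : List H) : FreeMagma (Leaf H) :=
  l.foldl (fun a x => a * .of (.hair x)) a

theorem leavesR_attach (a : FreeMagma (Leaf H)) (l : List H) :
    leavesR (attach a l) = leavesR a ++ l.map Leaf.hair := by
  induction l generalizing a with
  | nil => simp [attach]
  | cons x l ih =>
    refine (ih (a * .of (.hair x))).trans ?_
    simp

theorem firstLetter_attach {φ : Leaf H → k} (hφ : ∀ v, φ (.hair v) = 0) (a : FreeMagma (Leaf H))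
    (l : List H) : firstLetter (hairWord k) φ (attach a l) =
      firstLetter (hairWord k) φ a * word k l := by
  induction l generalizing a with
  | nil => simp [attach]
  | cons x l ih =>
    refine (ih (a * .of (.hair x))).trans ?_
    simp [hφ, hairWord, mul_assoc]

theorem omegaTrace_loopClass (s : ℕ) (hs : 2 ≤ s) (v : Fin s → H) :
    omegaTrace k H s hs (loopClass k v) = Submodule.mkQ _ (PiTensorProduct.tprod k v) := by
  rw [loopClass, omegaTrace_mk]
  change loopTrace k H s (gr k (.of (.tail 0), attach (.of (.head 0)) (List.ofFn v))) = _
  rw [loopTrace_root k s (fun v hv => by cases hv) (hs := List.ofFn v)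
    (by rw [leavesR_attach]; rfl), firstLetter_attach k (fun v => if_neg (by simp [Leaf.opp]))]
  have h1 : leafInd k (Leaf.tail 0).opp (Leaf.head 0 : Leaf H) = 1 := if_pos rfl
  have h2 : joinSign k (Leaf.tail 0 : Leaf H) (Leaf.tail 0).opp = 1 := by
    simp [joinSign, Leaf.opp]
  rw [firstLetter_of, h1, h2, map_one, one_mul, one_smul, dih, LinearMap.comp_apply,
    tensorPart_ofFn]

end LoopTrace

/-! ### Loops generate the graphs with one external edge -/

section Loops

variable (k : Type u) [Field k] {H : Type v} [AddCommGroup H] [Module k H]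

theorem attach_append (a : FreeMagma (Leaf H)) (l l' : List H) :
    attach a (l ++ l') = attach (attach a l) l' := List.foldl_append

theorem attach_cons (a : FreeMagma (Leaf H)) (v : H) (l : List H) :
    attach a (v :: l) = attach (a * .of (.hair v)) l := rfl

theorem attach_snoc (a : FreeMagma (Leaf H)) (l : List H) (v : H) :
    attach a (l ++ [v]) = attach a l * .of (.hair v) := by
  rw [attach_append]
  rfl

theorem gr_swap (a b c : FreeMagma (Leaf H)) : gr k (a, b * c) = - gr k (a, c * b) :=
  treeMk_swap k _ a b c

/-- Moving a hair across the cut costs one use of AS, and the hair attached last moves first, which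
reverses the order. -/
theorem gr_attach (x a : FreeMagma (Leaf H)) (l : List H) :
    gr k (x, attach a l) = (-1 : k) ^ l.length • gr k (attach x l.reverse, a) := by
  induction l using List.reverseRecOn generalizing x with
  | nil => simp [attach]
  | append_singleton l v ih =>
    rw [attach_snoc, gr_swap, ← gr_move, ih, List.reverse_append, List.reverse_singleton,
      List.singleton_append, attach_cons, List.length_append, pow_add]
    simp

theorem gr_foldr (x a : FreeMagma (Leaf H)) (l : List H) :
    gr k (x, l.foldr (fun v c => .of (.hair v) * c) a) = gr k (attach x l, a) := by
  induction l generalizing x with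
  | nil => rfl
  | cons v l ih => rw [List.foldr_cons, ← gr_move, ih, attach_cons]

/-- Multilinearity is imposed only at a leaf forming one side of the cut, so the tree is first recut
at the edge of the hair in question. -/
theorem gr_attach_linear (x a : FreeMagma (Leaf H)) (r : k) (v w : H) (l l' : List H) :
    gr k (x, attach a (l ++ (r • v + w) :: l')) =
      r • gr k (x, attach a (l ++ v :: l')) + gr k (x, attach a (l ++ w :: l')) := by
  have key : ∀ u : H, gr k (x, attach a (l ++ u :: l')) = (-1 : k) ^ l'.length •
      gr k (.of (.hair u), attach x l'.reverse * attach a l) := fun u => by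
    rw [attach_append, attach_cons, gr_attach, ← gr_move, gr_flip]
  have h : gr k (.of (.hair (r • v + w)), attach x l'.reverse * attach a l) =
      r • gr k (.of (.hair v), attach x l'.reverse * attach a l) +
        gr k (.of (.hair w), attach x l'.reverse * attach a l) := treeMk_linear k _ r v w _
  rw [key, key, key, h, smul_add, smul_comm]

theorem gr_attach_smul (x a : FreeMagma (Leaf H)) (r : k) (v : H) (l l' : List H) :
    gr k (x, attach a (l ++ (r • v) :: l')) = r • gr k (x, attach a (l ++ v :: l')) := by
  have h0 := gr_attach_linear k x a 1 (0 : H) 0 l l'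
  rw [smul_zero, add_zero, one_smul, left_eq_add] at h0
  have h := gr_attach_linear k x a r v 0 l l'
  rwa [add_zero, h0, add_zero] at h

/-- The loop with given hairs, as an element of `PreGraph`. -/
def loopGr (l : List H) : PreGraph k H := gr k (.of (.tail 0), attach (.of (.head 0)) l)

/-- Combinations of the graphs obtained from `a` by attaching `n` hairs. -/
def attachSpan (x a : FreeMagma (Leaf H)) (n : ℕ) : Submodule k (PreGraph k H) :=
  Submodule.span k {y | ∃ l : List H, l.length = n ∧ y = gr k (x, attach a l)}

/-- The extra hairs are moved to the other side of the cut, where the hypothesis, valid for every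
`x`, applies; then they are moved back, and the two signs cancel. -/
theorem attachSpan_le {a d : FreeMagma (Leaf H)} {m : ℕ}
    (h : ∀ x, gr k (x, d) ∈ attachSpan k x a m) (x : FreeMagma (Leaf H)) (n : ℕ) :
    attachSpan k x d n ≤ attachSpan k x a (m + n) := by
  refine Submodule.span_le.2 ?_
  rintro _ ⟨l, rfl, rfl⟩
  rw [gr_attach]
  refine Submodule.smul_mem _ _ (Submodule.span_le.2 ?_ (h (attach x l.reverse)))
  rintro _ ⟨l', rfl, rfl⟩
  have h2 : gr k (attach x l.reverse, attach a l') =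
      (-1 : k) ^ l.length • gr k (x, attach a (l' ++ l)) := by
    rw [attach_append, gr_attach k x, smul_smul, ← mul_pow]
    simp
  rw [SetLike.mem_coe, h2]
  exact Submodule.smul_mem _ _ (Submodule.subset_span ⟨_, by simp, rfl⟩)

/-- IHX in the form `a(bc) = (ab)c - (ac)b` breaks a branch of hairs hanging on a path into single
hairs. -/
theorem gr_mul_mem_attachSpan (c : FreeMagma (Leaf H)) (hc : ∀ x ∈ leavesR c, ∃ v, x = .hair v)
    (x a : FreeMagma (Leaf H)) : gr k (x, a * c) ∈ attachSpan k x a (nodesR c + 1) := by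
  induction c generalizing x a with
  | ih1 y =>
    obtain ⟨v, rfl⟩ := hc y (by simp)
    exact Submodule.subset_span ⟨[v], rfl, rfl⟩
  | ih2 b c hb hc' =>
    simp only [leavesR_mul, List.mem_append] at hc
    have hb := hb fun y hy => hc y (Or.inl hy)
    have hc' := hc' fun y hy => hc y (Or.inr hy)
    have e : gr k (x, a * (b * c)) = gr k (x, a * b * c) - gr k (x, a * c * b) := by
      have h1 := treeMk_leibniz k (Leaf.hair : H → Leaf H) x a b c
      have h2 := treeMk_swap k (Leaf.hair : H → Leaf H) x b (a * c)
      rw [h2, ← sub_eq_add_neg] at h1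
      exact h1
    rw [e]
    refine sub_mem ?_ ?_
    · have := attachSpan_le k (fun x => hb x a) x _ (hc' x (a * b))
      rwa [show nodesR (b * c) + 1 = nodesR b + 1 + (nodesR c + 1) by simp; omega]
    · have := attachSpan_le k (fun x => hc' x a) x _ (hb x (a * c))
      rwa [show nodesR (b * c) + 1 = nodesR c + 1 + (nodesR b + 1) by simp; omega]

theorem exists_eq_map_hair {l : List (Leaf H)} (h : ∀ x ∈ l, ∃ v, x = .hair v) :
    ∃ hs : List H, l = hs.map Leaf.hair := by
  induction l with
  | nil => exact ⟨[], rfl⟩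
  | cons x l ih =>
    obtain ⟨v, rfl⟩ := h x List.mem_cons_self
    obtain ⟨hs, rfl⟩ := ih fun y hy => h y (List.mem_cons_of_mem _ hy)
    exact ⟨v :: hs, rfl⟩

/-- The path from the root to `h` is followed; at each vertex, the branch not containing `h` carries
only hairs and can be combed. -/
theorem gr_mem_attachSpan (h : Leaf H) (c : FreeMagma (Leaf H)) {hs : List H}
    (hc : (leavesR c).Perm (h :: hs.map Leaf.hair)) (x : FreeMagma (Leaf H)) :
    gr k (x, c) ∈ attachSpan k x (.of h) (nodesR c) := by
  induction c generalizing x hs with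
  | ih1 y =>
    have := List.singleton_perm.1 hc
    simp only [List.cons.injEq] at this
    obtain ⟨rfl, -⟩ := this
    exact Submodule.subset_span ⟨[], rfl, rfl⟩
  | ih2 a b ha hb =>
    have key : ∀ a b : FreeMagma (Leaf H), (leavesR a ++ leavesR b).Perm (h :: hs.map Leaf.hair) →
        h ∈ leavesR a → (∃ hs' : List H, (leavesR a).Perm (h :: hs'.map Leaf.hair)) ∧
          ∀ x ∈ leavesR b, ∃ v, x = .hair v := by
      intro a b hab h1
      obtain ⟨l, hl⟩ := exists_perm_cons h1
      have h2 : (l ++ leavesR b).Perm (hs.map Leaf.hair) :=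
        (List.perm_cons h).1 ((hl.append_right _).symm.trans hab)
      have h3 : ∀ x ∈ l ++ leavesR b, ∃ v, x = .hair v := fun x hx => by
        obtain ⟨v, _, rfl⟩ := List.mem_map.1 (h2.subset hx)
        exact ⟨v, rfl⟩
      refine ⟨?_, fun x hx => h3 x (by simp [hx])⟩
      obtain ⟨hs', rfl⟩ := exists_eq_map_hair fun x hx => h3 x (List.mem_append_left _ hx)
      exact ⟨hs', hl⟩
    rw [leavesR_mul] at hc
    rcases List.mem_append.1 (hc.symm.subset List.mem_cons_self) with h1 | h1
    · obtain ⟨⟨hs', h2⟩, h3⟩ := key a b hc h1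
      have := attachSpan_le k (ha h2) x _ (gr_mul_mem_attachSpan k b h3 x a)
      rwa [nodesR_mul, add_assoc]
    · obtain ⟨⟨hs', h2⟩, h3⟩ := key b a (List.perm_append_comm.trans hc) h1
      have := attachSpan_le k (hb h2) x _ (gr_mul_mem_attachSpan k a h3 x b)
      rw [gr_swap, nodesR_mul, add_comm (nodesR a), add_assoc]
      exact neg_mem this

theorem exists_rooting {X : Type*} {t : UTree X} {x : X} (h : x ∈ leaves t) :
    ∃ c, (x, c) ∈ rootings t := by
  have key : ∀ a c : FreeMagma X, (rootingsR a c).map Prod.fst = leavesR a := by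
    intro a
    induction a with
    | ih1 x => intro c; rfl
    | ih2 a b ha hb => intro c; simp [ha, hb]
  have h1 : (rootings t).map Prod.fst = leaves t := by simp [rootings, leaves, key]
  rw [← h1] at h
  obtain ⟨⟨y, c⟩, hc, rfl⟩ := List.mem_map.1 h
  exact ⟨c, hc⟩

theorem IsHairy.leaves_perm {t : UTree (Leaf H)} (ht : IsHairy t) (h1 : numEdges (leaves t) = 1) :
    ∃ e, ∃ hs : List H, (leaves t).Perm (.tail e :: .head e :: hs.map Leaf.hair) := by
  obtain ⟨e, he⟩ := List.length_eq_one_iff.1 h1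
  have hT : Leaf.tail e ∈ leaves t := mem_tails.1 (by rw [he]; simp)
  have hD : Leaf.head e ∈ leaves t := 
    mem_heads.1 (by rw [(ht.eq_of_numEdges_eq_one h1 hT).2]; simp)
  obtain ⟨l, hl⟩ := exists_perm_cons hT
  have hD' : Leaf.head e ∈ l := by simpa using hl.subset hD
  obtain ⟨l', hl'⟩ := exists_perm_cons hD'
  have hp := hl.trans (hl'.cons _)
  have hn := Matched.numEnds_eq ht
  rw [h1, numEnds_perm hp, numEnds_cons_of_isEnd (fun v hv => by cases hv),
    numEnds_cons_of_isEnd (fun v hv => by cases hv)] at hn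
  obtain ⟨hs, rfl⟩ := exists_hairs_of_numEnds_eq_zero l' (by omega)
  exact ⟨e, hs, hp⟩

theorem numHairs_map_hair (l : List H) : numHairs (l.map Leaf.hair) = l.length := by
  rw [numHairs, List.filterMap_map]
  simp [Function.comp_def, Leaf.hair?]

/-- Every graph with one external edge is a combination of loops. -/
theorem PreC₁Part_le (s : ℕ) :
    PreC₁Part k H s 1 ≤ attachSpan k (.of (.tail 0)) (.of (.head 0)) s ⊔ edgeRel k H := by
  refine Submodule.span_le.2 ?_
  rintro _ ⟨t, ht, h1, h2, rfl⟩
  obtain ⟨e, hs, hp⟩ := ht.leaves_perm h1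
  have hlen : hs.length = s := by
    rw [← h2, numHairs_perm hp, ← numHairs_map_hair]
    rfl
  -- A transposition is used because renamings must be injective on all names.
  let t' := relabel (Leaf.rename (Equiv.swap e 0)) t
  have hp' : (leaves t').Perm (.tail 0 :: .head 0 :: hs.map Leaf.hair) := by
    rw [leaves_relabel]
    refine (hp.map _).trans ?_
    simp [Leaf.rename, Function.comp_def]
  obtain ⟨c, hc⟩ := exists_rooting (hp'.symm.subset List.mem_cons_self)
  have hc' := (rootings_perm t' _ hc).trans hp'
  rw [List.perm_cons] at hc'
  change (leavesR c).Perm _ at hc'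
  have hn : nodesR c = s := by
    have := hc'.length_eq
    rw [leavesR_length, List.length_cons, List.length_map] at this
    omega
  have h3 : gr k t' = gr k (.of (.tail 0), c) := treeMk_rootings k _ t' _ hc
  have h4 := gr_mem_attachSpan k (.head 0) c hc' (.of (.tail 0))
  rw [← h3, hn] at h4
  have h5 : gr k t - gr k t' ∈ edgeRel k H :=
    Submodule.subset_span (Or.inr ⟨t, _, ht, (Equiv.swap e 0).injective, rfl⟩)
  rw [SetLike.mem_coe, ← sub_add_cancel (gr k t) (gr k t')]
  exact add_mem (Submodule.mem_sup_right h5) (Submodule.mem_sup_left h4)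

/-! ### The dihedral symmetry of loops -/

theorem leaves_loop (l : List H) (i : ℕ) :
    leaves ((.of (.tail i), attach (.of (.head i)) l) : UTree (Leaf H)) =
      .tail i :: .head i :: l.map Leaf.hair := by
  simp [leaves, leavesR_attach]

theorem tails_map_hair (l : List H) : (l.map Leaf.hair).filterMap Leaf.tail? = [] := by
  rw [List.filterMap_map]; simp [Function.comp_def, Leaf.tail?]

theorem heads_map_hair (l : List H) : (l.map Leaf.hair).filterMap Leaf.head? = [] := by
  rw [List.filterMap_map]; simp [Function.comp_def, Leaf.head?]

theorem isHairy_loop (l : List H) :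
    IsHairy ((.of (.tail 0), attach (.of (.head 0)) l) : UTree (Leaf H)) := by
  rw [IsHairy, leaves_loop, Matched]
  simp only [List.filterMap_cons, Leaf.tail?, Leaf.head?, tails_map_hair, heads_map_hair]
  simp

theorem map_attach (f : Leaf H → Leaf H) (hf : ∀ v, f (.hair v) = .hair v)
    (a : FreeMagma (Leaf H)) (l : List H) :
    FreeMagma.map f (attach a l) = attach (FreeMagma.map f a) l := by
  induction l generalizing a with
  | nil => rfl
  | cons v l ih => rw [attach_cons, ih, map_mul, FreeMagma.map_of, hf, attach_cons]

/-- Switching the edge exchanges the two ends, and recutting moves all hairs to the other side, with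
reversed order and the sign of `gr_attach`. -/
theorem loopGr_reverse (l : List H) :
    loopGr k l.reverse + (-1 : k) ^ l.length • loopGr k l ∈ edgeRel k H := by
  have h : gr k (relabel (Leaf.switch 0) (.of (.tail 0), attach (.of (.head 0)) l.reverse)) =
      (-1 : k) ^ l.length • loopGr k l := by
    rw [relabel, map_attach _ (fun v => rfl)]
    simp only [FreeMagma.map_of, Leaf.switch, if_true]
    rw [gr_flip, loopGr, gr_attach, smul_smul, ← mul_pow]
    simp
  rw [← h]
  refine Submodule.subset_span (Or.inl ⟨_, 0, isHairy_loop l.reverse, ?_, rfl⟩)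
  rw [leaves_loop]
  simp [Leaf.tail?]

/-- A function that vanishes when the root is a hair sees only the rooting at the leaf `a`; from
there the hairs are met in order, as a right-nested tree. -/
theorem sum_rootingsR_attach {M : Type*} [AddCommGroup M] (F : Leaf H × FreeMagma (Leaf H) → M)
    (hF : ∀ v c, F (.hair v, c) = 0) (a : Leaf H) (l : List H) (c : FreeMagma (Leaf H)) :
    ((rootingsR (attach (.of a) l) c).map F).sum =
      F (a, l.foldr (fun v c => .of (.hair v) * c) c) := by
  induction l using List.reverseRecOn generalizing c with
  | nil => simp [attach]
  | append_singleton l v ih =>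
    rw [attach_snoc, rootingsR_mul, List.map_append, List.sum_append, ih]
    simp [hF]

/-- The other tree is a line from `head 0` to `head 1`. Contracting edge `0` closes it with edge
`1`, and contracting edge `1` closes it with edge `0` and traverses it in the opposite direction; in
both cases `v` lies at the junction. -/
theorem boundary_slide_loop (l : List H) (v : H) :
    boundary k ((.of (.hair v), .of (.tail 0) * .of (.tail 1)),
        (.of (.head 0), attach (.of (.head 1)) l)) =
      - gr k (.of (.tail 1), attach (.of (.head 1)) (l ++ [v])) +
        (-1 : k) ^ l.length • loopGr k (l.reverse ++ [v]) := by
  rw [boundary_tripod, rootings, List.map_append, List.sum_append, sum_rootingsR_attach _ (by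
    intro w c; simp [joinSign])]
  simp only [rootingsR_of, List.map_cons, List.map_nil, List.sum_singleton, joinSign]
  have h : gr k (.of (.tail 0), l.foldr (fun v c => .of (.hair v) * c) (.of (.head 0)) *
      .of (.hair v)) = (-1 : k) ^ l.length • loopGr k (l.reverse ++ [v]) := by
    rw [gr_swap, ← gr_move, gr_foldr, loopGr, attach_snoc, gr_swap k _ (attach _ _), ← gr_move,
      gr_attach, List.reverse_reverse, List.length_reverse, smul_neg, smul_smul, ← mul_pow]
    simp
  rw [h, gr_swap, attach_snoc]
  simp

theorem loopGr_slide (s : ℕ) (l : List H) (v : H) (hl : l.length + 1 = s) :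
    loopGr k (l ++ [v]) - (-1 : k) ^ l.length • loopGr k (l.reverse ++ [v]) ∈
      edgeRel k H ⊔ bdS₂Part k H s 1 := by
  -- The surviving edge of the first term is named `1`; shifting names identifies it with the
  -- standard loop.
  have h1 : loopGr k (l ++ [v]) - gr k (.of (.tail 1), attach (.of (.head 1)) (l ++ [v])) ∈
      edgeRel k H := by
    refine Submodule.subset_span (Or.inr ⟨_, Nat.succ, isHairy_loop (l ++ [v]),
      Nat.succ_injective, ?_⟩)
    rw [relabel, map_attach _ (fun v => rfl)]
    rfl
  have e : leaves₂ (((.of (.hair v), .of (.tail 0) * .of (.tail 1)),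
      (.of (.head 0), attach (.of (.head 1)) l)) : UTree (Leaf H) × UTree (Leaf H)) =
      .hair v :: .tail 0 :: .tail 1 :: .head 0 :: .head 1 :: l.map Leaf.hair := by
    simp [leaves₂, leaves, leavesR_attach]
  have h2 : boundary k ((.of (.hair v), .of (.tail 0) * .of (.tail 1)),
        (.of (.head 0), attach (.of (.head 1)) l)) ∈ bdS₂Part k H s 1 := by
    refine Submodule.subset_span ⟨_, IsS₂.slide _ _ _ _ ⟨0, Or.inl ⟨rfl, ?_⟩⟩
      ⟨1, Or.inl ⟨rfl, ?_⟩⟩ ?_, ?_, ?_, rfl⟩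
    · simp [leaves]
    · simp [leaves, leavesR_attach]
    · rw [e, Matched]
      simp only [List.filterMap_cons, Leaf.tail?, Leaf.head?, tails_map_hair, heads_map_hair]
      simp
    · rw [e, numEdges]
      simp only [List.filterMap_cons, Leaf.tail?, tails_map_hair]
      rfl
    · rw [e, ← hl, ← numHairs_map_hair l]
      rfl
  rw [boundary_slide_loop] at h2
  have := sub_mem (Submodule.mem_sup_left h1 : _ ∈ edgeRel k H ⊔ bdS₂Part k H s 1)
    (Submodule.mem_sup_right h2)
  convert this using 1
  abel

/-- The slide relation reverses all hairs but the last one, and switching the edge reverses all of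
them. Their composition is the rotation by one step, and the signs cancel. -/
theorem loopGr_rotate (s : ℕ) (l : List H) (v : H) (hl : l.length + 1 = s) :
    loopGr k (v :: l) - loopGr k (l ++ [v]) ∈ edgeRel k H ⊔ bdS₂Part k H s 1 := by
  have h1 := loopGr_slide k s l v hl
  have h2 : loopGr k (v :: l) + (-1 : k) ^ (l.length + 1) • loopGr k (l.reverse ++ [v]) ∈
      edgeRel k H ⊔ bdS₂Part k H s 1 := by
    have := loopGr_reverse k (l.reverse ++ [v])
    simp only [List.reverse_append, List.reverse_reverse, List.reverse_singleton,
      List.length_append, List.length_reverse, List.length_singleton, List.singleton_append] at this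
    exact Submodule.mem_sup_left this
  have := sub_mem h2 h1
  convert this using 1
  rw [pow_succ]
  simp only [mul_neg, mul_one, neg_smul]
  abel

/-! ### Loops as a map from dihedral coinvariants, and the isomorphism -/

theorem loopGr_ofFn_mem {s : ℕ} (v : Fin s → H) : loopGr k (List.ofFn v) ∈ PreC₁Part k H s 1 :=
  loopTree_mem v

theorem ofFn_update {α : Type*} {s : ℕ} [DecidableEq (Fin s)] (v : Fin s → α) (i : Fin s) (x : α) :
    List.ofFn (Function.update v i x) =
      (List.ofFn v).take i ++ x :: (List.ofFn v).drop (i + 1) := by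
  have h : List.ofFn (Function.update v i x) = (List.ofFn v).set i x := by
    refine List.ext_getElem (by simp) fun j h1 h2 => ?_
    simp only [List.getElem_ofFn, List.getElem_set, Function.update_apply, Fin.ext_iff, eq_comm]
  rw [h, List.set_eq_take_append_cons_drop, if_pos (by simp)]

variable (H) in
/-- The loop with given hairs, as a multilinear map. -/
def loopMulti (s : ℕ) : MultilinearMap k (fun _ : Fin s => H) (OmegaPart k H s 1) where
  toFun := loopClass k
  map_update_add' v i x y := by
    have := gr_attach_linear k (.of (.tail 0)) (.of (.head 0)) 1 x y
      ((List.ofFn v).take i) ((List.ofFn v).drop (i + 1))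
    rw [one_smul, one_smul, ← ofFn_update, ← ofFn_update, ← ofFn_update] at this
    exact congrArg (Submodule.mkQ _) (Subtype.ext this)
  map_update_smul' v i r x := by
    have := gr_attach_smul k (.of (.tail 0)) (.of (.head 0)) r x
      ((List.ofFn v).take i) ((List.ofFn v).drop (i + 1))
    rw [← ofFn_update, ← ofFn_update] at this
    exact congrArg (Submodule.mkQ _) (Subtype.ext this)

theorem loopClass_eq_of_mem {s : ℕ} {v w : Fin s → H} {r : k}
    (h : loopGr k (List.ofFn v) - r • loopGr k (List.ofFn w) ∈ edgeRel k H ⊔ bdS₂Part k H s 1) :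
    loopClass k v = r • loopClass k w := by
  rw [loopClass, loopClass, ← map_smul, ← sub_eq_zero, ← map_sub]
  exact (Submodule.Quotient.mk_eq_zero _).2 h

theorem loopClass_rotate {s : ℕ} (v : Fin s → H) :
    loopClass k (fun i => v ((finRotate s).symm i)) = loopClass k v := by
  cases s with
  | zero => exact congrArg _ (Subsingleton.elim _ _)
  | succ n =>
    -- The rotated family starts with the last entry of `v`, so it is `cons` where `v` is `snoc`.
    have h1 : v = fun i => Fin.cons (α := fun _ => H) (v (Fin.last n)) (Fin.init v)
        (finRotate _ i) := by
      rw [← Fin.snoc_eq_cons_rotate, Fin.snoc_init_self]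
    have h2 : (fun i => v ((finRotate (n + 1)).symm i)) =
        Fin.cons (α := fun _ => H) (v (Fin.last n)) (Fin.init v) := by
      funext i
      rw [congrFun h1 ((finRotate (n + 1)).symm i), Equiv.apply_symm_apply]
    rw [h2, ← one_smul k (loopClass k v)]
    refine loopClass_eq_of_mem k ?_
    have h3 : List.ofFn v = List.ofFn (Fin.init v) ++ [v (Fin.last n)] := by
      rw [List.ofFn_succ', List.concat_eq_append]
      rfl
    rw [List.ofFn_cons, h3, one_smul]
    exact loopGr_rotate k _ _ _ (by simp)

theorem loopClass_reverse {s : ℕ} (v : Fin s → H) :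
    loopClass k v = (-1 : k) ^ (s + 1) • loopClass k (fun i => v ((Fin.revPerm (n := s)).symm i)) := by
  refine loopClass_eq_of_mem k (Submodule.mem_sup_left ?_)
  have h := loopGr_reverse k (List.ofFn v)
  rw [ofFn_rev, List.length_ofFn] at h
  have h2 := Submodule.smul_mem _ ((-1 : k) ^ s) h
  rw [smul_add, smul_smul, ← mul_pow, neg_one_mul, neg_neg, one_pow, one_smul, add_comm] at h2
  convert h2 using 1
  rw [pow_succ, mul_neg, mul_one, neg_smul, sub_neg_eq_add]
  rfl

variable (H) in
/-- The inverse of `omegaTrace`. -/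
def omegaLoop (s : ℕ) : DihCoinv k H s →ₗ[k] OmegaPart k H s 1 :=
  Submodule.liftQ _ (PiTensorProduct.lift (loopMulti k H s)) <| by
    rw [sup_le_iff, LinearMap.range_le_ker_iff, LinearMap.range_le_ker_iff]
    constructor
    · ext v
      simp only [LinearMap.compMultilinearMap_apply, LinearMap.comp_apply, LinearMap.sub_apply,
        LinearEquiv.coe_coe, LinearMap.id_apply, map_sub, LinearMap.zero_apply, sub_eq_zero]
      rw [rot, PiTensorProduct.reindex_tprod, PiTensorProduct.lift.tprod,
        PiTensorProduct.lift.tprod]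
      exact loopClass_rotate k v
    · ext v
      simp only [LinearMap.compMultilinearMap_apply, LinearMap.comp_apply, LinearMap.sub_apply,
        LinearMap.id_apply, map_sub, LinearMap.zero_apply, sub_eq_zero]
      rw [rev, LinearMap.smul_apply, LinearEquiv.coe_coe, PiTensorProduct.reindex_tprod, map_smul,
        PiTensorProduct.lift.tprod, PiTensorProduct.lift.tprod]
      exact (loopClass_reverse k v).symm

theorem omegaLoop_mk (s : ℕ) (v : Fin s → H) :
    omegaLoop k H s (Submodule.mkQ _ (PiTensorProduct.tprod k v)) = loopClass k v :=
  (Submodule.liftQ_apply _ _ _).trans (PiTensorProduct.lift.tprod _)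

theorem omegaLoop_surjective (s : ℕ) : Function.Surjective (omegaLoop k H s) := by
  intro x
  obtain ⟨⟨x, hx⟩, rfl⟩ := Submodule.mkQ_surjective _ x
  obtain ⟨y, hy, z, hz, rfl⟩ := Submodule.mem_sup.1 (PreC₁Part_le k s hx)
  -- Membership in `PreC₁Part` is carried through the induction, because the class of `y` in the
  -- quotient makes sense only with it.
  have key : ∀ y ∈ attachSpan k (.of (.tail 0)) (.of (.head 0)) s, ∃ hy : y ∈ PreC₁Part k H s 1,
      ∃ w, omegaLoop k H s w = Submodule.mkQ _ ⟨y, hy⟩ := by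
    intro y hy
    induction hy using Submodule.span_induction with
    | mem y hy =>
      obtain ⟨l, hl, rfl⟩ := hy
      obtain ⟨v, rfl⟩ := exists_eq_ofFn hl
      exact ⟨loopGr_ofFn_mem k v, _, omegaLoop_mk k s v⟩
    | zero => exact ⟨zero_mem _, 0, by rw [map_zero]; exact (map_zero _).symm⟩
    | add y z _ _ hy hz =>
      obtain ⟨hy, w, hw⟩ := hy
      obtain ⟨hz, w', hw'⟩ := hz
      exact ⟨add_mem hy hz, w + w', by rw [map_add, hw, hw', ← map_add]; rfl⟩
    | smul r y _ hy =>
      obtain ⟨hy, w, hw⟩ := hy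
      exact ⟨Submodule.smul_mem _ _ hy, r • w, by rw [map_smul, hw, ← map_smul]; rfl⟩
  obtain ⟨hy', w, hw⟩ := key y hy
  refine ⟨w, hw.trans ?_⟩
  rw [eq_comm, ← sub_eq_zero, ← map_sub]
  refine (Submodule.Quotient.mk_eq_zero _).2 (Submodule.mem_sup_left (?_ : (y + z) - y ∈ _))
  rwa [add_sub_cancel_left]

theorem omegaTrace_omegaLoop (s : ℕ) (hs : 2 ≤ s) (x : DihCoinv k H s) :
    omegaTrace k H s hs (omegaLoop k H s x) = x := by
  obtain ⟨x, rfl⟩ := Submodule.mkQ_surjective _ x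
  suffices h : omegaTrace k H s hs ∘ₗ omegaLoop k H s ∘ₗ Submodule.mkQ _ = Submodule.mkQ _ from
    LinearMap.congr_fun h x
  ext v
  simp only [LinearMap.compMultilinearMap_apply, LinearMap.comp_apply]
  rw [omegaLoop_mk, omegaTrace_loopClass]

variable (H) in
/-- The isomorphism `Ω_{s,1}(H) ≅ [H^{⊗s}]_{D_{2s}}`. -/
def omegaEquiv (s : ℕ) (hs : 2 ≤ s) : OmegaPart k H s 1 ≃ₗ[k] DihCoinv k H s :=
  (LinearEquiv.ofBijective (omegaLoop k H s)
    ⟨Function.LeftInverse.injective (omegaTrace_omegaLoop k s hs), omegaLoop_surjective k s⟩).symm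

theorem omegaEquiv_apply (s : ℕ) (hs : 2 ≤ s) (x : OmegaPart k H s 1) :
    omegaEquiv k H s hs x = omegaTrace k H s hs x := by
  rw [omegaEquiv, LinearEquiv.symm_apply_eq]
  obtain ⟨y, rfl⟩ := omegaLoop_surjective k s x
  rw [omegaTrace_omegaLoop]
  rfl

end Loops

/-! ### The part of rank one of `Tr^C` -/

section TraceFormula

variable (k : Type u) [Field k] {H : Type v} [AddCommGroup H] [Module k H]

theorem numEdges_replace (t : UTree (Leaf H)) (p q : H × UTree (Leaf H))
    (hp : p ∈ replace (.tail 0) (relabel (Leaf.rename Nat.succ) t))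
    (hq : q ∈ replace (.head 0) p.2) : numEdges (leaves q.2) = numEdges (leaves t) + 1 := by
  obtain ⟨l, h1, h2⟩ := replace_perm _ _ p hp
  obtain ⟨l', h3, h4⟩ := replace_perm _ _ q hq
  have e1 := numEdges_perm h1
  have e2 := numEdges_perm (h2.symm.trans h3)
  have e3 := numEdges_perm h4
  rw [numEdges_relabel_rename] at e1
  have a1 : ∀ (v : H) l, numEdges (.hair v :: l) = numEdges l := fun _ _ => rfl
  have a2 : ∀ (e : ℕ) (l : List (Leaf H)), numEdges (.tail e :: l) = numEdges l + 1 := fun _ _ => rfl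
  have a3 : ∀ (e : ℕ) (l : List (Leaf H)), numEdges (.head e :: l) = numEdges l := fun _ _ => rfl
  rw [a1] at e1
  rw [a2, a1] at e2
  rw [a3] at e3
  omega

theorem addEdge_gr_mem (ω : LinearMap.BilinForm k H) (t : UTree (Leaf H)) :
    addEdge ω (gr k t) ∈ Submodule.span k {x | ∃ w : UTree (Leaf H),
      numEdges (leaves w) = numEdges (leaves t) + 1 ∧ numHairs (leaves w) + 2 = numHairs (leaves t) ∧
      x = gr k w} := by
  rw [addEdge_gr]
  refine Submodule.smul_mem _ _ (list_sum_mem fun y hy => ?_)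
  obtain ⟨p, hp, rfl⟩ := List.mem_map.1 hy
  refine list_sum_mem fun y hy => ?_
  obtain ⟨q, hq, rfl⟩ := List.mem_map.1 hy
  exact Submodule.smul_mem _ _ (Submodule.subset_span
    ⟨q.2, numEdges_replace t p q hp hq, (replace_replace t p q hp hq).1, rfl⟩)

theorem addEdge_pow_gr_mem (ω : LinearMap.BilinForm k H) (n : ℕ) (t : UTree (Leaf H)) :
    (addEdge ω ^ n) (gr k t) ∈ Submodule.span k {x | ∃ w : UTree (Leaf H),
      numEdges (leaves w) = numEdges (leaves t) + n ∧ x = gr k w} := by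
  induction n with
  | zero => exact Submodule.subset_span ⟨t, rfl, rfl⟩
  | succ n ih =>
    rw [pow_succ', Module.End.mul_apply]
    refine (Submodule.span_le (p := (Submodule.span k _).comap (addEdge ω))).2 ?_ ih
    rintro _ ⟨w, hw, rfl⟩
    refine Submodule.span_mono ?_ (addEdge_gr_mem k ω w)
    rintro _ ⟨w', hw', -, rfl⟩
    exact ⟨w', by omega, rfl⟩

theorem prePart_addEdge_pow (ω : LinearMap.BilinForm k H) (s n : ℕ) (hn : n ≠ 1)
    (t : UTree (Leaf H)) (ht : numEdges (leaves t) = 0) :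
    prePart k H s 1 ((addEdge ω ^ n) (gr k t)) = 0 := by
  refine (Submodule.span_le (p := LinearMap.ker (prePart k H s 1))).2 ?_ (addEdge_pow_gr_mem k ω n t)
  rintro _ ⟨w, hw, rfl⟩
  rw [SetLike.mem_coe, LinearMap.mem_ker, prePart_gr, if_neg]
  omega

theorem prePart_addEdge (ω : LinearMap.BilinForm k H) (s : ℕ)
    (t : UTree (Leaf H)) (ht : numEdges (leaves t) = 0) (ht' : numHairs (leaves t) = s + 2) :
    prePart k H s 1 (addEdge ω (gr k t)) = addEdge ω (gr k t) := by
  refine (Submodule.span_le (p := LinearMap.eqLocus (prePart k H s 1) LinearMap.id)).2 ?_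
    (addEdge_gr_mem k ω t)
  rintro _ ⟨w, hw, hw', rfl⟩
  exact (prePart_gr s 1 w).trans (if_pos (by omega))

/-- Each application of `T` adds exactly one edge and removes two hairs. Starting without edges,
only the term `n = 1` of the exponential has rank one, and it has the right number of hairs. -/
theorem prePart_expAddEdge (ω : LinearMap.BilinForm k H) (s : ℕ)
    (t : UTree (Leaf H)) (ht : numEdges (leaves t) = 0) (ht' : numHairs (leaves t) = s + 2) :
    prePart k H s 1 (expAddEdge ω (gr k t)) = addEdge ω (gr k t) := by
  have h : prePart k H s 1 (expAddEdge ω (gr k t)) = ∑ᶠ n : ℕ, prePart k H s 1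
      (((n.factorial : k)⁻¹) • (addEdge ω ^ n) (gr k t)) :=
    (prePart k H s 1).toAddMonoidHom.map_finsum (finite_support_exp ω (gr k t))
  rw [h, finsum_eq_single _ 1]
  · rw [pow_one, map_smul, prePart_addEdge k ω s t ht ht']
    simp
  · intro n hn
    rw [map_smul, prePart_addEdge_pow k ω s n hn t ht, smul_zero]

/-- Replacing a hair by `ℓ` and recutting at that leaf is the same as rooting the tree there. This
turns the first sum in `T` into the sum over roots in `η`. -/
theorem hairSum_root (ℓ : Leaf H) (a b : FreeMagma H) :
    hairSum ℓ (FreeMagma.map Leaf.hair a) (fun v c => v ⊗ₜ[k] gr k (c, FreeMagma.map Leaf.hair b)) =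
      ((rootingsR a b).map fun q => q.1 ⊗ₜ[k] gr k (.of ℓ, FreeMagma.map Leaf.hair q.2)).sum := by
  induction a generalizing b with
  | ih1 v => simp [hairSum, replaceR]
  | ih2 a₁ a₂ h1 h2 =>
    have e1 : ∀ c, gr k (c * FreeMagma.map Leaf.hair a₂, FreeMagma.map Leaf.hair b) =
        gr k (c, FreeMagma.map Leaf.hair (a₂ * b)) := fun c => by rw [gr_move, map_mul]
    have e2 : ∀ c, gr k (FreeMagma.map Leaf.hair a₁ * c, FreeMagma.map Leaf.hair b) =
        gr k (c, FreeMagma.map Leaf.hair (b * a₁)) := fun c => by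
      rw [map_mul]; exact treeMk_rotate k _ _ _ _
    rw [map_mul, hairSum_mul, rootingsR_mul, List.map_append, List.sum_append, ← h1, ← h2]
    simp only [e1, e2]

theorem detach_hair (ℓ : Leaf H) (t : UTree H) :
    detach k ℓ (gr k (relabel Leaf.hair t)) =
      ((rootings t).map fun q => q.1 ⊗ₜ[k] gr k (.of ℓ, FreeMagma.map Leaf.hair q.2)).sum := by
  rw [detach_gr]
  change detachTree k ℓ (relabel Leaf.hair t) = _
  rw [relabel, detachTree_eq, hairSum_root]
  simp only [gr_flip (FreeMagma.map Leaf.hair t.1)]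
  rw [hairSum_root, ← List.sum_append, ← List.map_append]
  rfl

theorem comm_map_hair (a : FreeMagma H) :
    comm (hairWord k) (FreeMagma.map Leaf.hair a) = comm (TensorAlgebra.ι k) a :=
  (firstLetter_map (hairWord k) Leaf.hair (fun _ => (0 : k)) a).2

theorem leavesR_map {X Y : Type v} (f : X → Y) (a : FreeMagma X) :
    leavesR (FreeMagma.map f a) = (leavesR a).map f := by
  induction a with
  | ih1 x => rfl
  | ih2 a b ha hb => simp [ha, hb]

theorem firstLetter_leafInd_hair (e : Leaf H) (he : e.IsEnd) (a : FreeMagma H) :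
    firstLetter (hairWord k) (leafInd k e) (FreeMagma.map Leaf.hair a) = 0 := by
  refine firstLetter_eq_zero _ _ fun x hx => if_neg ?_
  rw [leavesR_map] at hx
  obtain ⟨v, -, rfl⟩ := List.mem_map.1 hx
  exact fun h => he v h.symm

/-- Among the words of the commutator with one hair replaced by `e`, the indicator of `e` selects
those that begin at that place. Summing over all hairs with weights `φ` evaluates `φ` on the first
letter. -/
theorem hairSum_firstLetter (φ : H → k) (e : Leaf H) (he : e.IsEnd) (a : FreeMagma H) :
    hairSum e (FreeMagma.map Leaf.hair a) (fun v c => φ v • firstLetter (hairWord k) (leafInd k e) c) =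
      firstLetter (TensorAlgebra.ι k) φ a := by
  induction a with
  | ih1 v => 
    have h : leafInd k e e = 1 := if_pos rfl
    simp [hairSum, replaceR, h, Algebra.algebraMap_eq_smul_one]
  | ih2 a b ha hb =>
    have h1 : ∀ (l : FreeMagma (Leaf H)) (y : TensorAlgebra k H),
        hairSum e l (fun v c => φ v • firstLetter (hairWord k) (leafInd k e) c) * y =
        hairSum e l (fun v c => φ v • (firstLetter (hairWord k) (leafInd k e) c * y)) := by
      intro l y
      simp only [hairSum, List.sum_map_mul_right, ← smul_mul_assoc]
    rw [map_mul, hairSum_mul, firstLetter_mul, ← ha, ← hb, h1, h1, sub_eq_add_neg]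
    simp only [firstLetter_mul, firstLetter_leafInd_hair k e he, zero_mul, sub_zero, zero_sub,
      comm_map_hair]
    congr 1
    have h2 := hairSum_smul (-1 : k) e (FreeMagma.map Leaf.hair b)
      (fun v c => φ v • (firstLetter (hairWord k) (leafInd k e) c * comm (TensorAlgebra.ι k) a))
    rw [neg_one_smul] at h2
    rw [h2]
    simp

variable {k} in
/-- Contraction of the two detached labels with the form. -/
def contractLabels (ω : LinearMap.BilinForm k H) :
    H ⊗[k] (H ⊗[k] PreGraph k H) →ₗ[k] PreGraph k H :=
  (TensorProduct.lid k (PreGraph k H)).toLinearMap ∘ₗ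
    (TensorProduct.lift ω).rTensor (PreGraph k H) ∘ₗ
    (TensorProduct.assoc k H H (PreGraph k H)).symm.toLinearMap

theorem contractLabels_tmul (ω : LinearMap.BilinForm k H) (v w : H) (x : PreGraph k H) :
    contractLabels ω (v ⊗ₜ (w ⊗ₜ x)) = ω v w • x := by
  simp [contractLabels]

theorem loopTrace_contractLabels (ω : LinearMap.BilinForm k H) (s : ℕ) (v : H) (c : FreeMagma H) :
    loopTrace k H s (contractLabels ω (v ⊗ₜ detach k (.head 0)
      (gr k (.of (.tail 0), FreeMagma.map Leaf.hair c)))) =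
      dih k H s (firstLetter (TensorAlgebra.ι k) (ω v) c) := by
  have hh : (Leaf.head 0 : Leaf H).IsEnd := fun v hv => by cases hv
  have ht : (Leaf.tail 0 : Leaf H).IsEnd := fun v hv => by cases hv
  rw [detach_gr]
  change loopTrace k H s (contractLabels ω (v ⊗ₜ detachTree k _ _)) = _
  rw [detachTree_eq, ← hairSum_firstLetter k (ω v) _ hh]
  have h0 : hairSum (.head 0) (.of (Leaf.tail 0 : Leaf H)) (fun v c' => v ⊗ₜ[k]
      gr k (c', FreeMagma.map Leaf.hair c)) = 0 := rfl
  rw [h0, zero_add]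
  have h1 : ∀ z, loopTrace k H s (contractLabels ω (v ⊗ₜ z)) =
      (loopTrace k H s ∘ₗ contractLabels ω ∘ₗ TensorProduct.mk k H _ v) z := fun z => rfl
  rw [h1, hairSum, hairSum, map_list_sum, map_list_sum, List.map_map, List.map_map]
  refine congrArg List.sum (List.map_congr_left fun p hp => ?_)
  simp only [Function.comp_apply, LinearMap.comp_apply, TensorProduct.mk_apply, contractLabels_tmul,
    map_smul]
  obtain ⟨l, h2, h3⟩ := replaceR_perm _ _ p hp
  obtain ⟨hs, rfl⟩ : ∃ hs : List H, l = hs.map Leaf.hair := by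
    refine exists_eq_map_hair fun x hx => ?_
    have := h2.symm.subset (List.mem_cons_of_mem _ hx)
    rw [leavesR_map] at this
    obtain ⟨w, -, rfl⟩ := List.mem_map.1 this
    exact ⟨w, rfl⟩
  have h4 := loopTrace_root k s ht (c := p.2) (hs := hs) h3
  have h5 : joinSign k (Leaf.tail 0 : Leaf H) (Leaf.tail 0).opp = 1 := by
    simp [joinSign, Leaf.opp]
  rw [h4, h5, one_smul]
  rfl

/-- The hair that becomes the tail is the root, and the hair that becomes the head is the first
letter. So the sum over ordered pairs of hairs is the whole trace, and the half in `addEdge`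
remains. -/
theorem loopTrace_addEdge (ω : LinearMap.BilinForm k H) (s : ℕ) (t : UTree H) :
    loopTrace k H s (addEdge ω (gr k (relabel Leaf.hair t))) =
      (2⁻¹ : k) • dih k H s (algTrace (TensorAlgebra.ι k) (fun x y => ω x y) t) := by
  -- A tree without external edges has no names to shift.
  have h0 : shift k H (gr k (relabel Leaf.hair t)) = gr k (relabel Leaf.hair t) := by
    have key : ∀ a : FreeMagma H, FreeMagma.map (Leaf.rename Nat.succ) (FreeMagma.map Leaf.hair a) =
        FreeMagma.map (Leaf.hair : H → Leaf H) a := by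
      intro a
      induction a with
      | ih1 x => rfl
      | ih2 a b ha hb => simp only [map_mul, ha, hb]
    rw [shift_gr, relabel, relabel, key, key]
  have h1 : addEdge ω (gr k (relabel Leaf.hair t)) = (2⁻¹ : k) • contractLabels ω
      ((detach k (.head 0)).lTensor H (detach k (.tail 0) (shift k H (gr k (relabel Leaf.hair t))))) :=
    rfl
  rw [h1, h0, detach_hair, map_smul]
  congr 1
  have h2 : ∀ z, loopTrace k H s (contractLabels ω ((detach k (.head 0)).lTensor H z)) =
      (loopTrace k H s ∘ₗ contractLabels ω ∘ₗ (detach k (.head 0)).lTensor H) z := fun z => rfl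
  rw [h2, map_list_sum, algTrace, map_list_sum, List.map_map, List.map_map]
  refine congrArg List.sum (List.map_congr_left fun q hq => ?_)
  exact loopTrace_contractLabels k ω s q.1 q.2

theorem omegaTrace_trC [CharZero k] (ω : LinearMap.BilinForm k H) (s : ℕ) (hs : 2 ≤ s)
    (t : TDeg k H s) : omegaTrace k H s hs (projOmega k H s 1 le_rfl (trC ω t)) =
      (1 / 2 : k) • cycToDih k H s (trES ω s (eta k H s t)) := by
  obtain ⟨x, hx⟩ := t
  have h1 : projOmega k H s 1 le_rfl (trC ω x) = Submodule.mkQ _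
      ⟨prePart k H s 1 (expAddEdge ω (inclT k H x)), prePart_mem s 1 _ (trCKV ω x).2⟩ := rfl
  rw [h1, omegaTrace_mk, trES_eta, one_div]
  change loopTrace k H s (prePart k H s 1 (expAddEdge ω (inclT k H x))) =
    (2⁻¹ : k) • cycToDih k H s (trTree k ω s x)
  refine (Submodule.span_le (p := LinearMap.eqLocus
    (loopTrace k H s ∘ₗ prePart k H s 1 ∘ₗ expAddEdge ω ∘ₗ inclT k H)
    ((2⁻¹ : k) • (cycToDih k H s ∘ₗ trTree k ω s)))).2 ?_ hx
  rintro _ ⟨t, ht, rfl⟩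
  change loopTrace k H s (prePart k H s 1 (expAddEdge ω (inclT k H (treeMk k id t)))) =
    (2⁻¹ : k) • cycToDih k H s (trTree k ω s (treeMk k id t))
  rw [inclT_mk, prePart_expAddEdge, loopTrace_addEdge, trTree_mk, cycToDih_cyc]
  · rw [numEdges, tails_hair, List.length_nil]
  · rw [leaves_relabel, numHairs_map_hair, leaves, List.length_append, leavesR_length,
      leavesR_length, ← ht, trivalent]
    omega

end TraceFormula

end Johnson

end

/-! ### The theorem -/

open Johnson
theorem mainTheorem5 {k : Type*} {H : Type*} [Field k] [CharZero k] [AddCommGroup H] [Module k H]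
    [FiniteDimensional k H] (ω : LinearMap.BilinForm k H) (hω : ω.IsAlt) (hnd : ω.Nondegenerate) :
    (∀ s : ℕ,
      (∀ d : D k H s, revCyc k H s (trES ω s d) = trES ω s d) ∧
      Function.Bijective ((cycToDih k H s).domRestrict
        (LinearMap.ker (revCyc k H s - LinearMap.id)))) ∧
    (∀ s : ℕ, Function.Bijective (eta k H s)) ∧
    (∀ s : ℕ, 2 ≤ s → ∃ Φ : OmegaPart k H s 1 ≃ₗ[k] DihCoinv k H s,
      (∀ v : Fin s → H, Φ (loopClass k v) = Submodule.mkQ _ (PiTensorProduct.tprod k v)) ∧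
      ∀ t : TDeg k H s, Φ (projOmega k H s 1 le_rfl (trC ω t)) =
        (1 / 2 : k) • cycToDih k H s (trES ω s (eta k H s t))) := by
  refine ⟨fun s => ⟨revCyc_trES k ω hω s, cycToDih_bijective k s⟩,
    fun s => ⟨eta_injective k H s, eta_surjective k H s⟩, fun s hs =>
    ⟨omegaEquiv k H s hs, fun v => ?_, fun t => ?_⟩⟩
  · rw [omegaEquiv_apply, omegaTrace_loopClass]
  · rw [omegaEquiv_apply, omegaTrace_trC]
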